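/- Let $n\ge1$, $p>1$, $q\ge1$, $b\in\mathbb R$, and let $u_0,h\in BC^1(\mathbb R^n)=\{\phi\in C^1(\mathbb R^n):\phi,\nabla\phi\in L^\infty(\mathbb R^n)\}$ with $h\ge0$. Consider the problem $$u_t-\Delta u=|u|^p+b|\nabla u|^q+h(x)\ \text{ in }(0,T)\times\mathbb R^n,\qquad u(0,\cdot)=u_0 .$$ A classical solution on $[0,\sigma)$ is a function $u\in C^{1,2}((0,\sigma)\times\mathbb R^n)$, with $u,\nabla u$ bounded and continuous on $[0,\sigma)\times\mathbb R^n$, which satisfies the equation in $(0,\sigma)\times\mathbb R^n$ and $u(0,\cdot)=u_0$. Let $u$ be the maximal classical solution and $T\in(0,\infty]$ its existence time, i.e. $u$ is a classical solution on $[0,\sigma)$ for every finite $\sigma\in(0,T)$ and it cannot be continued as a classical solution to any $[0,\sigma)$ with $\sigma>T$. (i) Assume that $u(t,x)\le M$ for all $(t,x)\in(0,\min(T,\tau))\times\mathbb R^n$, for some $M,\tau>0$. Then there exists a positive constant $N=N(p,M,\tau,\|u_0\|_{C^1},\|\nabla h\|_\infty)$, where $\|u_0\|_{C^1}=\|u_0\|_\infty+\|\nabla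 u_0\|_\infty$, such that $$|\nabla u(t,x)|\le N\quad\text{for all }(t,x)\in(0,\min(T,\tau))\times\mathbb R^n .$$ (ii) If $T<\infty$, then $$\limsup_{t\to T^-}\Bigl(\sup_{x\in\mathbb R^n}u(t,x)\Bigr)=\infty .$$ -/

import Mathlib

open Set Filter Topology
open scoped Laplacian Gradient

noncomputable section

/-- `BC¹(ℝⁿ)`: the `C¹` functions which are bounded together with their gradient. -/
structure IsBC1 {n : ℕ} (φ : EuclideanSpace ℝ (Fin n) → ℝ) : Prop where
  contDiff : ContDiff ℝ 1 φ
  bounded : ∃ C : ℝ, ∀ x, |φ x| ≤ C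
  gradient_bounded : ∃ C : ℝ, ∀ x, ‖∇ φ x‖ ≤ C

/-- `‖∇φ‖_∞`, the supremum of `|∇φ|` over `ℝⁿ` (meaningful for bounded gradients). -/
def gradSupNorm {n : ℕ} (φ : EuclideanSpace ℝ (Fin n) → ℝ) : ℝ :=
  ⨆ x, ‖∇ φ x‖

/-- `‖φ‖_{C¹} = ‖φ‖_∞ + ‖∇φ‖_∞` (meaningful for `φ ∈ BC¹(ℝⁿ)`). -/
def c1Norm {n : ℕ} (φ : EuclideanSpace ℝ (Fin n) → ℝ) : ℝ :=
  (⨆ x, |φ x|) + gradSupNorm φ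

/-- `u` is a classical solution on `[0, σ) × ℝⁿ` of the Cauchy problem
`u_t - Δu = |u|^p + b |∇u|^q + h(x)`, `u(0, ·) = u₀`: it is of class `C^{1,2}` on
`(0, σ) × ℝⁿ`, the functions `u` and `∇u` are bounded and continuous on `[0, σ) × ℝⁿ`, the
equation holds pointwise in `(0, σ) × ℝⁿ`, and the initial value is attained.
Values of `u` at times outside `[0, σ)` are irrelevant. -/
structure IsClassicalSolution {n : ℕ} (p q b : ℝ) (h u₀ : EuclideanSpace ℝ (Fin n) → ℝ)
    (σ : ℝ) (u : ℝ → EuclideanSpace ℝ (Fin n) → ℝ) : Prop where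
  differentiableAt_time : ∀ t ∈ Ioo 0 σ, ∀ x, DifferentiableAt ℝ (fun s => u s x) t
  contDiff_space : ∀ t ∈ Ioo 0 σ, ContDiff ℝ 2 (u t)
  continuousOn_deriv_time :
    ContinuousOn (fun z : ℝ × EuclideanSpace ℝ (Fin n) => deriv (fun s => u s z.2) z.1)
      (Ioo 0 σ ×ˢ univ)
  continuousOn_second_deriv :
    ContinuousOn (fun z : ℝ × EuclideanSpace ℝ (Fin n) => iteratedFDeriv ℝ 2 (u z.1) z.2)
      (Ioo 0 σ ×ˢ univ)
  continuousOn :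
    ContinuousOn (fun z : ℝ × EuclideanSpace ℝ (Fin n) => u z.1 z.2) (Ico 0 σ ×ˢ univ)
  continuousOn_gradient :
    ContinuousOn (fun z : ℝ × EuclideanSpace ℝ (Fin n) => ∇ (u z.1) z.2) (Ico 0 σ ×ˢ univ)
  bounded : ∃ C : ℝ, ∀ t ∈ Ico 0 σ, ∀ x, |u t x| ≤ C
  gradient_bounded : ∃ C : ℝ, ∀ t ∈ Ico 0 σ, ∀ x, ‖∇ (u t) x‖ ≤ C
  equation : ∀ t ∈ Ioo 0 σ, ∀ x,
    deriv (fun s => u s x) t - Δ (u t) x = |u t x| ^ p + b * ‖∇ (u t) x‖ ^ q + h x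
  initial : ∀ x, u 0 x = u₀ x

/-- `u` is a maximal classical solution, with existence time `T ∈ (0, ∞]`: its restriction to
`[0, σ) × ℝⁿ` is a classical solution for every finite `σ < T`, and no classical solution which
coincides with `u` as long as both are defined lives beyond `T`. -/
structure IsMaximalClassicalSolution {n : ℕ} (p q b : ℝ)
    (h u₀ : EuclideanSpace ℝ (Fin n) → ℝ) (T : EReal)
    (u : ℝ → EuclideanSpace ℝ (Fin n) → ℝ) : Prop where
  time_pos : 0 < T
  solution : ∀ σ : ℝ, 0 < σ → (σ : EReal) < T → IsClassicalSolution p q b h u₀ σ u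
  maximal : ∀ (σ : ℝ) (v : ℝ → EuclideanSpace ℝ (Fin n) → ℝ), 0 < σ →
    IsClassicalSolution p q b h u₀ σ v →
    (∀ t : ℝ, 0 ≤ t → t < σ → (t : EReal) < T → ∀ x, v t x = u t x) → (σ : EReal) ≤ T

end

/-! The gradient bound comes from comparing `u` with its spatial translates. Constants carry no
gradient term, and `h` and `|u|^p` are nonnegative, so `-‖u₀‖_∞` is a lower barrier (`neg_le`). With
`u ≤ M` this gives `|u| ≤ R = max M ‖u₀‖_{C¹}`. For fixed `y`, the difference `w = u(t, x + y) -
u(t, x)` satisfies, where `w > 0`, `w_t - Δw ≤ K w + L |∇w| + ‖∇h‖_∞ |y|` with `K = p R^(p-1)`. The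
constant `L` involves `b`, `q` and some bound of `∇u` on the time interval, which is finite by
definition of a classical solution. The maximum principle on the whole space
(`nonpos_of_parabolic_inequality`) yields `w ≤ e^{Kt}(‖∇u₀‖_∞ + ‖∇h‖_∞ t) |y|`, from which `L` has
disappeared (`sub_le`). Letting `y → 0` bounds `∇u` independently of `b`, `q` and `n`.

For the blow-up, suppose `T < ∞` and the limsup is finite. Then `u` is bounded above on `(0, T)`,
hence bounded in `C¹` by the first part. The local existence time depends on the datum only through
a `C¹` bound (`exists_isClassicalSolution`), so a solution started at some `t₀` close to `T` lives
beyond `T`. By `unique` it agrees with `u` on `[t₀, T)`, and gluing the two (`glue`) contradicts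
maximality.

Most of the work is local existence. The heat semigroup is written as a Gaussian expectation, and
the nonlinearity is truncated to a bounded Lipschitz one. The integral equation for the pair `(u,
Du)` is solved by contraction, since one derivative of the heat kernel costs only the integrable
factor `r^{-1/2}`. A bounded source makes `u` and `Du` 1/2-Hölder in space, hence the source is
Hölder too. Then `D²` of the kernel costs only `r^{-3/4}`, so `D²u` exists and is continuous. The
time derivative follows from the semigroup law. For short times the truncation is inactive. -/

/-! ### The standard Gaussian measure: density, rotation invariance, covariance -/

section GaussianDensity

open MeasureTheory ProbabilityTheory
open scoped RealInnerProductSpace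

variable {E : Type*} [NormedAddCommGroup E] [InnerProductSpace ℝ E] [FiniteDimensional ℝ E]
  [MeasurableSpace E] [BorelSpace E]

lemma integrable_exp_neg_mul_norm_sub_sq {b : ℝ} (hb : 0 < b) (x : E) :
    Integrable (fun y : E => Real.exp (-b * ‖y - x‖ ^ 2)) := by
  have h := (GaussianFourier.integrable_cexp_neg_mul_sq_norm_add (V := E) (b := (b : ℂ))
    (by simpa using hb) 0 0).re
  have h' : Integrable (fun y : E => Real.exp (-b * ‖y‖ ^ 2)) := by
    refine h.congr (Eventually.of_forall fun y => ?_)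
    simp only [inner_zero_left, Complex.ofReal_zero, mul_zero, add_zero, RCLike.re_to_complex]
    rw [← Complex.exp_ofReal_re]
    push_cast
    rfl
  exact h'.comp_sub_right x

/-- The normalising constant of the Gaussian density. -/
noncomputable def gaussianConst (E : Type*) [NormedAddCommGroup E] [InnerProductSpace ℝ E]
    [FiniteDimensional ℝ E] [MeasurableSpace E] [BorelSpace E] : ℝ :=
  (∫ v : E, Real.exp (-(1 / 2) * ‖v‖ ^ 2))⁻¹

lemma gaussianConst_nonneg : 0 ≤ gaussianConst E := by
  unfold gaussianConst
  exact inv_nonneg.2 (integral_nonneg fun _ => (Real.exp_pos _).le)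

lemma integral_withDensity_gaussian {F : Type*} [NormedAddCommGroup F] [NormedSpace ℝ F]
    (f : E → F) :
    ∫ z, f z ∂((volume : Measure E).withDensity
        fun z => ENNReal.ofReal (gaussianConst E * Real.exp (-(1 / 2) * ‖z‖ ^ 2))) =
      ∫ z, (gaussianConst E * Real.exp (-(1 / 2) * ‖z‖ ^ 2)) • f z := by
  rw [integral_withDensity_eq_integral_toReal_smul (by fun_prop)
    (Eventually.of_forall fun _ => ENNReal.ofReal_lt_top)]
  refine integral_congr_ae (Eventually.of_forall fun z => ?_)
  simp only
  rw [ENNReal.toReal_ofReal (mul_nonneg gaussianConst_nonneg (Real.exp_pos _).le)]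

/-- Both measures are finite and have the same Fourier transform. The density is what allows
derivatives to be moved from a function onto the kernel. -/
lemma stdGaussian_eq_withDensity :
    stdGaussian E = (volume : Measure E).withDensity
      fun z => ENNReal.ofReal (gaussianConst E * Real.exp (-(1 / 2) * ‖z‖ ^ 2)) := by
  have hint : Integrable (fun z : E => gaussianConst E * Real.exp (-(1 / 2) * ‖z‖ ^ 2)) := by
    simpa using (integrable_exp_neg_mul_norm_sub_sq (E := E) (b := 1 / 2) (by norm_num) 0).const_mul
      (gaussianConst E)
  have : IsFiniteMeasure ((volume : Measure E).withDensity
      fun z => ENNReal.ofReal (gaussianConst E * Real.exp (-(1 / 2) * ‖z‖ ^ 2))) :=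
    isFiniteMeasure_withDensity_ofReal hint.2
  apply Measure.ext_of_charFun
  ext t
  rw [charFun_stdGaussian, charFun_apply, integral_withDensity_gaussian]
  have h1 : ∀ z : E, (gaussianConst E * Real.exp (-(1 / 2) * ‖z‖ ^ 2)) •
      Complex.exp (⟪z, t⟫ * Complex.I) = (gaussianConst E : ℂ) *
        Complex.exp (-((1 / 2 : ℂ)) * ‖z‖ ^ 2 + Complex.I * ⟪t, z⟫) := by
    intro z
    rw [Complex.exp_add, Complex.real_smul, real_inner_comm, mul_comm Complex.I]
    push_cast
    ring
  simp_rw [h1]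
  rw [integral_const_mul, GaussianFourier.integral_cexp_neg_mul_sq_norm_add (by norm_num)]
  have h2 : (gaussianConst E : ℂ) * (Real.pi / (1 / 2 : ℂ)) ^ (Module.finrank ℝ E / 2 : ℂ) = 1 := by
    rw [← GaussianFourier.integral_cexp_neg_mul_sq_norm (V := E) (by norm_num)]
    have h3 : ∫ v : E, Complex.exp (-(1 / 2 : ℂ) * ‖v‖ ^ 2) =
        ((∫ v : E, Real.exp (-(1 / 2) * ‖v‖ ^ 2) : ℝ) : ℂ) := by
      rw [← integral_complex_ofReal]
      refine integral_congr_ae (Eventually.of_forall fun z => ?_)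
      push_cast
      rfl
    rw [h3, gaussianConst, ← Complex.ofReal_mul, inv_mul_cancel₀, Complex.ofReal_one]
    rw [GaussianFourier.integral_rexp_neg_mul_sq_norm (by norm_num)]
    positivity
  rw [← mul_assoc, h2, one_mul, Complex.I_sq]
  congr 1
  ring

lemma integral_stdGaussian {F : Type*} [NormedAddCommGroup F] [NormedSpace ℝ F] (f : E → F) :
    ∫ z, f z ∂(stdGaussian E) =
      ∫ z, (gaussianConst E * Real.exp (-(1 / 2) * ‖z‖ ^ 2)) • f z := by
  rw [stdGaussian_eq_withDensity, integral_withDensity_gaussian]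

lemma integrable_norm_sq_stdGaussian : Integrable (fun z : E => ‖z‖ ^ 2) (stdGaussian E) :=
  (IsGaussian.memLp_two_id (μ := stdGaussian E)).integrable_norm_pow (by norm_num)

/-- Rotation invariance: a combination of independent standard Gaussian vectors is Gaussian. -/
lemma map_add_stdGaussian_prod (a b c : ℝ) (h : c ^ 2 = a ^ 2 + b ^ 2) :
    ((stdGaussian E).prod (stdGaussian E)).map (fun w => a • w.1 + b • w.2) =
      (stdGaussian E).map (fun z => c • z) := by
  have : IsProbabilityMeasure (((stdGaussian E).prod (stdGaussian E)).map
    (fun w => a • w.1 + b • w.2)) := Measure.isProbabilityMeasure_map (by fun_prop)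
  have : IsProbabilityMeasure ((stdGaussian E).map (fun z => c • z)) :=
    Measure.isProbabilityMeasure_map (by fun_prop)
  apply Measure.ext_of_charFun
  ext t
  rw [charFun_apply, charFun_apply, integral_map (by fun_prop) (by fun_prop),
    integral_map (by fun_prop) (by fun_prop)]
  have h1 : ∀ w : E × E, Complex.exp (⟪a • w.1 + b • w.2, t⟫ * Complex.I) =
      Complex.exp (⟪w.1, a • t⟫ * Complex.I) * Complex.exp (⟪w.2, b • t⟫ * Complex.I) := by
    intro w
    rw [← Complex.exp_add, inner_add_left, real_inner_smul_left, real_inner_smul_left,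
      real_inner_smul_right, real_inner_smul_right]
    push_cast
    ring_nf
  have h2 : ∀ z : E, ⟪c • z, t⟫ = ⟪z, c • t⟫ := fun z => by
    rw [real_inner_smul_left, real_inner_smul_right]
  simp_rw [h1, h2]
  rw [integral_prod_mul (fun z : E => Complex.exp (⟪z, a • t⟫ * Complex.I))
    (fun z : E => Complex.exp (⟪z, b • t⟫ * Complex.I)), ← charFun_apply, ← charFun_apply,
    ← charFun_apply, charFun_stdGaussian, charFun_stdGaussian, charFun_stdGaussian,
    ← Complex.exp_add]
  congr 1
  simp only [norm_smul, Real.norm_eq_abs, mul_pow, Complex.ofReal_mul]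
  rw [← Complex.ofReal_pow |c|, ← Complex.ofReal_pow |a|, ← Complex.ofReal_pow |b|, sq_abs, sq_abs,
    sq_abs, h]
  push_cast
  ring

/-- The covariance is the identity; this is why the generator of the semigroup is the Laplacian. -/
lemma integral_inner_mul_inner_stdGaussian (v w : E) :
    ∫ z, ⟪v, z⟫ * ⟪w, z⟫ ∂(stdGaussian E) = ⟪v, w⟫ := by
  have h := congrArg (fun B => B v w) (covarianceBilin_stdGaussian (E := E))
  change _ = ⟪v, w⟫ at h
  rw [covarianceBilin_apply IsGaussian.memLp_two_id] at h
  simpa using h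

end GaussianDensity

/-! ### The heat semigroup and its spatial derivatives -/

section HeatSemigroup

set_option linter.unusedSectionVars false

open MeasureTheory ProbabilityTheory
open scoped RealInnerProductSpace

variable {E : Type*} [NormedAddCommGroup E] [InnerProductSpace ℝ E] [FiniteDimensional ℝ E]
  [MeasurableSpace E] [BorelSpace E]
variable {F : Type*} [NormedAddCommGroup F] [NormedSpace ℝ F]

/-- The heat semigroup at time `s² / 2`: `heat s f x = 𝔼 f (x + s Z)`, `Z` standard Gaussian. -/
noncomputable def heat (s : ℝ) (f : E → F) (x : E) : F :=
  ∫ z, f (x + s • z) ∂(stdGaussian E)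

/-- The derivative of `heat s f` at `x`, `s⁻¹ 𝔼 (⟪Z, ·⟫ f (x + s Z))`. -/
noncomputable def heatD (s : ℝ) (f : E → F) (x : E) : E →L[ℝ] F :=
  s⁻¹ • ∫ z, (innerSL ℝ z).smulRight (f (x + s • z)) ∂(stdGaussian E)

/-- The second derivative of `heat s f` at `x`. -/
noncomputable def heatH (s : ℝ) (f : E → F) (x : E) : E →L[ℝ] E →L[ℝ] F :=
  heatD (s / √2) (heatD (s / √2) f) x

/-- The expectation `𝔼 (1 + ‖Z‖²)`, `Z` standard Gaussian. -/
noncomputable def gaussianMoment (E : Type*) [NormedAddCommGroup E] [InnerProductSpace ℝ E]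
    [FiniteDimensional ℝ E] [MeasurableSpace E] [BorelSpace E] : ℝ :=
  ∫ z : E, (1 + ‖z‖ ^ 2) ∂(stdGaussian E)

lemma integrable_one_add_norm_sq : Integrable (fun z : E => 1 + ‖z‖ ^ 2) (stdGaussian E) :=
  (integrable_const _).add integrable_norm_sq_stdGaussian

lemma gaussianMoment_nonneg : 0 ≤ gaussianMoment E :=
  integral_nonneg fun z => by positivity

lemma continuous_smulRight_shift {f : E → F} (hf : Continuous f) (s : ℝ) (x : E) :
    Continuous (fun z : E => (innerSL ℝ z).smulRight (f (x + s • z))) := by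
  have h : Continuous fun z : E => f (x + s • z) := hf.comp (by fun_prop)
  exact ((ContinuousLinearMap.smulRightL ℝ E F).continuous.comp
    (innerSL ℝ).continuous).clm_apply h

/-- The crude majorant `1 + ‖z‖²` replaces `‖z‖` here and `‖z‖^{3/2}` in the Hölder estimate, so a
single moment serves throughout. -/
lemma norm_smulRight_shift_le {f : E → F} {C : ℝ} (hC : ∀ x, ‖f x‖ ≤ C) (s : ℝ) (x z : E) :
    ‖(innerSL ℝ z).smulRight (f (x + s • z))‖ ≤ C * (1 + ‖z‖ ^ 2) := by
  rw [ContinuousLinearMap.norm_smulRight_apply, innerSL_apply_norm, mul_comm]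
  have h0 : 0 ≤ C := (norm_nonneg _).trans (hC x)
  have : ‖z‖ ≤ 1 + ‖z‖ ^ 2 := by nlinarith [sq_nonneg (‖z‖ - 1)]
  exact mul_le_mul (hC _) this (norm_nonneg _) h0

lemma integrable_heat {f : E → F} (hf : Continuous f) {C : ℝ} (hC : ∀ x, ‖f x‖ ≤ C)
    (s : ℝ) (x : E) : Integrable (fun z => f (x + s • z)) (stdGaussian E) :=
  Integrable.of_bound (hf.comp (by fun_prop)).aestronglyMeasurable C
    (Eventually.of_forall fun _ => hC _)

lemma integrable_heatD {f : E → F} (hf : Continuous f) {C : ℝ} (hC : ∀ x, ‖f x‖ ≤ C)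
    (s : ℝ) (x : E) :
    Integrable (fun z => (innerSL ℝ z).smulRight (f (x + s • z))) (stdGaussian E) :=
  (integrable_one_add_norm_sq.const_mul C).mono'
    (continuous_smulRight_shift hf s x).aestronglyMeasurable
    (Eventually.of_forall fun z => norm_smulRight_shift_le hC s x z)

lemma norm_heat_le {f : E → F} {C : ℝ} (hC : ∀ x, ‖f x‖ ≤ C) (s : ℝ) (x : E) :
    ‖heat s f x‖ ≤ C := by
  have := norm_integral_le_of_norm_le_const (μ := stdGaussian E) (f := fun z => f (x + s • z))
    (Eventually.of_forall fun _ => hC _)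
  simpa [heat] using this

lemma norm_heatD_le {f : E → F} {C : ℝ} (hC : ∀ x, ‖f x‖ ≤ C) {s : ℝ} (hs : 0 ≤ s) (x : E) :
    ‖heatD s f x‖ ≤ s⁻¹ * (C * gaussianMoment E) := by
  rw [heatD, norm_smul, Real.norm_of_nonneg (inv_nonneg.2 hs)]
  refine mul_le_mul_of_nonneg_left ?_ (inv_nonneg.2 hs)
  rw [gaussianMoment, ← integral_const_mul]
  exact norm_integral_le_of_norm_le (integrable_one_add_norm_sq.const_mul C)
    (Eventually.of_forall fun z => norm_smulRight_shift_le hC s x z)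

lemma integral_innerSL_smulRight_const [CompleteSpace F] (c : F) :
    ∫ z : E, (innerSL ℝ z).smulRight c ∂(stdGaussian E) = 0 := by
  let Φ : E →L[ℝ] E →L[ℝ] F :=
    ((ContinuousLinearMap.smulRightL ℝ E F).flip c).comp
      ((innerSL ℝ : E →L⋆[ℝ] E →L[ℝ] ℝ) : E →L[ℝ] E →L[ℝ] ℝ)
  have h : ∀ z : E, (innerSL ℝ z).smulRight c = Φ z := fun z => rfl
  simp_rw [h]
  have h0 : ∫ z : E, z ∂(stdGaussian E) = 0 := integral_id_stdGaussian
  rw [Φ.integral_comp_comm (φ := fun z => z) IsGaussian.integrable_id, h0, map_zero]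

/-- The kernel of `heatD` has mean zero, so constants may be subtracted. With `c = f x`, Hölder
continuity of `f` then gains a factor `√s`. -/
lemma heatD_eq_sub [CompleteSpace F] {f : E → F} (hf : Continuous f) {C : ℝ} (hC : ∀ x, ‖f x‖ ≤ C)
    (s : ℝ) (x : E) (c : F) :
    heatD s f x = s⁻¹ • ∫ z, (innerSL ℝ z).smulRight (f (x + s • z) - c) ∂(stdGaussian E) := by
  have h : ∀ z : E, (innerSL ℝ z).smulRight (f (x + s • z) - c) =
      (innerSL ℝ z).smulRight (f (x + s • z)) - (innerSL ℝ z).smulRight c := by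
    intro z
    ext w
    simp [smul_sub]
  simp_rw [h]
  rw [integral_sub (integrable_heatD hf hC s x)
    (integrable_heatD (f := fun _ => c) continuous_const (fun _ => le_rfl) s x),
    integral_innerSL_smulRight_const, sub_zero, heatD]

lemma norm_heatD_le_of_holder [CompleteSpace F] {f : E → F} (hf : Continuous f) {C K : ℝ} (hC : ∀ x, ‖f x‖ ≤ C)
    (hK : ∀ x y, ‖f x - f y‖ ≤ K * √‖x - y‖) (hK0 : 0 ≤ K) {s : ℝ} (hs : 0 ≤ s) (x : E) :
    ‖heatD s f x‖ ≤ s⁻¹ * √s * (K * gaussianMoment E) := by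
  rw [heatD_eq_sub hf hC s x (f x), norm_smul, Real.norm_of_nonneg (inv_nonneg.2 hs), mul_assoc]
  refine mul_le_mul_of_nonneg_left ?_ (inv_nonneg.2 hs)
  rw [gaussianMoment, ← integral_const_mul, ← integral_const_mul]
  refine norm_integral_le_of_norm_le ((integrable_one_add_norm_sq.const_mul _).const_mul _)
    (Eventually.of_forall fun z => ?_)
  rw [ContinuousLinearMap.norm_smulRight_apply, innerSL_apply_norm]
  have h1 : ‖f (x + s • z) - f x‖ ≤ K * (√s * √‖z‖) := by
    have := hK (x + s • z) x
    rwa [add_sub_cancel_left, norm_smul, Real.norm_of_nonneg hs, Real.sqrt_mul hs] at this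
  have h2 : ‖z‖ * √‖z‖ ≤ 1 + ‖z‖ ^ 2 := by
    have h3 : √‖z‖ ^ 2 = ‖z‖ := Real.sq_sqrt (norm_nonneg z)
    have h4 := Real.sqrt_nonneg ‖z‖
    nlinarith [sq_nonneg (√‖z‖ - 1), sq_nonneg (‖z‖ - 1), norm_nonneg z]
  calc ‖z‖ * ‖f (x + s • z) - f x‖ ≤ ‖z‖ * (K * (√s * √‖z‖)) := by gcongr
    _ = √s * (K * (‖z‖ * √‖z‖)) := by ring
    _ ≤ √s * (K * (1 + ‖z‖ ^ 2)) := by gcongr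

lemma hasFDerivAt_gaussian_translate (y x : E) :
    HasFDerivAt (fun x : E => gaussianConst E * Real.exp (-(1 / 2) * ‖y - x‖ ^ 2))
      ((gaussianConst E * Real.exp (-(1 / 2) * ‖y - x‖ ^ 2)) • innerSL ℝ (y - x)) x := by
  have h1 : HasFDerivAt (fun x : E => y - x) (-ContinuousLinearMap.id ℝ E) x :=
    (hasFDerivAt_id x).const_sub y
  have h2 := ((h1.norm_sq.const_mul (-(1 / 2))).exp).const_mul (gaussianConst E)
  refine h2.congr_fderiv ?_
  ext v
  simp
  ring

/-- A majorant of the differentiated kernel, uniform for `x` in the unit ball around `x₀`. It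
combines `t ≤ e^{t²/4}` with `(t + 1)² ≤ 2t² + 2`. -/
lemma exp_translate_le {y x x₀ : E} (hx : ‖x - x₀‖ ≤ 1) :
    Real.exp (-(1 / 2) * ‖y - x‖ ^ 2) * ‖y - x‖ ≤
      Real.exp (1 / 4) * Real.exp (-(1 / 8) * ‖y - x₀‖ ^ 2) := by
  set t := ‖y - x‖
  have ht : 0 ≤ t := norm_nonneg _
  have h1 : t ≤ Real.exp (t ^ 2 / 4) := by
    have := Real.add_one_le_exp (t ^ 2 / 4)
    nlinarith [sq_nonneg (t / 2 - 1)]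
  have h2 : ‖y - x₀‖ ≤ t + 1 := by
    calc ‖y - x₀‖ = ‖(y - x) + (x - x₀)‖ := by congr 1; abel
      _ ≤ _ := (norm_add_le _ _).trans (by gcongr)
  calc Real.exp (-(1 / 2) * t ^ 2) * t
      ≤ Real.exp (-(1 / 2) * t ^ 2) * Real.exp (t ^ 2 / 4) := by gcongr
    _ = Real.exp (-(1 / 2) * t ^ 2 + t ^ 2 / 4) := (Real.exp_add _ _).symm
    _ ≤ Real.exp (1 / 4 + -(1 / 8) * ‖y - x₀‖ ^ 2) := by
        apply Real.exp_le_exp.2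
        nlinarith [sq_nonneg (t - 1), norm_nonneg (y - x₀)]
    _ = _ := Real.exp_add _ _

lemma hasFDerivAt_gaussian_conv {g : E → F} (hg : Continuous g) {C : ℝ} (hC : ∀ x, ‖g x‖ ≤ C)
    (x₀ : E) :
    HasFDerivAt
      (fun x => ∫ y, (gaussianConst E * Real.exp (-(1 / 2) * ‖y - x‖ ^ 2)) • g y)
      (∫ y, ((gaussianConst E * Real.exp (-(1 / 2) * ‖y - x₀‖ ^ 2)) •
        innerSL ℝ (y - x₀)).smulRight (g y)) x₀ := by
  have hC0 : 0 ≤ C := (norm_nonneg _).trans (hC x₀)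
  refine hasFDerivAt_integral_of_dominated_of_fderiv_le
    (bound := fun y => gaussianConst E * (Real.exp (1 / 4) *
      Real.exp (-(1 / 8) * ‖y - x₀‖ ^ 2)) * C)
    (F' := fun x y => ((gaussianConst E * Real.exp (-(1 / 2) * ‖y - x‖ ^ 2)) •
        innerSL ℝ (y - x)).smulRight (g y))
    (Metric.ball_mem_nhds x₀ one_pos) ?_ ?_ ?_ ?_ ?_ ?_
  · refine Eventually.of_forall fun x => Continuous.aestronglyMeasurable ?_
    exact Continuous.smul (by fun_prop) hg
  · refine Integrable.mono' (((integrable_exp_neg_mul_norm_sub_sq (E := E) (b := 1 / 2)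
      (by norm_num) x₀).const_mul (gaussianConst E)).mul_const C)
      (Continuous.aestronglyMeasurable (Continuous.smul (by fun_prop) hg))
      (Eventually.of_forall fun y => ?_)
    rw [norm_smul, Real.norm_of_nonneg (mul_nonneg gaussianConst_nonneg (Real.exp_pos _).le)]
    exact mul_le_mul_of_nonneg_left (hC y)
      (mul_nonneg gaussianConst_nonneg (Real.exp_pos _).le)
  · have h : Continuous fun y : E => ((gaussianConst E *
        Real.exp (-(1 / 2) * ‖y - x₀‖ ^ 2)) • innerSL ℝ (y - x₀)).smulRight (g y) := by
      refine ((ContinuousLinearMap.smulRightL ℝ E F).continuous.comp ?_).clm_apply hg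
      have h1 : Continuous fun y : E => gaussianConst E * Real.exp (-(1 / 2) * ‖y - x₀‖ ^ 2) := by
        fun_prop
      have h2 : Continuous fun y : E => y - x₀ := by fun_prop
      exact h1.smul ((innerSL ℝ).continuous.comp h2)
    exact h.aestronglyMeasurable
  · refine Eventually.of_forall fun y x hx => ?_
    rw [ContinuousLinearMap.norm_smulRight_apply, norm_smul, innerSL_apply_norm,
      Real.norm_of_nonneg (mul_nonneg gaussianConst_nonneg (Real.exp_pos _).le)]
    have := exp_translate_le (y := y) (x := x) (x₀ := x₀)
      (by rw [← dist_eq_norm]; exact (Metric.mem_ball.1 hx).le)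
    have h0 := gaussianConst_nonneg (E := E)
    refine mul_le_mul ?_ (hC y) (norm_nonneg _) (by positivity)
    rw [mul_assoc]
    exact mul_le_mul_of_nonneg_left this h0
  · exact ((((integrable_exp_neg_mul_norm_sub_sq (E := E) (b := 1 / 8)
      (by norm_num) x₀).const_mul _).const_mul _).mul_const C)
  · refine Eventually.of_forall fun y x _ => ?_
    exact (hasFDerivAt_gaussian_translate y x).smul_const (g y)

/-- The substitution `y = s⁻¹x + z` turns the expectation into a convolution of `f(s·)` with the
Gaussian, evaluated at `s⁻¹x`. The derivative falls on the kernel, so `f` need only be bounded and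
continuous. -/
lemma hasFDerivAt_heat {f : E → F} (hf : Continuous f) {C : ℝ} (hC : ∀ x, ‖f x‖ ≤ C)
    {s : ℝ} (hs : s ≠ 0) (x : E) : HasFDerivAt (heat s f) (heatD s f x) x := by
  have hg : Continuous fun y : E => f (s • y) := hf.comp (by fun_prop)
  have key := (hasFDerivAt_gaussian_conv hg (fun y => hC (s • y)) (s⁻¹ • x)).comp x
    ((hasFDerivAt_id x).const_smul s⁻¹)
  have e1 : heat s f = (fun x => ∫ y, (gaussianConst E *
      Real.exp (-(1 / 2) * ‖y - x‖ ^ 2)) • f (s • y)) ∘ (fun x => s⁻¹ • x) := by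
    ext x
    rw [heat, integral_stdGaussian, Function.comp_apply,
      ← integral_sub_right_eq_self _ (s⁻¹ • x)]
    refine integral_congr_ae (Eventually.of_forall fun y => ?_)
    simp only
    rw [smul_sub, smul_inv_smul₀ hs, add_sub_cancel]
  rw [e1]
  refine key.congr_fderiv ?_
  rw [heatD, integral_stdGaussian, ContinuousLinearMap.comp_smul, ContinuousLinearMap.comp_id,
    ← integral_sub_right_eq_self (fun z => (gaussianConst E * Real.exp (-(1 / 2) * ‖z‖ ^ 2)) •
      (innerSL ℝ z).smulRight (f (x + s • z))) (s⁻¹ • x)]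
  congr 1
  refine integral_congr_ae (Eventually.of_forall fun y => ?_)
  simp only
  rw [smul_sub, smul_inv_smul₀ hs, add_sub_cancel]
  ext w
  simp [mul_smul]

lemma continuousOn_heat {X : Type*} [TopologicalSpace X] [FirstCountableTopology X] {S : Set X}
    {σ : X → ℝ} {ξ : X → E} {g : X → E → F} (hσ : ContinuousOn σ S) (hξ : ContinuousOn ξ S)
    (hg : ContinuousOn (fun p : X × E => g p.1 p.2) (S ×ˢ univ)) {C : ℝ}
    (hC : ∀ p ∈ S, ∀ y, ‖g p y‖ ≤ C) :
    ContinuousOn (fun p => heat (σ p) (g p) (ξ p)) S := by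
  have hgp : ∀ p ∈ S, Continuous (g p) := fun p hp =>
    hg.comp_continuous (by fun_prop : Continuous fun y : E => (p, y)) fun y => ⟨hp, mem_univ _⟩
  refine continuousOn_of_dominated (bound := fun _ => C) ?_ ?_ (integrable_const _) ?_
  · exact fun p hp => ((hgp p hp).comp (by fun_prop)).aestronglyMeasurable
  · exact fun p hp => Eventually.of_forall fun z => hC p hp _
  · refine Eventually.of_forall fun z => ?_
    exact hg.comp (f := fun p => (p, ξ p + σ p • z))
      (continuousOn_id.prodMk (hξ.add (hσ.smul continuousOn_const)))
      fun p hp => ⟨hp, mem_univ _⟩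

lemma continuousOn_heatD {X : Type*} [TopologicalSpace X] [FirstCountableTopology X] {S : Set X}
    {σ : X → ℝ} {ξ : X → E} {g : X → E → F} (hσ : ContinuousOn σ S) (hξ : ContinuousOn ξ S)
    (hσ0 : ∀ p ∈ S, σ p ≠ 0)
    (hg : ContinuousOn (fun p : X × E => g p.1 p.2) (S ×ˢ univ)) {C : ℝ}
    (hC : ∀ p ∈ S, ∀ y, ‖g p y‖ ≤ C) :
    ContinuousOn (fun p => heatD (σ p) (g p) (ξ p)) S := by
  have hgp : ∀ p ∈ S, Continuous (g p) := fun p hp =>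
    hg.comp_continuous (by fun_prop : Continuous fun y : E => (p, y)) fun y => ⟨hp, mem_univ _⟩
  refine (hσ.inv₀ hσ0).smul ?_
  refine continuousOn_of_dominated (bound := fun z => C * (1 + ‖z‖ ^ 2)) ?_ ?_
    (integrable_one_add_norm_sq.const_mul C) ?_
  · exact fun p hp => (continuous_smulRight_shift (hgp p hp) _ _).aestronglyMeasurable
  · exact fun p hp => Eventually.of_forall fun z => norm_smulRight_shift_le (hC p hp) _ _ _
  · refine Eventually.of_forall fun z => ?_
    have : ContinuousOn (fun p => g p (ξ p + σ p • z)) S :=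
      hg.comp (f := fun p => (p, ξ p + σ p • z))
        (continuousOn_id.prodMk (hξ.add (hσ.smul continuousOn_const)))
        fun p hp => ⟨hp, mem_univ _⟩
    exact (ContinuousLinearMap.smulRightL ℝ E F (innerSL ℝ z)).continuous.comp_continuousOn this

lemma continuous_heat {f : E → F} (hf : Continuous f) {C : ℝ} (hC : ∀ x, ‖f x‖ ≤ C) (s : ℝ) :
    Continuous (heat s f) := by
  rw [← continuousOn_univ]
  exact continuousOn_heat (σ := fun _ => s) (ξ := fun x : E => x) (g := fun _ => f)
    continuousOn_const continuousOn_id (hf.comp continuous_snd).continuousOn fun _ _ => hC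

lemma continuous_heatD {f : E → F} (hf : Continuous f) {C : ℝ} (hC : ∀ x, ‖f x‖ ≤ C) {s : ℝ}
    (hs : s ≠ 0) : Continuous (heatD s f) := by
  rw [← continuousOn_univ]
  exact continuousOn_heatD (σ := fun _ => s) (ξ := fun x : E => x) (g := fun _ => f)
    continuousOn_const continuousOn_id (fun _ _ => hs)
    (hf.comp continuous_snd).continuousOn fun _ _ => hC

/-- The semigroup law: by Fubini and rotation invariance, variances add. -/
lemma heat_heat {f : E → F} (hf : Continuous f) {C : ℝ} (hC : ∀ x, ‖f x‖ ≤ C) {a b c : ℝ}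
    (h : c ^ 2 = a ^ 2 + b ^ 2) (x : E) : heat a (heat b f) x = heat c f x := by
  have hcont : Continuous fun w : E => f (x + w) := hf.comp (by fun_prop)
  have hint : Integrable (fun w : E × E => f (x + (a • w.1 + b • w.2)))
      ((stdGaussian E).prod (stdGaussian E)) :=
    Integrable.of_bound (hcont.comp (by fun_prop)).aestronglyMeasurable C
      (Eventually.of_forall fun _ => hC _)
  calc heat a (heat b f) x
      = ∫ z, ∫ z', f (x + (a • z + b • z')) ∂(stdGaussian E) ∂(stdGaussian E) := by
        simp only [heat, add_assoc]
    _ = ∫ w, f (x + (a • w.1 + b • w.2)) ∂((stdGaussian E).prod (stdGaussian E)) :=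
        (integral_prod _ hint).symm
    _ = ∫ w, f (x + w) ∂(((stdGaussian E).prod (stdGaussian E)).map
          (fun w => a • w.1 + b • w.2)) :=
        (integral_map (by fun_prop) hcont.aestronglyMeasurable).symm
    _ = heat c f x := by
        rw [map_add_stdGaussian_prod a b c h,
          integral_map (by fun_prop) hcont.aestronglyMeasurable, heat]

/-- When `f` is itself `C¹` the derivative can fall on `f`: there is no singular factor, and `s = 0`
is allowed. -/
lemma hasFDerivAt_heat_of_hasFDerivAt {f : E → F} {f' : E → E →L[ℝ] F}
    (hff' : ∀ x, HasFDerivAt f (f' x) x) (hf' : Continuous f') {C C' : ℝ} (hC : ∀ x, ‖f x‖ ≤ C)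
    (hC' : ∀ x, ‖f' x‖ ≤ C') (s : ℝ) (x : E) :
    HasFDerivAt (heat s f) (heat s f' x) x := by
  have hf : Continuous f := continuous_iff_continuousAt.2 fun x => (hff' x).continuousAt
  refine hasFDerivAt_integral_of_dominated_of_fderiv_le (bound := fun _ => C')
    (F := fun x z => f (x + s • z)) (F' := fun x z => f' (x + s • z)) univ_mem ?_
    (integrable_heat hf hC s x) (integrable_heat hf' hC' s x).1 ?_ (integrable_const _) ?_
  · exact Eventually.of_forall fun x => (integrable_heat hf hC s x).1
  · exact Eventually.of_forall fun _ _ _ => hC' _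
  · refine Eventually.of_forall fun z y _ => ?_
    exact (hff' (y + s • z)).comp y ((hasFDerivAt_id y).add_const (s • z))

/-- Two steps of size `s / √2` make one of size `s`, and both sides are the derivative of the same
function. A second derivative can thus be put on the outer step, so that no second-order kernel is
needed. -/
lemma heatD_eq_heat_heatD {f : E → F} (hf : Continuous f) {C : ℝ} (hC : ∀ x, ‖f x‖ ≤ C) {s : ℝ}
    (hs : 0 < s) : heatD s f = heat (s / √2) (heatD (s / √2) f) := by
  have hs' : 0 < s / √2 := by positivity
  ext1 x
  have h1 := hasFDerivAt_heat hf hC hs.ne' x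
  have h2 := hasFDerivAt_heat_of_hasFDerivAt (hasFDerivAt_heat hf hC hs'.ne')
    (continuous_heatD hf hC hs'.ne') (norm_heat_le hC _) (norm_heatD_le hC hs'.le) (s / √2) x
  have h3 : heat (s / √2) (heat (s / √2) f) = heat s f := by
    ext1 y
    refine heat_heat hf hC ?_ y
    rw [div_pow, Real.sq_sqrt zero_le_two]
    ring
  rw [h3] at h2
  exact h1.unique h2

lemma hasFDerivAt_heatD {f : E → F} (hf : Continuous f) {C : ℝ} (hC : ∀ x, ‖f x‖ ≤ C) {s : ℝ}
    (hs : 0 < s) (x : E) : HasFDerivAt (heatD s f) (heatH s f x) x := by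
  have hs' : 0 < s / √2 := by positivity
  rw [heatD_eq_heat_heatD hf hC hs]
  exact hasFDerivAt_heat (continuous_heatD hf hC hs'.ne') (norm_heatD_le hC hs'.le) hs'.ne' x

end HeatSemigroup

/-! ### Singular kernel estimates and regularity of the Duhamel integral -/

section Duhamel

set_option maxSynthPendingDepth 3

set_option linter.unusedSectionVars false

open MeasureTheory ProbabilityTheory
open scoped RealInnerProductSpace

/-- The weight `r ^ (-3/4)`. -/
noncomputable def sing (r : ℝ) : ℝ := r⁻¹ * √√r

lemma sing_nonneg {r : ℝ} (hr : 0 ≤ r) : 0 ≤ sing r := by unfold sing; positivity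

lemma sing_mul {a : ℝ} (ha : 0 ≤ a) (b : ℝ) : sing (a * b) = sing a * sing b := by
  unfold sing
  rw [Real.sqrt_mul ha, Real.sqrt_mul (Real.sqrt_nonneg a), mul_inv]
  ring

lemma sing_eq_rpow {r : ℝ} (hr : 0 < r) : sing r = r ^ (-(3 / 4) : ℝ) := by
  unfold sing
  rw [Real.sqrt_eq_rpow, Real.sqrt_eq_rpow, ← Real.rpow_neg_one, ← Real.rpow_mul hr.le,
    ← Real.rpow_add hr]
  norm_num

lemma inv_sqrt_eq_rpow {r : ℝ} (hr : 0 < r) : (√r)⁻¹ = r ^ (-(1 / 2) : ℝ) := by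
  rw [Real.sqrt_eq_rpow, ← Real.rpow_neg hr.le]

lemma integrableOn_rpow_unit {a : ℝ} (ha : -1 < a) :
    IntegrableOn (fun θ : ℝ => θ ^ a) (Ioo 0 1) := by
  have h := intervalIntegral.intervalIntegrable_rpow' (a := 0) (b := 1) ha
  rw [intervalIntegrable_iff_integrableOn_Ioo_of_le zero_le_one] at h
  exact h

lemma integrableOn_rpow_one_sub {a : ℝ} (ha : -1 < a) :
    IntegrableOn (fun θ : ℝ => (1 - θ) ^ a) (Ioo 0 1) := by
  have h := (intervalIntegral.intervalIntegrable_rpow' (a := 0) (b := 1) ha).comp_sub_left 1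
  rw [sub_zero, sub_self] at h
  have h := h.symm
  rw [intervalIntegrable_iff_integrableOn_Ioo_of_le zero_le_one] at h
  exact h

lemma integrableOn_sing : IntegrableOn (fun θ : ℝ => sing (1 - θ)) (Ioo 0 1) := by
  refine (integrableOn_rpow_one_sub (a := -(3 / 4)) (by norm_num)).congr_fun
    (fun θ hθ => ?_) measurableSet_Ioo
  exact (sing_eq_rpow (by linarith [hθ.2])).symm

lemma integrableOn_inv_sqrt : IntegrableOn (fun θ : ℝ => (√(1 - θ))⁻¹) (Ioo 0 1) := by
  refine (integrableOn_rpow_one_sub (a := -(1 / 2)) (by norm_num)).congr_fun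
    (fun θ hθ => ?_) measurableSet_Ioo
  exact (inv_sqrt_eq_rpow (by linarith [hθ.2])).symm

/-- The two singularities sit at opposite ends: on either side of `1/2` one of the factors is at
most `2`. -/
lemma integrableOn_sing_mul_inv_sqrt :
    IntegrableOn (fun θ : ℝ => sing (1 - θ) * (√θ)⁻¹) (Ioo 0 1) := by
  have h1 : IntegrableOn (fun θ : ℝ => (√θ)⁻¹) (Ioo 0 1) := by
    refine (integrableOn_rpow_unit (a := -(1 / 2)) (by norm_num)).congr_fun
      (fun θ hθ => ?_) measurableSet_Ioo
    exact (inv_sqrt_eq_rpow hθ.1).symm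
  have h2 : IntegrableOn (fun θ : ℝ => 2 * sing (1 - θ) + 2 * (√θ)⁻¹) (Ioo 0 1) :=
    (integrableOn_sing.const_mul 2).add (h1.const_mul 2)
  have hm : Measurable (fun θ : ℝ => sing (1 - θ) * (√θ)⁻¹) := by unfold sing; fun_prop
  refine Integrable.mono' h2 hm.aestronglyMeasurable ?_
  refine (ae_restrict_iff' measurableSet_Ioo).2 (Eventually.of_forall fun θ hθ => ?_)
  have hs : 0 ≤ sing (1 - θ) := sing_nonneg (by linarith [hθ.2])
  have hi : 0 ≤ (√θ)⁻¹ := by positivity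
  rw [Real.norm_of_nonneg (by positivity)]
  rcases le_total θ (1 / 2) with h | h
  · have : sing (1 - θ) ≤ 2 := by
      have h3 : √√(1 - θ) ≤ 1 := by
        rw [Real.sqrt_le_one, Real.sqrt_le_one]; linarith [hθ.1]
      have h4 : (1 - θ)⁻¹ ≤ 2 := by
        rw [inv_le_comm₀ (by linarith) (by norm_num)]; linarith
      calc sing (1 - θ) ≤ 2 * 1 := mul_le_mul h4 h3 (Real.sqrt_nonneg _) (by norm_num)
        _ = 2 := by norm_num
    nlinarith
  · have : (√θ)⁻¹ ≤ 2 := by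
      rw [inv_le_comm₀ (Real.sqrt_pos.2 hθ.1) (by norm_num)]
      exact Real.le_sqrt_of_sq_le (by linarith)
    nlinarith

variable {E : Type*} [NormedAddCommGroup E] [InnerProductSpace ℝ E] [FiniteDimensional ℝ E]
  [MeasurableSpace E] [BorelSpace E]
variable {F : Type*} [NormedAddCommGroup F] [NormedSpace ℝ F] [CompleteSpace F]

lemma one_le_gaussianMoment : 1 ≤ gaussianMoment E := by
  have : (1 : ℝ) = ∫ _ : E, (1 : ℝ) ∂(stdGaussian E) := by simp
  rw [this, gaussianMoment]
  exact integral_mono (integrable_const _) integrable_one_add_norm_sq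
    fun z => by simp

lemma sqrt_two_mul_div_sqrt_two {r : ℝ} : √(2 * r) / √2 = √r := by
  rw [Real.sqrt_mul zero_le_two, mul_div_cancel_left₀]
  positivity

lemma inv_sqrt_two_mul_le {r : ℝ} (hr : 0 ≤ r) : (√(2 * r))⁻¹ ≤ (√r)⁻¹ := by
  rcases hr.eq_or_lt with rfl | hr
  · simp
  · exact inv_anti₀ (Real.sqrt_pos.2 hr) (Real.sqrt_le_sqrt (by linarith))

lemma norm_heatD_sqrt_le {f : E → F} {C : ℝ} (hC : ∀ x, ‖f x‖ ≤ C) {r : ℝ} (hr : 0 ≤ r) (x : E) :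
    ‖heatD √(2 * r) f x‖ ≤ (√r)⁻¹ * (C * gaussianMoment E) := by
  have hC0 : 0 ≤ C := (norm_nonneg _).trans (hC x)
  refine (norm_heatD_le hC (Real.sqrt_nonneg _) x).trans ?_
  exact mul_le_mul_of_nonneg_right (inv_sqrt_two_mul_le hr)
    (mul_nonneg hC0 gaussianMoment_nonneg)

lemma norm_heatH_le {f : E → F} {C : ℝ} (hC : ∀ x, ‖f x‖ ≤ C) {r : ℝ} (hr : 0 < r) (x : E) :
    ‖heatH √(2 * r) f x‖ ≤ r⁻¹ * (C * gaussianMoment E ^ 2) := by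
  rw [heatH, sqrt_two_mul_div_sqrt_two]
  refine (norm_heatD_le (norm_heatD_le hC (Real.sqrt_nonneg _)) (Real.sqrt_nonneg _) x).trans ?_
  have h : √r * √r = r := Real.mul_self_sqrt hr.le
  apply le_of_eq
  nth_rewrite 3 [← h]
  rw [mul_inv]
  ring

/-- The inner half-step gains `r^{1/4}` from Hölder continuity. The factor `r⁻¹` of a merely bounded
`f`, not integrable at `0`, improves to `r^{-3/4}`. -/
lemma norm_heatH_le_of_holder {f : E → F} (hf : Continuous f) {C K : ℝ} (hC : ∀ x, ‖f x‖ ≤ C)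
    (hK : ∀ x y, ‖f x - f y‖ ≤ K * √‖x - y‖) (hK0 : 0 ≤ K) {r : ℝ} (hr : 0 < r) (x : E) :
    ‖heatH √(2 * r) f x‖ ≤ sing r * (K * gaussianMoment E ^ 2) := by
  rw [heatH, sqrt_two_mul_div_sqrt_two]
  refine (norm_heatD_le (norm_heatD_le_of_holder hf hC hK hK0 (Real.sqrt_nonneg _))
    (Real.sqrt_nonneg _) x).trans ?_
  have h : √r * √r = r := Real.mul_self_sqrt hr.le
  apply le_of_eq
  rw [sing]
  nth_rewrite 4 [← h]
  rw [mul_inv]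
  ring

/-- Interpolation between a uniform bound and a Lipschitz bound. -/
lemma norm_sub_le_of_bound_of_lip {G : Type*} [NormedAddCommGroup G] {a b : G} {A q d : ℝ}
    (hA : 0 ≤ A) (hq : 0 < q) (hd : 0 ≤ d) (h1 : ‖a - b‖ ≤ 2 * A) (h2 : ‖a - b‖ ≤ A * q⁻¹ ^ 2 * d) :
    ‖a - b‖ ≤ 2 * A * q⁻¹ * √d := by
  have h3 : √d ^ 2 = d := Real.sq_sqrt hd
  have h4 := Real.sqrt_nonneg d
  have h5 : q⁻¹ * q = 1 := inv_mul_cancel₀ hq.ne'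
  have h6 : 0 < q⁻¹ := inv_pos.2 hq
  rcases le_total (√d) q with h | h
  · have h7 : q⁻¹ * √d ≤ 1 := by rw [← h5]; gcongr
    have h8 : 0 ≤ q⁻¹ * √d := by positivity
    calc ‖a - b‖ ≤ A * q⁻¹ ^ 2 * d := h2
      _ = A * (q⁻¹ * √d) * (q⁻¹ * √d) := by rw [← h3, Real.sqrt_sq h4]; ring
      _ ≤ A * (q⁻¹ * √d) * 1 := by gcongr
      _ ≤ 2 * A * q⁻¹ * √d := by nlinarith [mul_nonneg hA h8]
  · have h7 : 1 ≤ q⁻¹ * √d := by rw [← h5]; gcongr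
    nlinarith

lemma norm_image_sub_le_of_hasFDerivAt {G : Type*} [NormedAddCommGroup G] [NormedSpace ℝ G]
    {f : E → G} {f' : E → E →L[ℝ] G} {C : ℝ} (hf : ∀ x, HasFDerivAt f (f' x) x)
    (hC : ∀ x, ‖f' x‖ ≤ C) (x y : E) : ‖f x - f y‖ ≤ C * ‖x - y‖ :=
  convex_univ.norm_image_sub_le_of_norm_hasFDerivWithin_le
    (fun z _ => (hf z).hasFDerivWithinAt) (fun z _ => hC z) (mem_univ y) (mem_univ x)

/-- Interpolation between the sup bound and the Lipschitz constant of order `r^{-1/2}`, with `q =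
r^{1/4}`. -/
lemma heat_holder {f : E → F} (hf : Continuous f) {C : ℝ} (hC : ∀ x, ‖f x‖ ≤ C) {r : ℝ}
    (hr : 0 < r) (x y : E) :
    ‖heat √(2 * r) f x - heat √(2 * r) f y‖ ≤
      2 * (C * gaussianMoment E) * (√√r)⁻¹ * √‖x - y‖ := by
  have hC0 : 0 ≤ C := (norm_nonneg _).trans (hC x)
  have hm := one_le_gaussianMoment (E := E)
  refine norm_sub_le_of_bound_of_lip (by positivity) (Real.sqrt_pos.2 (Real.sqrt_pos.2 hr))
    (norm_nonneg _) ?_ ?_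
  · refine (norm_sub_le _ _).trans ?_
    nlinarith [norm_heat_le hC √(2 * r) x, norm_heat_le hC √(2 * r) y]
  · refine (norm_image_sub_le_of_hasFDerivAt (hasFDerivAt_heat hf hC (by positivity))
      (norm_heatD_sqrt_le hC hr.le) x y).trans (le_of_eq ?_)
    rw [inv_pow, Real.sq_sqrt (Real.sqrt_nonneg _)]
    ring

/-- Interpolation between the sup bound of order `r^{-1/2}` and the Lipschitz bound of order `r⁻¹`;
their geometric mean `r^{-3/4}` is integrable in time. -/
lemma heatD_holder {f : E → F} (hf : Continuous f) {C : ℝ} (hC : ∀ x, ‖f x‖ ≤ C) {r : ℝ}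
    (hr : 0 < r) (x y : E) :
    ‖heatD √(2 * r) f x - heatD √(2 * r) f y‖ ≤
      2 * (C * gaussianMoment E ^ 2) * sing r * √‖x - y‖ := by
  have hC0 : 0 ≤ C := (norm_nonneg _).trans (hC x)
  have hm := one_le_gaussianMoment (E := E)
  have h2 : √r * √r = r := Real.mul_self_sqrt hr.le
  have h3 : √√r * √√r = √r := Real.mul_self_sqrt (Real.sqrt_nonneg _)
  have hq : 0 < √√r := Real.sqrt_pos.2 (Real.sqrt_pos.2 hr)
  have h4 : (√r)⁻¹ = (√√r)⁻¹ ^ 2 := by nth_rewrite 1 [← h3]; rw [mul_inv]; ring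
  have h5 : r⁻¹ = (√√r)⁻¹ ^ 4 := by
    nth_rewrite 1 [← h2]; rw [mul_inv, h4]; ring
  have h6 : sing r = (√√r)⁻¹ ^ 3 := by
    rw [sing, h5]
    field_simp
  have := norm_sub_le_of_bound_of_lip (a := heatD √(2 * r) f x) (b := heatD √(2 * r) f y)
    (A := (√r)⁻¹ * (C * gaussianMoment E ^ 2)) (q := √√r) (d := ‖x - y‖) (by positivity) hq
    (norm_nonneg _) ?_ ?_
  · refine this.trans (le_of_eq ?_)
    rw [h6, h4]
    ring
  · refine (norm_sub_le _ _).trans ?_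
    have h7 : (√r)⁻¹ * (C * gaussianMoment E) ≤ (√r)⁻¹ * (C * gaussianMoment E ^ 2) := by
      have : gaussianMoment E ≤ gaussianMoment E ^ 2 := by nlinarith
      gcongr
    linarith [norm_heatD_sqrt_le hC hr.le x, norm_heatD_sqrt_le hC hr.le y]
  · refine (norm_image_sub_le_of_hasFDerivAt (hasFDerivAt_heatD hf hC (by positivity))
      (norm_heatH_le hC hr) x y).trans (le_of_eq ?_)
    rw [h5, h4]
    ring

/-- The Duhamel integral `∫₀ᵗ e^{(t-s)Δ} g(s) ds`, rescaled to the unit interval. -/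
noncomputable def duh (g : ℝ → E → F) (t : ℝ) (x : E) : F :=
  t • ∫ θ in Ioo (0 : ℝ) 1, heat √(2 * (t - t * θ)) (g (t * θ)) x

/-- The spatial derivative of the Duhamel integral. -/
noncomputable def duhD (g : ℝ → E → F) (t : ℝ) (x : E) : E →L[ℝ] F :=
  t • ∫ θ in Ioo (0 : ℝ) 1, heatD √(2 * (t - t * θ)) (g (t * θ)) x

/-- The second spatial derivative of the Duhamel integral. -/
noncomputable def duhH (g : ℝ → E → F) (t : ℝ) (x : E) : E →L[ℝ] E →L[ℝ] F :=
  t • ∫ θ in Ioo (0 : ℝ) 1, heatH √(2 * (t - t * θ)) (g (t * θ)) x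

lemma sub_mul_pos {t θ : ℝ} (ht : 0 < t) (hθ : θ ∈ Ioo (0 : ℝ) 1) : 0 < t - t * θ := by
  nlinarith [hθ.2]

section Regularity

variable {g : ℝ → E → F} (hg : Continuous fun p : ℝ × E => g p.1 p.2) {C : ℝ}
  (hC : ∀ s x, ‖g s x‖ ≤ C)

include hg in
lemma continuous_source (s : ℝ) : Continuous (g s) :=
  hg.comp (by fun_prop : Continuous fun y : E => (s, y))

include hg hC in
lemma continuous_heat_source :
    Continuous fun q : ℝ × ℝ × E => heat q.1 (g q.2.1) q.2.2 := by
  rw [← continuousOn_univ]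
  refine continuousOn_heat (σ := fun q : ℝ × ℝ × E => q.1) (ξ := fun q => q.2.2)
    (g := fun q => g q.2.1) (by fun_prop) (by fun_prop) ?_ fun q _ => hC q.2.1
  exact (hg.comp (by fun_prop :
    Continuous fun w : (ℝ × ℝ × E) × E => (w.1.2.1, w.2))).continuousOn

include hg hC in
lemma continuousOn_heatD_source :
    ContinuousOn (fun q : ℝ × ℝ × E => heatD q.1 (g q.2.1) q.2.2) {q | 0 < q.1} := by
  refine continuousOn_heatD (σ := fun q : ℝ × ℝ × E => q.1) (ξ := fun q => q.2.2)
    (g := fun q => g q.2.1) (by fun_prop) (by fun_prop) (fun q hq => (ne_of_gt hq)) ?_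
    fun q _ => hC q.2.1
  exact (hg.comp (by fun_prop :
    Continuous fun w : (ℝ × ℝ × E) × E => (w.1.2.1, w.2))).continuousOn

include hg hC in
-- The inner `heatD` is bounded uniformly only away from time zero, so continuity is proved locally,
-- on `q.1 / 2 < p.1`.
lemma continuousOn_heatH_source :
    ContinuousOn (fun q : ℝ × ℝ × E => heatH q.1 (g q.2.1) q.2.2) {q | 0 < q.1} := by
  intro q hq
  have hC0 : 0 ≤ C := (norm_nonneg _).trans (hC 0 0)
  have hq0 : 0 < q.1 := hq
  set S : Set (ℝ × ℝ × E) := {p | q.1 / 2 < p.1}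
  have hS : IsOpen S := isOpen_lt continuous_const continuous_fst
  have hqS : q ∈ S := half_lt_self hq0
  have key : ContinuousOn (fun q : ℝ × ℝ × E => heatH q.1 (g q.2.1) q.2.2) S := by
    refine continuousOn_heatD (σ := fun q : ℝ × ℝ × E => q.1 / √2) (ξ := fun q => q.2.2)
      (g := fun q => heatD (q.1 / √2) (g q.2.1)) (by fun_prop) (by fun_prop) ?_ ?_
      (C := (q.1 / 2 / √2)⁻¹ * (C * gaussianMoment E)) ?_
    · intro p hp
      have : 0 < p.1 := (half_pos hq0).trans hp
      positivity
    · refine (continuousOn_heatD_source hg hC).comp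
        (f := fun w : (ℝ × ℝ × E) × E => (w.1.1 / √2, w.1.2.1, w.2)) (by fun_prop) ?_
      rintro w ⟨hw, -⟩
      have : 0 < w.1.1 := (half_pos hq0).trans hw
      change 0 < w.1.1 / √2
      positivity
    · intro p hp y
      have hp' : q.1 / 2 < p.1 := hp
      have : 0 < p.1 := (half_pos hq0).trans hp
      refine (norm_heatD_le (hC _) (by positivity) y).trans ?_
      have hm := gaussianMoment_nonneg (E := E)
      gcongr
  exact (key.continuousAt (hS.mem_nhds hqS)).continuousWithinAt

include hg hC in
lemma aestronglyMeasurable_heatD_source {t : ℝ} (ht : 0 < t) (x : E) :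
    AEStronglyMeasurable (fun θ => heatD √(2 * (t - t * θ)) (g (t * θ)) x)
      (volume.restrict (Ioo (0 : ℝ) 1)) := by
  refine ContinuousOn.aestronglyMeasurable ?_ measurableSet_Ioo
  refine (continuousOn_heatD_source hg hC).comp
    (f := fun θ : ℝ => (√(2 * (t - t * θ)), t * θ, x)) (by fun_prop) ?_
  intro θ hθ
  have := sub_mul_pos ht hθ
  exact Real.sqrt_pos.2 (by linarith)

include hg hC in
lemma aestronglyMeasurable_heatH_source {t : ℝ} (ht : 0 < t) (x : E) :
    AEStronglyMeasurable (fun θ => heatH √(2 * (t - t * θ)) (g (t * θ)) x)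
      (volume.restrict (Ioo (0 : ℝ) 1)) := by
  refine ContinuousOn.aestronglyMeasurable ?_ measurableSet_Ioo
  refine (continuousOn_heatH_source hg hC).comp
    (f := fun θ : ℝ => (√(2 * (t - t * θ)), t * θ, x)) (by fun_prop) ?_
  intro θ hθ
  have := sub_mul_pos ht hθ
  exact Real.sqrt_pos.2 (by linarith)

include hC in
lemma norm_heatD_source_le {t θ : ℝ} (ht : 0 < t) (hθ : θ ∈ Ioo (0 : ℝ) 1) (x : E) :
    ‖heatD √(2 * (t - t * θ)) (g (t * θ)) x‖ ≤
      (√t)⁻¹ * (C * gaussianMoment E) * (√(1 - θ))⁻¹ := by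
  refine (norm_heatD_sqrt_le (hC _) (sub_mul_pos ht hθ).le x).trans (le_of_eq ?_)
  rw [show t - t * θ = t * (1 - θ) by ring, Real.sqrt_mul ht.le, mul_inv]
  ring

include hg hC in
lemma integrable_heatD_source {t : ℝ} (ht : 0 < t) (x : E) :
    Integrable (fun θ => heatD √(2 * (t - t * θ)) (g (t * θ)) x)
      (volume.restrict (Ioo (0 : ℝ) 1)) :=
  (integrableOn_inv_sqrt.const_mul _).mono' (aestronglyMeasurable_heatD_source hg hC ht x)
    ((ae_restrict_iff' measurableSet_Ioo).2
      (Eventually.of_forall fun _ hθ => norm_heatD_source_le hC ht hθ x))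

include hg hC in
lemma hasFDerivAt_duh {t : ℝ} (ht : 0 < t) (x : E) :
    HasFDerivAt (duh g t) (duhD g t x) x := by
  refine HasFDerivAt.const_smul (R := ℝ) (c := t) ?_
  refine hasFDerivAt_integral_of_dominated_of_fderiv_le
    (F := fun x θ => heat √(2 * (t - t * θ)) (g (t * θ)) x)
    (F' := fun x θ => heatD √(2 * (t - t * θ)) (g (t * θ)) x)
    (bound := fun θ => (√t)⁻¹ * (C * gaussianMoment E) * (√(1 - θ))⁻¹) univ_mem
    ?_ ?_ (aestronglyMeasurable_heatD_source hg hC ht x) ?_ (integrableOn_inv_sqrt.const_mul _) ?_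
  · exact Eventually.of_forall fun y => ((continuous_heat_source hg hC).comp (by fun_prop :
      Continuous fun θ : ℝ => (√(2 * (t - t * θ)), t * θ, y))).aestronglyMeasurable
  · exact Integrable.of_bound ((continuous_heat_source hg hC).comp (by fun_prop :
      Continuous fun θ : ℝ => (√(2 * (t - t * θ)), t * θ, x))).aestronglyMeasurable C
      (Eventually.of_forall fun θ => norm_heat_le (hC _) _ _)
  · exact (ae_restrict_iff' measurableSet_Ioo).2
      (Eventually.of_forall fun θ hθ y _ => norm_heatD_source_le hC ht hθ y)
  · refine (ae_restrict_iff' measurableSet_Ioo).2 (Eventually.of_forall fun θ hθ y _ => ?_)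
    have := sub_mul_pos ht hθ
    exact hasFDerivAt_heat (continuous_source hg _) (hC _) (by positivity) y

include hC in
lemma norm_duh_le {t : ℝ} (ht : 0 ≤ t) (x : E) : ‖duh g t x‖ ≤ t * C := by
  rw [duh, norm_smul, Real.norm_of_nonneg ht]
  refine mul_le_mul_of_nonneg_left ?_ ht
  have := norm_setIntegral_le_of_norm_le_const (μ := volume) (s := Ioo (0 : ℝ) 1)
    (f := fun θ => heat √(2 * (t - t * θ)) (g (t * θ)) x) (C := C) (by simp)
    fun θ _ => norm_heat_le (hC _) _ _
  simpa using this

/-- The constant in the gradient bound of the Duhamel integral. -/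
noncomputable def duhConst (E : Type*) [NormedAddCommGroup E] [InnerProductSpace ℝ E]
    [FiniteDimensional ℝ E] [MeasurableSpace E] [BorelSpace E] : ℝ :=
  gaussianMoment E * ∫ θ in Ioo (0 : ℝ) 1, (√(1 - θ))⁻¹

lemma duhConst_nonneg : 0 ≤ duhConst E :=
  mul_nonneg gaussianMoment_nonneg (setIntegral_nonneg measurableSet_Ioo fun θ _ => by positivity)

include hC in
lemma norm_duhD_le {t : ℝ} (ht : 0 ≤ t) (x : E) : ‖duhD g t x‖ ≤ √t * (C * duhConst E) := by
  rcases ht.eq_or_lt with rfl | ht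
  · simp [duhD]
  have h1 : ‖∫ θ in Ioo (0 : ℝ) 1, heatD √(2 * (t - t * θ)) (g (t * θ)) x‖ ≤
      ∫ θ in Ioo (0 : ℝ) 1, (√t)⁻¹ * (C * gaussianMoment E) * (√(1 - θ))⁻¹ :=
    norm_integral_le_of_norm_le (integrableOn_inv_sqrt.const_mul _)
      ((ae_restrict_iff' measurableSet_Ioo).2
        (Eventually.of_forall fun θ hθ => norm_heatD_source_le hC ht hθ x))
  rw [integral_const_mul] at h1
  rw [duhD, norm_smul, Real.norm_of_nonneg ht.le]
  refine (mul_le_mul_of_nonneg_left h1 ht.le).trans (le_of_eq ?_)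
  have h2 : √t * √t = t := Real.mul_self_sqrt ht.le
  -- The factor `√t` left over here is what makes the gradient part of the fixed-point map contract
  -- for short times.
  have h3 : t * (√t)⁻¹ = √t := by
    nth_rewrite 1 [← h2]
    rw [mul_assoc, mul_inv_cancel₀ (Real.sqrt_pos.2 ht).ne', mul_one]
  rw [duhConst]
  linear_combination (C * gaussianMoment E * ∫ θ in Ioo (0 : ℝ) 1, (√(1 - θ))⁻¹) * h3

include hg hC in
-- The bootstrap: a source that is only bounded already gives a 1/2-Hölder gradient.
lemma duhD_holder {t : ℝ} (ht : 0 < t) (x y : E) :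
    ‖duhD g t x - duhD g t y‖ ≤ t * sing t * (2 * (C * gaussianMoment E ^ 2) *
      ∫ θ in Ioo (0 : ℝ) 1, sing (1 - θ)) * √‖x - y‖ := by
  have h1 : ‖∫ θ in Ioo (0 : ℝ) 1, (heatD √(2 * (t - t * θ)) (g (t * θ)) x -
      heatD √(2 * (t - t * θ)) (g (t * θ)) y)‖ ≤
      ∫ θ in Ioo (0 : ℝ) 1, (2 * (C * gaussianMoment E ^ 2) * sing t * √‖x - y‖) *
        sing (1 - θ) := by
    refine norm_integral_le_of_norm_le (integrableOn_sing.const_mul _)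
      ((ae_restrict_iff' measurableSet_Ioo).2 (Eventually.of_forall fun θ hθ => ?_))
    refine (heatD_holder (continuous_source hg _) (hC _) (sub_mul_pos ht hθ) x y).trans
      (le_of_eq ?_)
    rw [show t - t * θ = t * (1 - θ) by ring, sing_mul ht.le]
    ring
  rw [integral_const_mul] at h1
  rw [duhD, duhD, ← smul_sub, ← integral_sub (integrable_heatD_source hg hC ht x)
    (integrable_heatD_source hg hC ht y), norm_smul, Real.norm_of_nonneg ht.le]
  refine (mul_le_mul_of_nonneg_left h1 ht.le).trans (le_of_eq ?_)
  ring

include hg hC in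
-- After rescaling, the domain of integration does not move with `t`, so joint continuity is plain
-- dominated convergence.
lemma continuous_duh : Continuous fun p : ℝ × E => duh g p.1 p.2 := by
  refine continuous_fst.smul ?_
  refine continuous_of_dominated (F := fun (p : ℝ × E) θ =>
    heat √(2 * (p.1 - p.1 * θ)) (g (p.1 * θ)) p.2) (bound := fun _ => C) ?_ ?_
    (integrable_const _) ?_
  · exact fun p => ((continuous_heat_source hg hC).comp (by fun_prop :
      Continuous fun θ : ℝ => (√(2 * (p.1 - p.1 * θ)), p.1 * θ, p.2))).aestronglyMeasurable
  · exact fun p => Eventually.of_forall fun θ => norm_heat_le (hC _) _ _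
  · exact Eventually.of_forall fun θ => (continuous_heat_source hg hC).comp (by fun_prop :
      Continuous fun p : ℝ × E => (√(2 * (p.1 - p.1 * θ)), p.1 * θ, p.2))

include hg hC in
lemma continuousOn_duhD :
    ContinuousOn (fun p : ℝ × E => duhD g p.1 p.2) (Ici 0 ×ˢ univ) := by
  have hC0 : 0 ≤ C := (norm_nonneg _).trans (hC 0 0)
  rintro ⟨t, x⟩ ⟨ht, -⟩
  rcases (mem_Ici.1 ht).eq_or_lt with h0 | ht
  -- At time zero the bound `√t` forces the limit `0`; at positive times domination is local, on `t
  -- / 2 < p.1`.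
  · have h0' : t = 0 := h0.symm
    subst h0'
    have : duhD g 0 x = 0 := by simp [duhD]
    rw [ContinuousWithinAt, this]
    have hb : Tendsto (fun p : ℝ × E => √p.1 * (C * duhConst E)) (𝓝[Ici 0 ×ˢ univ] (0, x))
        (𝓝 0) := by
      have : Continuous fun p : ℝ × E => √p.1 * (C * duhConst E) := by fun_prop
      have h := (this.tendsto ((0 : ℝ), x)).mono_left
        (nhdsWithin_le_nhds (s := Ici (0 : ℝ) ×ˢ (univ : Set E)))
      simpa using h
    refine squeeze_zero_norm' ?_ hb
    filter_upwards [self_mem_nhdsWithin] with p hp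
    exact norm_duhD_le hC hp.1 p.2
  · set S : Set (ℝ × E) := {p | t / 2 < p.1}
    have hS : IsOpen S := isOpen_lt continuous_const continuous_fst
    have hpos : ∀ p ∈ S, 0 < p.1 := fun p hp => (half_pos ht).trans hp
    have key : ContinuousOn (fun p : ℝ × E => duhD g p.1 p.2) S := by
      refine continuous_fst.continuousOn.smul ?_
      refine continuousOn_of_dominated (F := fun (p : ℝ × E) θ =>
        heatD √(2 * (p.1 - p.1 * θ)) (g (p.1 * θ)) p.2)
        (bound := fun θ => (√(t / 2))⁻¹ * (C * gaussianMoment E) * (√(1 - θ))⁻¹) ?_ ?_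
        (integrableOn_inv_sqrt.const_mul _) ?_
      · exact fun p hp => aestronglyMeasurable_heatD_source hg hC (hpos p hp) _
      · intro p hp
        refine (ae_restrict_iff' measurableSet_Ioo).2 (Eventually.of_forall fun θ hθ => ?_)
        refine (norm_heatD_source_le hC (hpos p hp) hθ p.2).trans ?_
        have h1 : √(t / 2) ≤ √p.1 := Real.sqrt_le_sqrt (le_of_lt hp)
        have h2 : 0 < √(t / 2) := Real.sqrt_pos.2 (half_pos ht)
        have hm := gaussianMoment_nonneg (E := E)
        gcongr
      · refine (ae_restrict_iff' measurableSet_Ioo).2 (Eventually.of_forall fun θ hθ => ?_)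
        refine (continuousOn_heatD_source hg hC).comp
          (f := fun p : ℝ × E => (√(2 * (p.1 - p.1 * θ)), p.1 * θ, p.2)) (by fun_prop) ?_
        intro p hp
        have := sub_mul_pos (hpos p hp) hθ
        exact Real.sqrt_pos.2 (by linarith)
    exact (key.continuousAt (hS.mem_nhds (half_lt_self ht))).continuousWithinAt

variable {K τ : ℝ} (hK : ∀ s, 0 < s → s < τ → ∀ x y, ‖g s x - g s y‖ ≤ K * (√s)⁻¹ * √‖x - y‖)
  (hK0 : 0 ≤ K)

include hg hC hK hK0 in
-- The factor `θ^{-1/2}` is the Hölder constant of the source, allowed to blow up like `s^{-1/2}` at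
-- `s = 0` because the initial gradient is only bounded and continuous.
lemma norm_heatH_source_le {t θ : ℝ} (ht : 0 < t) (htτ : t < τ) (hθ : θ ∈ Ioo (0 : ℝ) 1) (x : E) :
    ‖heatH √(2 * (t - t * θ)) (g (t * θ)) x‖ ≤
      t⁻¹ * √√τ * (√t)⁻¹ * (K * gaussianMoment E ^ 2) * (sing (1 - θ) * (√θ)⁻¹) := by
  have h0 : 0 < t * θ := mul_pos ht hθ.1
  have h1 : t * θ < τ := by nlinarith [hθ.2]
  refine (norm_heatH_le_of_holder (continuous_source hg _) (hC _) (hK _ h0 h1)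
    (by positivity) (sub_mul_pos ht hθ) x).trans ?_
  rw [show t - t * θ = t * (1 - θ) by ring, sing_mul ht.le, Real.sqrt_mul ht.le, mul_inv]
  -- Each remaining power of `t` is now visibly decreasing, so the bound at `t / 2` dominates at all
  -- later times below `τ`.
  have h2 : sing t ≤ t⁻¹ * √√τ := by
    unfold sing
    gcongr
  have h3 : 0 ≤ sing (1 - θ) := sing_nonneg (by linarith [hθ.2])
  calc sing t * sing (1 - θ) * (K * ((√t)⁻¹ * (√θ)⁻¹) * gaussianMoment E ^ 2)
      ≤ (t⁻¹ * √√τ) * sing (1 - θ) * (K * ((√t)⁻¹ * (√θ)⁻¹) * gaussianMoment E ^ 2) := by gcongr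
    _ = _ := by ring

include hg hC hK hK0 in
lemma hasFDerivAt_duhD {t : ℝ} (ht : 0 < t) (htτ : t < τ) (x : E) :
    HasFDerivAt (duhD g t) (duhH g t x) x := by
  refine HasFDerivAt.const_smul (R := ℝ) (c := t) ?_
  refine hasFDerivAt_integral_of_dominated_of_fderiv_le
    (F := fun x θ => heatD √(2 * (t - t * θ)) (g (t * θ)) x)
    (F' := fun x θ => heatH √(2 * (t - t * θ)) (g (t * θ)) x)
    (bound := fun θ => t⁻¹ * √√τ * (√t)⁻¹ * (K * gaussianMoment E ^ 2) *
      (sing (1 - θ) * (√θ)⁻¹)) univ_mem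
    ?_ (integrable_heatD_source hg hC ht x) (aestronglyMeasurable_heatH_source hg hC ht x) ?_
    (integrableOn_sing_mul_inv_sqrt.const_mul _) ?_
  · exact Eventually.of_forall fun y => aestronglyMeasurable_heatD_source hg hC ht y
  · exact (ae_restrict_iff' measurableSet_Ioo).2
      (Eventually.of_forall fun θ hθ y _ => norm_heatH_source_le hg hC hK hK0 ht htτ hθ y)
  · refine (ae_restrict_iff' measurableSet_Ioo).2 (Eventually.of_forall fun θ hθ y _ => ?_)
    have := sub_mul_pos ht hθ
    exact hasFDerivAt_heatD (continuous_source hg _) (hC _) (by positivity) y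

include hg hC hK hK0 in
lemma exists_norm_duhH_le {t : ℝ} (ht : 0 < t) (htτ : t < τ) :
    ∃ B, ∀ x, ‖duhH g t x‖ ≤ B := by
  refine ⟨t * ∫ θ in Ioo (0 : ℝ) 1, t⁻¹ * √√τ * (√t)⁻¹ * (K * gaussianMoment E ^ 2) *
      (sing (1 - θ) * (√θ)⁻¹), fun x => ?_⟩
  rw [duhH, norm_smul, Real.norm_of_nonneg ht.le]
  refine mul_le_mul_of_nonneg_left ?_ ht.le
  exact norm_integral_le_of_norm_le (integrableOn_sing_mul_inv_sqrt.const_mul _)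
    ((ae_restrict_iff' measurableSet_Ioo).2
      (Eventually.of_forall fun θ hθ => norm_heatH_source_le hg hC hK hK0 ht htτ hθ x))

include hg hC hK hK0 in
lemma continuousOn_duhH :
    ContinuousOn (fun p : ℝ × E => duhH g p.1 p.2) (Ioo 0 τ ×ˢ univ) := by
  rintro ⟨t, x⟩ ⟨⟨ht, htτ⟩, -⟩
  simp only at ht htτ
  set S : Set (ℝ × E) := Ioo (t / 2) τ ×ˢ univ
  have hS : IsOpen S := isOpen_Ioo.prod isOpen_univ
  have hpos : ∀ p ∈ S, 0 < p.1 := fun p hp => (half_pos ht).trans hp.1.1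
  have key : ContinuousOn (fun p : ℝ × E => duhH g p.1 p.2) S := by
    refine continuous_fst.continuousOn.smul ?_
    refine continuousOn_of_dominated (F := fun (p : ℝ × E) θ =>
      heatH √(2 * (p.1 - p.1 * θ)) (g (p.1 * θ)) p.2)
      (bound := fun θ => (t / 2)⁻¹ * √√τ * (√(t / 2))⁻¹ * (K * gaussianMoment E ^ 2) *
        (sing (1 - θ) * (√θ)⁻¹)) ?_ ?_ (integrableOn_sing_mul_inv_sqrt.const_mul _) ?_
    · exact fun p hp => aestronglyMeasurable_heatH_source hg hC (hpos p hp) _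
    · intro p hp
      refine (ae_restrict_iff' measurableSet_Ioo).2 (Eventually.of_forall fun θ hθ => ?_)
      refine (norm_heatH_source_le hg hC hK hK0 (hpos p hp) hp.1.2 hθ p.2).trans ?_
      have h1 : √(t / 2) ≤ √p.1 := Real.sqrt_le_sqrt (le_of_lt hp.1.1)
      have h2 : 0 < √(t / 2) := Real.sqrt_pos.2 (half_pos ht)
      have h3 : t / 2 ≤ p.1 := hp.1.1.le
      have h4 : 0 ≤ sing (1 - θ) := sing_nonneg (by linarith [hθ.2])
      gcongr
    · refine (ae_restrict_iff' measurableSet_Ioo).2 (Eventually.of_forall fun θ hθ => ?_)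
      refine (continuousOn_heatH_source hg hC).comp
        (f := fun p : ℝ × E => (√(2 * (p.1 - p.1 * θ)), p.1 * θ, p.2)) (by fun_prop) ?_
      intro p hp
      have := sub_mul_pos (hpos p hp) hθ
      exact Real.sqrt_pos.2 (by linarith)
  exact (key.continuousAt (hS.mem_nhds ⟨⟨half_lt_self ht, htτ⟩, mem_univ _⟩)).continuousWithinAt

end Regularity

end Duhamel

/-! ### Mild solutions and their time derivative -/

section MildSolution

set_option maxSynthPendingDepth 3
set_option linter.unusedSectionVars false

open MeasureTheory ProbabilityTheory
open scoped RealInnerProductSpace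

variable {E : Type*} [NormedAddCommGroup E] [InnerProductSpace ℝ E] [FiniteDimensional ℝ E]
  [MeasurableSpace E] [BorelSpace E]

/-- A continuous function is determined by its right derivative and one value, so `f` coincides with
a primitive of `f'`. -/
lemma hasDerivAt_of_right_deriv {f f' : ℝ → ℝ} {a b : ℝ} (hf : ContinuousOn f (Ioo a b))
    (hf' : ContinuousOn f' (Ioo a b))
    (h : ∀ t ∈ Ioo a b, HasDerivWithinAt f (f' t) (Ici t) t) {t : ℝ} (ht : t ∈ Ioo a b) :
    HasDerivAt f (f' t) t := by
  obtain ⟨c, hac, hct⟩ := exists_between ht.1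
  obtain ⟨d, htd, hdb⟩ := exists_between ht.2
  have hsub : Icc c d ⊆ Ioo a b := Icc_subset_Ioo hac hdb
  have hG : ∀ s ∈ Icc c d, HasDerivAt (fun u => f c + ∫ x in c..u, f' x) (f' s) s := by
    intro s hs
    refine (intervalIntegral.integral_hasDerivAt_right ?_ ?_ ?_).const_add _
    · refine ContinuousOn.intervalIntegrable (hf'.mono ?_)
      rw [uIcc_of_le hs.1]
      exact (Icc_subset_Icc_right hs.2).trans hsub
    · exact hf'.stronglyMeasurableAtFilter isOpen_Ioo s (hsub hs)
    · exact hf'.continuousAt (isOpen_Ioo.mem_nhds (hsub hs))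
  have key := eq_of_has_deriv_right_eq (f := f) (g := fun u => f c + ∫ x in c..u, f' x)
    (f' := f') (a := c) (b := d) (fun s hs => h s (hsub (Ico_subset_Icc_self hs)))
    (fun s hs => (hG s (Ico_subset_Icc_self hs)).hasDerivWithinAt) (hf.mono hsub)
    (fun s hs => (hG s hs).continuousAt.continuousWithinAt) (by simp)
  refine (hG t ⟨hct.le, htd.le⟩).congr_of_eventuallyEq ?_
  filter_upwards [Icc_mem_nhds hct htd] with s hs using key s hs

lemma integral_bilin_stdGaussian (B : E →L[ℝ] E →L[ℝ] ℝ) :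
    ∫ z, B z z ∂(stdGaussian E) =
      ∑ i, B (stdOrthonormalBasis ℝ E i) (stdOrthonormalBasis ℝ E i) := by
  set b := stdOrthonormalBasis ℝ E
  have h1 : ∀ z : E, B z z = ∑ i, ∑ j, (⟪b i, z⟫ * ⟪b j, z⟫) * B (b i) (b j) := by
    intro z
    have hz : B z z = B (∑ i, ⟪b i, z⟫ • b i) (∑ i, ⟪b i, z⟫ • b i) := by rw [b.sum_repr' z]
    rw [hz]
    simp only [map_sum, _root_.sum_apply, map_smul,
      _root_.smul_apply, smul_eq_mul]
    simp only [Finset.mul_sum]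
    rw [Finset.sum_comm]
    refine Finset.sum_congr rfl fun i _ => Finset.sum_congr rfl fun j _ => ?_
    ring
  have hint : ∀ i j, Integrable (fun z : E => (⟪b i, z⟫ * ⟪b j, z⟫) * B (b i) (b j))
      (stdGaussian E) := by
    intro i j
    refine Integrable.mul_const ?_ _
    refine (integrable_norm_sq_stdGaussian (E := E)).mono' (by fun_prop)
      (Eventually.of_forall fun z => ?_)
    rw [norm_mul, sq]
    have h2 : ∀ i, ‖⟪b i, z⟫‖ ≤ ‖z‖ := fun i => by
      simpa using norm_inner_le_norm (𝕜 := ℝ) (b i) z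
    exact mul_le_mul (h2 i) (h2 j) (norm_nonneg _) (norm_nonneg _)
  rw [integral_congr_ae (Eventually.of_forall h1), integral_finsetSum _ fun i _ => integrable_finsetSum _ fun j _ => hint i j]
  refine Finset.sum_congr rfl fun i _ => ?_
  rw [integral_finsetSum _ fun j _ => hint i j, Finset.sum_eq_single i]
  · rw [integral_mul_const, integral_inner_mul_inner_stdGaussian]
    simp
  · intro j _ hj
    rw [integral_mul_const, integral_inner_mul_inner_stdGaussian,
      b.inner_eq_zero hj.symm, zero_mul]
  · simp

/-- The generator of the heat semigroup is the Laplacian, on bounded `C²` functions. -/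
lemma tendsto_heat_slope {φ : E → ℝ} {φ' : E → E →L[ℝ] ℝ} {φ'' : E → E →L[ℝ] E →L[ℝ] ℝ}
    (h1 : ∀ x, HasFDerivAt φ (φ' x) x) (h2 : ∀ x, HasFDerivAt φ' (φ'' x) x) {C B : ℝ}
    (hC : ∀ x, ‖φ x‖ ≤ C) (hB : ∀ x, ‖φ'' x‖ ≤ B) (x : E) :
    Tendsto (fun k : ℝ => k⁻¹ * (heat √(2 * k) φ x - φ x)) (𝓝[>] 0)
      (𝓝 (∑ i, φ'' x (stdOrthonormalBasis ℝ E i) (stdOrthonormalBasis ℝ E i))) := by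
  have hφ : Continuous φ := continuous_iff_continuousAt.2 fun x => (h1 x).continuousAt
  have hB0 : 0 ≤ B := (norm_nonneg _).trans (hB x)
  -- This first-order remainder gives the majorant `2B‖z‖²`, free of `k`; the pointwise limit comes
  -- from the second-order Taylor formula below.
  have htaylor : ∀ v : E, ‖φ (x + v) - φ x - φ' x v‖ ≤ B * ‖v‖ ^ 2 := by
    intro v
    have := (convex_closedBall x ‖v‖).norm_image_sub_le_of_norm_hasFDerivWithin_le'
      (f := φ) (f' := φ') (φ := φ' x) (x := x) (y := x + v) (C := B * ‖v‖)
      (fun y _ => (h1 y).hasFDerivWithinAt) ?_ (by simp) (by simp)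
    · rw [add_sub_cancel_left] at this
      exact this.trans (le_of_eq (by ring))
    · intro y hy
      refine (norm_image_sub_le_of_hasFDerivAt h2 hB y x).trans ?_
      rw [Metric.mem_closedBall, dist_eq_norm] at hy
      gcongr
  have hlin : ∀ s : ℝ, Integrable (fun z => s * φ' x z) (stdGaussian E) := fun s =>
    ((φ' x).integrable_comp IsGaussian.integrable_id).const_mul s
  -- The linear term has mean zero; subtracting it keeps the quotient bounded as `k → 0`.
  have heq : ∀ k : ℝ, k⁻¹ * (heat √(2 * k) φ x - φ x) =
      ∫ z, k⁻¹ * (φ (x + √(2 * k) • z) - φ x - √(2 * k) * φ' x z) ∂(stdGaussian E) := by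
    intro k
    have hsub : Integrable (fun z => φ (x + √(2 * k) • z) - φ x) (stdGaussian E) :=
      (integrable_heat hφ hC _ x).sub (integrable_const _)
    rw [integral_const_mul, integral_sub hsub (hlin _), integral_sub (integrable_heat hφ hC _ x) (integrable_const _), integral_const_mul]
    have h0 : ∫ z, φ' x z ∂(stdGaussian E) = 0 := integral_strongDual_stdGaussian _
    rw [h0]
    simp [heat]
  simp_rw [heq]
  rw [← integral_bilin_stdGaussian]
  refine tendsto_integral_filter_of_dominated_convergence (fun z => 2 * B * ‖z‖ ^ 2) ?_ ?_
    (integrable_norm_sq_stdGaussian.const_mul _) ?_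
  · refine Eventually.of_forall fun k => ?_
    have h : Continuous fun z : E => φ (x + √(2 * k) • z) := hφ.comp (by fun_prop)
    exact (continuous_const.mul ((h.sub continuous_const).sub
      (continuous_const.mul (φ' x).continuous))).aestronglyMeasurable
  · filter_upwards [self_mem_nhdsWithin] with k hk
    have hk : 0 < k := hk
    refine Eventually.of_forall fun z => ?_
    rw [norm_mul, Real.norm_of_nonneg (inv_nonneg.2 hk.le)]
    have := htaylor (√(2 * k) • z)
    rw [map_smul, smul_eq_mul, norm_smul, Real.norm_of_nonneg (Real.sqrt_nonneg _), mul_pow,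
      Real.sq_sqrt (by positivity)] at this
    calc k⁻¹ * ‖φ (x + √(2 * k) • z) - φ x - √(2 * k) * φ' x z‖
        ≤ k⁻¹ * (B * (2 * k * ‖z‖ ^ 2)) := by gcongr
      _ = 2 * B * ‖z‖ ^ 2 := by field_simp
  · refine Eventually.of_forall fun z => ?_
    have ht := Convex.taylor_approx_two_segment (s := (univ : Set E)) (f := φ) (f' := φ')
      (f'' := φ'' x) (x := x) convex_univ (fun y _ => h1 y) (mem_univ x)
      (h2 x).hasFDerivWithinAt (v := 0) (w := z) (by simp) (by simp)
    have hsq : Tendsto (fun k : ℝ => √(2 * k)) (𝓝[>] 0) (𝓝[>] 0) := by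
      refine tendsto_nhdsWithin_iff.2 ⟨?_, ?_⟩
      · have : Continuous fun k : ℝ => √(2 * k) := by fun_prop
        have h := (this.tendsto 0).mono_left (nhdsWithin_le_nhds (s := Ioi (0 : ℝ)))
        simpa using h
      · filter_upwards [self_mem_nhdsWithin] with k hk
        exact Real.sqrt_pos.2 (mul_pos two_pos hk)
    have h3 := (ht.comp_tendsto hsq).tendsto_div_nhds_zero
    have h4 := (h3.const_mul 2).add_const (φ'' x z z)
    rw [mul_zero, zero_add] at h4
    refine h4.congr' ?_
    filter_upwards [self_mem_nhdsWithin] with k hk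
    have hk : 0 < k := hk
    simp only [Function.comp_apply, smul_zero, add_zero, Real.sq_sqrt (show 0 ≤ 2 * k by positivity),
      map_zero, _root_.zero_apply, smul_eq_mul]
    field_simp
    ring

section Restart

variable {g : ℝ → E → ℝ} (hg : Continuous fun p : ℝ × E => g p.1 p.2) {C : ℝ}
  (hC : ∀ s x, ‖g s x‖ ≤ C)

lemma smul_setIntegral_unit (f : ℝ → ℝ) (d c : ℝ) :
    c • ∫ θ in Ioo (0 : ℝ) 1, f (d + c * θ) = ∫ s in d..d + c, f s := by
  rw [← integral_Ioc_eq_integral_Ioo, ← intervalIntegral.integral_of_le zero_le_one,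
    intervalIntegral.smul_integral_comp_add_mul]
  simp

include hg hC in
-- Fubini moves the outer step inside the time integral, where the semigroup law merges the two
-- steps.
lemma heat_duh {t k : ℝ} (ht : 0 ≤ t) (hk : 0 ≤ k) (x : E) :
    heat √(2 * k) (duh g t) x = ∫ s in (0 : ℝ)..t, heat √(2 * (t + k - s)) (g s) x := by
  have hcont : Continuous fun w : ℝ × E =>
      heat √(2 * (t - t * w.1)) (g (t * w.1)) (x + √(2 * k) • w.2) :=
    (continuous_heat_source hg hC).comp (by fun_prop :
      Continuous fun w : ℝ × E => (√(2 * (t - t * w.1)), t * w.1, x + √(2 * k) • w.2))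
  have hint : Integrable (Function.uncurry fun (θ : ℝ) (z : E) =>
      heat √(2 * (t - t * θ)) (g (t * θ)) (x + √(2 * k) • z))
      ((volume.restrict (Ioo (0 : ℝ) 1)).prod (stdGaussian E)) :=
    Integrable.of_bound hcont.aestronglyMeasurable C
      (Eventually.of_forall fun _ => norm_heat_le (hC _) _ _)
  have h1 : heat √(2 * k) (duh g t) x = t • ∫ θ in Ioo (0 : ℝ) 1,
      heat √(2 * k) (heat √(2 * (t - t * θ)) (g (t * θ))) x := by
    simp only [heat.eq_1 (√(2 * k)), duh]
    rw [integral_smul, integral_integral_swap hint]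
  rw [h1]
  have h2 := smul_setIntegral_unit (fun s => heat √(2 * (t + k - s)) (g s) x) 0 t
  simp only [zero_add] at h2
  rw [← h2]
  congr 1
  refine setIntegral_congr_fun measurableSet_Ioo fun θ hθ => ?_
  have h3 : 0 ≤ t - t * θ := by nlinarith [hθ.2]
  refine heat_heat (continuous_source hg _) (hC _) ?_ x
  rw [Real.sq_sqrt (by linarith), Real.sq_sqrt (by linarith), Real.sq_sqrt (by linarith)]
  ring

/-- The mild solution of `u_t - Δu = g`, `u(0) = u₀`. -/
noncomputable def mild (u₀ : E → ℝ) (g : ℝ → E → ℝ) (t : ℝ) (x : E) : ℝ :=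
  heat √(2 * t) u₀ x + duh g t x

/-- The spatial derivative of the mild solution, `u₀'` being the derivative of `u₀`. -/
noncomputable def mildD (u₀' : E → E →L[ℝ] ℝ) (g : ℝ → E → ℝ) (t : ℝ) (x : E) : E →L[ℝ] ℝ :=
  heat √(2 * t) u₀' x + duhD g t x

/-- The second spatial derivative of the mild solution. -/
noncomputable def mildH (u₀' : E → E →L[ℝ] ℝ) (g : ℝ → E → ℝ) (t : ℝ) (x : E) :
    E →L[ℝ] E →L[ℝ] ℝ :=
  heatD √(2 * t) u₀' x + duhH g t x

variable {u₀ : E → ℝ} (hu₀ : Continuous u₀) {A : ℝ} (hA : ∀ x, ‖u₀ x‖ ≤ A)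

include hg hC hu₀ hA in
-- Restarting at time `t` yields the time derivative without differentiating a singular integral.
lemma mild_add {t k : ℝ} (ht : 0 ≤ t) (hk : 0 ≤ k) (x : E) :
    mild u₀ g (t + k) x = heat √(2 * k) (mild u₀ g t) x + duh (fun s => g (t + s)) k x := by
  have hi1 : Integrable (fun z => heat √(2 * t) u₀ (x + √(2 * k) • z)) (stdGaussian E) :=
    integrable_heat (continuous_heat hu₀ hA _) (norm_heat_le hA _) _ x
  have hi2 : Integrable (fun z => duh g t (x + √(2 * k) • z)) (stdGaussian E) :=
    integrable_heat ((continuous_duh hg hC).comp (by fun_prop : Continuous fun y : E => (t, y)))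
      (norm_duh_le hC ht) _ x
  have h1 : heat √(2 * k) (mild u₀ g t) x =
      heat √(2 * k) (heat √(2 * t) u₀) x + heat √(2 * k) (duh g t) x := by
    simp only [heat.eq_1 (√(2 * k)), mild]
    exact integral_add hi1 hi2
  have h2 : heat √(2 * k) (heat √(2 * t) u₀) x = heat √(2 * (t + k)) u₀ x := by
    refine heat_heat hu₀ hA ?_ x
    rw [Real.sq_sqrt (by linarith), Real.sq_sqrt (by linarith), Real.sq_sqrt (by linarith)]
    ring
  have h3 : duh g (t + k) x = ∫ s in (0 : ℝ)..t + k, heat √(2 * (t + k - s)) (g s) x := by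
    have := smul_setIntegral_unit (fun s => heat √(2 * (t + k - s)) (g s) x) 0 (t + k)
    simp only [zero_add] at this
    rw [← this, duh]
  have h4 : duh (fun s => g (t + s)) k x =
      ∫ s in t..t + k, heat √(2 * (t + k - s)) (g s) x := by
    rw [← smul_setIntegral_unit (fun s => heat √(2 * (t + k - s)) (g s) x) t k, duh]
    congr 1
    refine setIntegral_congr_fun measurableSet_Ioo fun θ _ => ?_
    rw [show t + k - (t + k * θ) = k - k * θ by ring]
  have hc : Continuous fun s => heat √(2 * (t + k - s)) (g s) x :=
    (continuous_heat_source hg hC).comp (by fun_prop :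
      Continuous fun s : ℝ => (√(2 * (t + k - s)), s, x))
  rw [mild, h1, h2, h3, h4, heat_duh hg hC ht hk, add_assoc,
    intervalIntegral.integral_add_adjacent_intervals (hc.intervalIntegrable _ _)
      (hc.intervalIntegrable _ _)]

include hg hC in
lemma tendsto_duh_div (t : ℝ) (x : E) :
    Tendsto (fun k : ℝ => k⁻¹ * duh (fun s => g (t + s)) k x) (𝓝[>] 0) (𝓝 (g t x)) := by
  have hc : Continuous fun k : ℝ =>
      ∫ θ in Ioo (0 : ℝ) 1, heat √(2 * (k - k * θ)) (g (t + k * θ)) x := by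
    refine continuous_of_dominated (F := fun (k : ℝ) θ =>
      heat √(2 * (k - k * θ)) (g (t + k * θ)) x) (bound := fun _ => C) ?_ ?_
      (integrable_const _) ?_
    · exact fun p => ((continuous_heat_source hg hC).comp (by fun_prop :
        Continuous fun θ : ℝ => (√(2 * (p - p * θ)), t + p * θ, x))).aestronglyMeasurable
    · exact fun p => Eventually.of_forall fun θ => norm_heat_le (hC _) _ _
    · exact Eventually.of_forall fun θ => (continuous_heat_source hg hC).comp (by fun_prop :
        Continuous fun p : ℝ => (√(2 * (p - p * θ)), t + p * θ, x))
  have h := (hc.tendsto 0).mono_left (nhdsWithin_le_nhds (s := Ioi (0 : ℝ)))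
  have h0 : ∫ θ in Ioo (0 : ℝ) 1, heat √(2 * (0 - 0 * θ)) (g (t + 0 * θ)) x = g t x := by
    simp [heat]
  rw [h0] at h
  refine h.congr' ?_
  filter_upwards [self_mem_nhdsWithin] with k hk
  have hk : k ≠ 0 := ne_of_gt hk
  rw [duh, smul_eq_mul, inv_mul_cancel_left₀ hk]

end Restart

section Regularity

variable {g : ℝ → E → ℝ} (hg : Continuous fun p : ℝ × E => g p.1 p.2) {C : ℝ}
  (hC : ∀ s x, ‖g s x‖ ≤ C) {K τ : ℝ}
  (hK : ∀ s, 0 < s → s < τ → ∀ x y, ‖g s x - g s y‖ ≤ K * (√s)⁻¹ * √‖x - y‖) (hK0 : 0 ≤ K)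
  {u₀ : E → ℝ} {u₀' : E → E →L[ℝ] ℝ} (hu₀ : ∀ x, HasFDerivAt u₀ (u₀' x) x)
  (hu₀' : Continuous u₀') {A : ℝ} (hA : ∀ x, ‖u₀ x‖ ≤ A) (hA' : ∀ x, ‖u₀' x‖ ≤ A)

include hg hC hu₀ hu₀' hA hA' in
lemma hasFDerivAt_mild {t : ℝ} (ht : 0 ≤ t) (x : E) :
    HasFDerivAt (mild u₀ g t) (mildD u₀' g t x) x := by
  refine (hasFDerivAt_heat_of_hasFDerivAt hu₀ hu₀' hA hA' _ x).add ?_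
  rcases ht.eq_or_lt with rfl | ht
  · have h1 : duh g 0 = fun _ => (0 : ℝ) := by ext y; simp [duh]
    have h2 : duhD g 0 x = 0 := by simp [duhD]
    rw [h1, h2]
    exact hasFDerivAt_const _ _
  · exact hasFDerivAt_duh hg hC ht x

include hg hC hK hK0 hu₀' hA' in
lemma hasFDerivAt_mildD {t : ℝ} (ht : 0 < t) (htτ : t < τ) (x : E) :
    HasFDerivAt (mildD u₀' g t) (mildH u₀' g t x) x :=
  (hasFDerivAt_heat hu₀' hA' (by positivity) x).add (hasFDerivAt_duhD hg hC hK hK0 ht htτ x)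

include hg hC hu₀ hA in
lemma continuous_mild : Continuous fun p : ℝ × E => mild u₀ g p.1 p.2 := by
  refine Continuous.add ?_ (continuous_duh hg hC)
  have hc : Continuous u₀ := continuous_iff_continuousAt.2 fun x => (hu₀ x).continuousAt
  rw [← continuousOn_univ]
  exact continuousOn_heat (X := ℝ × E) (σ := fun p => √(2 * p.1)) (ξ := fun p => p.2)
    (g := fun _ => u₀) (by fun_prop) (by fun_prop) (hc.comp continuous_snd).continuousOn
    fun _ _ => hA

include hg hC hu₀' hA' in
lemma continuousOn_mildD :
    ContinuousOn (fun p : ℝ × E => mildD u₀' g p.1 p.2) (Ici 0 ×ˢ univ) := by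
  refine ContinuousOn.add ?_ (continuousOn_duhD hg hC)
  exact continuousOn_heat (X := ℝ × E) (σ := fun p => √(2 * p.1)) (ξ := fun p => p.2)
    (g := fun _ => u₀') (by fun_prop) (by fun_prop) (hu₀'.comp continuous_snd).continuousOn
    fun _ _ => hA'

include hg hC hK hK0 hu₀' hA' in
lemma continuousOn_mildH :
    ContinuousOn (fun p : ℝ × E => mildH u₀' g p.1 p.2) (Ioo 0 τ ×ˢ univ) := by
  refine ContinuousOn.add ?_ (continuousOn_duhH hg hC hK hK0)
  refine continuousOn_heatD (X := ℝ × E) (σ := fun p => √(2 * p.1)) (ξ := fun p => p.2)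
    (g := fun _ => u₀') (by fun_prop) (by fun_prop) ?_ (hu₀'.comp continuous_snd).continuousOn
    fun _ _ => hA'
  intro p hp
  have : 0 < p.1 := hp.1.1
  positivity

include hC hA in
lemma norm_mild_le {t : ℝ} (ht : 0 ≤ t) (x : E) : ‖mild u₀ g t x‖ ≤ A + t * C :=
  (norm_add_le _ _).trans (add_le_add (norm_heat_le hA _ x) (norm_duh_le hC ht x))

include hC hA' in
lemma norm_mildD_le {t : ℝ} (ht : 0 ≤ t) (x : E) :
    ‖mildD u₀' g t x‖ ≤ A + √t * (C * duhConst E) :=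
  (norm_add_le _ _).trans (add_le_add (norm_heat_le hA' _ x) (norm_duhD_le hC ht x))

include hg hC hK hK0 hu₀ hu₀' hA hA' in
-- By the restart formula, the forward quotient is `k⁻¹(e^{kΔ} - 1)u(t)`, tending to `Δu(t)`, plus a
-- short Duhamel integral, tending to `g(t)`. This right derivative is continuous, hence two-sided.
lemma hasDerivAt_mild_time {t : ℝ} (ht : t ∈ Ioo 0 τ) (x : E) :
    HasDerivAt (fun s => mild u₀ g s x)
      ((∑ i, mildH u₀' g t x (stdOrthonormalBasis ℝ E i) (stdOrthonormalBasis ℝ E i)) + g t x)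
      t := by
  have hc : Continuous u₀ := continuous_iff_continuousAt.2 fun x => (hu₀ x).continuousAt
  refine hasDerivAt_of_right_deriv (f' := fun s =>
    (∑ i, mildH u₀' g s x (stdOrthonormalBasis ℝ E i) (stdOrthonormalBasis ℝ E i)) + g s x)
    ((continuous_mild hg hC hu₀ hA).comp
      (by fun_prop : Continuous fun s : ℝ => (s, x))).continuousOn ?_ ?_ ht
  · have h1 : ContinuousOn (fun s => mildH u₀' g s x) (Ioo 0 τ) :=
      (continuousOn_mildH hg hC hK hK0 hu₀' hA').comp
        (f := fun s : ℝ => (s, x)) (by fun_prop) fun s hs => ⟨hs, mem_univ _⟩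
    have h2 : Continuous fun s => g s x := hg.comp (by fun_prop : Continuous fun s : ℝ => (s, x))
    refine ContinuousOn.add ?_ h2.continuousOn
    exact continuousOn_finsetSum _ fun i _ =>
      (h1.clm_apply continuousOn_const).clm_apply continuousOn_const
  · rintro t ⟨ht, htτ⟩
    rw [← hasDerivWithinAt_Ioi_iff_Ici, hasDerivWithinAt_iff_tendsto_slope' self_notMem_Ioi]
    obtain ⟨B, hB⟩ := exists_norm_duhH_le hg hC hK hK0 ht htτ
    have h1 := tendsto_heat_slope (fun y => hasFDerivAt_mild hg hC hu₀ hu₀' hA hA' ht.le y)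
      (fun y => hasFDerivAt_mildD hg hC hK hK0 hu₀' hA' ht htτ y) (norm_mild_le hC hA ht.le)
      (B := (√(2 * t))⁻¹ * (A * gaussianMoment E) + B)
      (fun y => (norm_add_le _ _).trans
        (add_le_add (norm_heatD_le hA' (Real.sqrt_nonneg _) y) (hB y))) x
    have h2 := h1.add (tendsto_duh_div hg hC t x)
    have h3 : Tendsto (fun s => s - t) (𝓝[>] t) (𝓝[>] 0) := by
      refine tendsto_nhdsWithin_iff.2 ⟨?_, ?_⟩
      · have : Continuous fun s : ℝ => s - t := by fun_prop
        have h := (this.tendsto t).mono_left (nhdsWithin_le_nhds (s := Ioi t))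
        simpa using h
      · filter_upwards [self_mem_nhdsWithin] with s hs
        exact sub_pos.2 (mem_Ioi.1 hs)
    refine (h2.comp h3).congr' ?_
    filter_upwards [self_mem_nhdsWithin] with s hs
    have hs : 0 < s - t := sub_pos.2 (mem_Ioi.1 hs)
    have h4 := mild_add hg hC hc hA ht.le hs.le x
    rw [add_sub_cancel] at h4
    simp only [Function.comp_apply, slope_def_field]
    rw [h4]
    field_simp
    ring

end Regularity

end MildSolution

/-! ### The contraction argument -/

section FixedPoint

set_option maxSynthPendingDepth 3
set_option linter.unusedSectionVars false

open MeasureTheory ProbabilityTheory BoundedContinuousFunction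
open scoped RealInnerProductSpace

variable {E : Type*} [NormedAddCommGroup E] [InnerProductSpace ℝ E] [FiniteDimensional ℝ E]
  [MeasurableSpace E] [BorelSpace E]

lemma heat_sub {f₁ f₂ : E → ℝ} (h₁ : Continuous f₁) (h₂ : Continuous f₂) {C : ℝ}
    (hC₁ : ∀ x, ‖f₁ x‖ ≤ C) (hC₂ : ∀ x, ‖f₂ x‖ ≤ C) (s : ℝ) (x : E) :
    heat s f₁ x - heat s f₂ x = heat s (fun y => f₁ y - f₂ y) x :=
  (integral_sub (integrable_heat h₁ hC₁ s x) (integrable_heat h₂ hC₂ s x)).symm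

lemma heatD_sub {f₁ f₂ : E → ℝ} (h₁ : Continuous f₁) (h₂ : Continuous f₂) {C : ℝ}
    (hC₁ : ∀ x, ‖f₁ x‖ ≤ C) (hC₂ : ∀ x, ‖f₂ x‖ ≤ C) (s : ℝ) (x : E) :
    heatD s f₁ x - heatD s f₂ x = heatD s (fun y => f₁ y - f₂ y) x := by
  rw [heatD, heatD, heatD, ← smul_sub,
    ← integral_sub (integrable_heatD h₁ hC₁ s x) (integrable_heatD h₂ hC₂ s x)]
  congr 1
  refine integral_congr_ae (Eventually.of_forall fun z => ?_)
  ext w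
  simp [mul_sub]

lemma duh_sub {g₁ g₂ : ℝ → E → ℝ} (h₁ : Continuous fun p : ℝ × E => g₁ p.1 p.2)
    (h₂ : Continuous fun p : ℝ × E => g₂ p.1 p.2) {C : ℝ} (hC₁ : ∀ s x, ‖g₁ s x‖ ≤ C)
    (hC₂ : ∀ s x, ‖g₂ s x‖ ≤ C) (t : ℝ) (x : E) :
    duh g₁ t x - duh g₂ t x = duh (fun s y => g₁ s y - g₂ s y) t x := by
  have hi : ∀ {g : ℝ → E → ℝ}, Continuous (fun p : ℝ × E => g p.1 p.2) → (∀ s x, ‖g s x‖ ≤ C) →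
      Integrable (fun θ : ℝ => heat √(2 * (t - t * θ)) (g (t * θ)) x)
        (volume.restrict (Ioo (0 : ℝ) 1)) := fun hg hC =>
    Integrable.of_bound ((continuous_heat_source hg hC).comp (by fun_prop :
      Continuous fun θ : ℝ => (√(2 * (t - t * θ)), t * θ, x))).aestronglyMeasurable C
      (Eventually.of_forall fun θ => norm_heat_le (hC _) _ _)
  rw [duh, duh, duh, ← smul_sub, ← integral_sub (hi h₁ hC₁) (hi h₂ hC₂)]
  congr 2
  ext θ
  exact heat_sub (continuous_source h₁ _) (continuous_source h₂ _) (hC₁ _) (hC₂ _) _ _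

lemma duhD_sub {g₁ g₂ : ℝ → E → ℝ} (h₁ : Continuous fun p : ℝ × E => g₁ p.1 p.2)
    (h₂ : Continuous fun p : ℝ × E => g₂ p.1 p.2) {C : ℝ} (hC₁ : ∀ s x, ‖g₁ s x‖ ≤ C)
    (hC₂ : ∀ s x, ‖g₂ s x‖ ≤ C) {t : ℝ} (ht : 0 ≤ t) (x : E) :
    duhD g₁ t x - duhD g₂ t x = duhD (fun s y => g₁ s y - g₂ s y) t x := by
  rcases ht.eq_or_lt with rfl | ht
  · simp [duhD]
  rw [duhD, duhD, duhD, ← smul_sub, ← integral_sub (integrable_heatD_source h₁ hC₁ ht x)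
    (integrable_heatD_source h₂ hC₂ ht x)]
  congr 2
  ext1 θ
  exact heatD_sub (continuous_source h₁ _) (continuous_source h₂ _) (hC₁ _) (hC₂ _) _ _

/-- Short-time solvability of the integral equation for the pair `(u, Du)` with a bounded, globally
Lipschitz nonlinearity. -/
theorem exists_mild_fixedPoint {N : ℝ × (E →L[ℝ] ℝ) → E → ℝ}
    (hN : Continuous fun w : (ℝ × (E →L[ℝ] ℝ)) × E => N w.1 w.2) {C L : ℝ} (hL : 0 ≤ L)
    (hC : ∀ w x, ‖N w x‖ ≤ C) (hLip : ∀ w w' x, ‖N w x - N w' x‖ ≤ L * dist w w')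
    {u₀ : E → ℝ} {u₀' : E → E →L[ℝ] ℝ} (hu₀ : ∀ x, HasFDerivAt u₀ (u₀' x) x)
    (hu₀' : Continuous u₀') {A : ℝ} (hA : ∀ x, ‖u₀ x‖ ≤ A) (hA' : ∀ x, ‖u₀' x‖ ≤ A)
    {τ : ℝ} (hτ : 0 ≤ τ) (hτL : (τ + √τ * duhConst E) * L < 1) :
    ∃ g : ℝ → E → ℝ, Continuous (fun p : ℝ × E => g p.1 p.2) ∧ (∀ s x, ‖g s x‖ ≤ C) ∧
      ∀ t ∈ Icc 0 τ, ∀ x, g t x = N (mild u₀ g t x, mildD u₀' g t x) x := by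
  have hC0 : 0 ≤ C := (norm_nonneg _).trans (hC 0 0)
  have hA0 : 0 ≤ A := (norm_nonneg _).trans (hA 0)
  have hc0 := duhConst_nonneg (E := E)
  -- Clamping time to `[0, τ]` lets the map act on bounded continuous functions on all of `ℝ × E`.
  let c : ℝ → ℝ := fun t => max 0 (min t τ)
  have hc : Continuous c := by fun_prop
  have hc_nonneg : ∀ t, 0 ≤ c t := fun t => le_max_left _ _
  have hc_le : ∀ t, c t ≤ τ := fun t => max_le hτ (min_le_right _ _)
  have hc_eq : ∀ t ∈ Icc 0 τ, c t = t := fun t ht => by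
    simp only [c]; rw [min_eq_left ht.2, max_eq_right ht.1]
  -- The function and its gradient are independent unknowns, so a sup-norm space suffices. That the
  -- second component is the derivative of the first follows afterwards from `hasFDerivAt_mild`.
  let X := (ℝ × E) →ᵇ (ℝ × (E →L[ℝ] ℝ))
  let src : X → ℝ → E → ℝ := fun z s x => N (z (s, x)) x
  have hsrc : ∀ z : X, Continuous fun p : ℝ × E => src z p.1 p.2 := fun z =>
    hN.comp ((z.continuous.comp (by fun_prop)).prodMk continuous_snd)
  have hsrcC : ∀ (z : X) s x, ‖src z s x‖ ≤ C := fun z s x => hC _ _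
  have hcont : ∀ z : X, Continuous fun p : ℝ × E =>
      (mild u₀ (src z) (c p.1) p.2, mildD u₀' (src z) (c p.1) p.2) := fun z => by
    refine Continuous.prodMk ?_ ?_
    · exact (continuous_mild (hsrc z) (hsrcC z) hu₀ hA).comp (by fun_prop :
        Continuous fun p : ℝ × E => (c p.1, p.2))
    · exact (continuousOn_mildD (hsrc z) (hsrcC z) hu₀' hA').comp_continuous (by fun_prop :
        Continuous fun p : ℝ × E => (c p.1, p.2)) fun p => ⟨hc_nonneg _, mem_univ _⟩
  have hbound : ∀ (z : X) (p : ℝ × E),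
      ‖(mild u₀ (src z) (c p.1) p.2, mildD u₀' (src z) (c p.1) p.2)‖ ≤
        A + τ * C + √τ * (C * duhConst E) := fun z p => by
    have h1 := norm_mild_le (hsrcC z) hA (hc_nonneg p.1) p.2
    have h2 := norm_mildD_le (hsrcC z) hA' (hc_nonneg p.1) p.2
    have h3 : c p.1 * C ≤ τ * C := mul_le_mul_of_nonneg_right (hc_le _) hC0
    have h4 : √(c p.1) * (C * duhConst E) ≤ √τ * (C * duhConst E) :=
      mul_le_mul_of_nonneg_right (Real.sqrt_le_sqrt (hc_le _)) (by positivity)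
    have h5 : 0 ≤ τ * C := by positivity
    have h6 : 0 ≤ √τ * (C * duhConst E) := by positivity
    exact max_le (by linarith) (by linarith)
  let Φ : X → X := fun z => BoundedContinuousFunction.ofNormedAddCommGroup _ (hcont z) _ (hbound z)
  have hdiff : ∀ (z z' : X) s x, ‖src z s x - src z' s x‖ ≤ L * dist z z' := fun z z' s x =>
    (hLip _ _ _).trans (mul_le_mul_of_nonneg_left (BoundedContinuousFunction.dist_coe_le_dist _) hL)
  have hcontr : ContractingWith (Real.toNNReal ((τ + √τ * duhConst E) * L)) Φ := by
    refine ⟨by rwa [Real.toNNReal_lt_one], LipschitzWith.of_dist_le_mul fun z z' => ?_⟩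
    rw [Real.coe_toNNReal _ (by positivity), BoundedContinuousFunction.dist_le (by positivity)]
    rintro ⟨t, x⟩
    have h1 : dist (mild u₀ (src z) (c t) x) (mild u₀ (src z') (c t) x) ≤
        τ * (L * dist z z') := by
      rw [dist_eq_norm, mild, mild, add_sub_add_left_eq_sub,
        duh_sub (hsrc z) (hsrc z') (hsrcC z) (hsrcC z')]
      exact (norm_duh_le (hdiff z z') (hc_nonneg t) x).trans
        (mul_le_mul_of_nonneg_right (hc_le t) (by positivity))
    have h2 : dist (mildD u₀' (src z) (c t) x) (mildD u₀' (src z') (c t) x) ≤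
        √τ * (L * dist z z' * duhConst E) := by
      rw [dist_eq_norm, mildD, mildD, add_sub_add_left_eq_sub,
        duhD_sub (hsrc z) (hsrc z') (hsrcC z) (hsrcC z') (hc_nonneg t)]
      exact (norm_duhD_le (hdiff z z') (hc_nonneg t) x).trans
        (mul_le_mul_of_nonneg_right (Real.sqrt_le_sqrt (hc_le t)) (by positivity))
    have h3 : 0 ≤ τ * (L * dist z z') := by positivity
    have h4 : 0 ≤ √τ * (L * dist z z' * duhConst E) := by positivity
    have h5 : (τ + √τ * duhConst E) * L * dist z z' =
      τ * (L * dist z z') + √τ * (L * dist z z' * duhConst E) := by ring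
    rw [h5]
    exact max_le (h1.trans (le_add_of_nonneg_right h4)) (h2.trans (le_add_of_nonneg_left h3))
  let z := hcontr.fixedPoint Φ
  have hz : Φ z = z := hcontr.fixedPoint_isFixedPt
  refine ⟨src z, hsrc z, hsrcC z, fun t ht x => ?_⟩
  have h1 : z (t, x) = (mild u₀ (src z) (c t) x, mildD u₀' (src z) (c t) x) := by
    conv_lhs => rw [← hz]
    rfl
  change N (z (t, x)) x = _
  rw [h1, hc_eq t ht]

/-- Hölder regularity in space of the mild solution and of its derivative. -/
lemma exists_holder_mild {g : ℝ → E → ℝ} (hg : Continuous fun p : ℝ × E => g p.1 p.2) {C : ℝ}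
    (hC : ∀ s x, ‖g s x‖ ≤ C) {u₀ : E → ℝ} {u₀' : E → E →L[ℝ] ℝ}
    (hu₀ : ∀ x, HasFDerivAt u₀ (u₀' x) x) (hu₀' : Continuous u₀') {A : ℝ}
    (hA : ∀ x, ‖u₀ x‖ ≤ A) (hA' : ∀ x, ‖u₀' x‖ ≤ A) :
    ∃ K, 0 ≤ K ∧ ∀ s, 0 < s → s < 1 → ∀ x y,
      ‖mild u₀ g s x - mild u₀ g s y‖ ≤ K * (√s)⁻¹ * √‖x - y‖ ∧
      ‖mildD u₀' g s x - mildD u₀' g s y‖ ≤ K * (√s)⁻¹ * √‖x - y‖ := by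
  have hC0 : 0 ≤ C := (norm_nonneg _).trans (hC 0 0)
  have hA0 : 0 ≤ A := (norm_nonneg _).trans (hA 0)
  have hm := one_le_gaussianMoment (E := E)
  have hc0 := duhConst_nonneg (E := E)
  set I := ∫ θ in Ioo (0 : ℝ) 1, sing (1 - θ) with hI
  have hI0 : 0 ≤ I := setIntegral_nonneg measurableSet_Ioo fun θ hθ =>
    sing_nonneg (by linarith [hθ.2])
  set D := A + C + C * duhConst E
  set K₁ := 2 * (A * gaussianMoment E) + 2 * (C * gaussianMoment E ^ 2) * I
  have hD0 : 0 ≤ D := by positivity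
  have hK₁ : 0 ≤ K₁ := by positivity
  -- `2D` serves `u`, by interpolation with `q = 1`; `K₁` serves `Du`, whose two parts have Hölder
  -- constants of order `s^{-1/4}` and `s^{1/4}`. For `s < 1` all are absorbed in `s^{-1/2}`.
  refine ⟨2 * D + K₁, by positivity, fun s hs hs1 x y => ?_⟩
  have hs' : √s ≤ 1 := Real.sqrt_le_one.2 hs1.le
  have hsp : 0 < √s := Real.sqrt_pos.2 hs
  have hinv : 1 ≤ (√s)⁻¹ := (one_le_inv₀ hsp).2 hs'
  have hd := Real.sqrt_nonneg ‖x - y‖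
  constructor
  · have h1 : ∀ x, ‖mild u₀ g s x‖ ≤ D := fun x => by
      refine (norm_mild_le hC hA hs.le x).trans ?_
      have : s * C ≤ 1 * C := by gcongr
      have : 0 ≤ C * duhConst E := by positivity
      linarith
    have h2 : ∀ x, ‖mildD u₀' g s x‖ ≤ D := fun x => by
      refine (norm_mildD_le hC hA' hs.le x).trans ?_
      have : √s * (C * duhConst E) ≤ 1 * (C * duhConst E) := by gcongr
      linarith
    have h3 := norm_sub_le_of_bound_of_lip (a := mild u₀ g s x) (b := mild u₀ g s y) (q := 1)
      hD0 one_pos (norm_nonneg (x - y))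
      ((norm_sub_le _ _).trans (by linarith [h1 x, h1 y]))
      ((norm_image_sub_le_of_hasFDerivAt
        (fun x => hasFDerivAt_mild hg hC hu₀ hu₀' hA hA' hs.le x) h2 x y).trans (by simp))
    calc ‖mild u₀ g s x - mild u₀ g s y‖ ≤ 2 * D * 1⁻¹ * √‖x - y‖ := h3
      _ = 2 * D * 1 * √‖x - y‖ := by rw [inv_one]
      _ ≤ (2 * D + K₁) * (√s)⁻¹ * √‖x - y‖ := by gcongr; linarith
  · have h1 := heat_holder hu₀' hA' hs x y
    have h2 := duhD_holder hg hC hs x y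
    have h3 : √s ≤ √√s := by
      refine Real.le_sqrt_of_sq_le ?_
      nlinarith
    have h4 : (√√s)⁻¹ ≤ (√s)⁻¹ := inv_anti₀ hsp h3
    have h5 : s * sing s ≤ (√s)⁻¹ := by
      have : s * sing s = √√s := by
        rw [sing, mul_inv_cancel_left₀ hs.ne']
      rw [this]
      exact (Real.sqrt_le_one.2 hs').trans hinv
    calc ‖mildD u₀' g s x - mildD u₀' g s y‖
        = ‖(heat √(2 * s) u₀' x - heat √(2 * s) u₀' y) + (duhD g s x - duhD g s y)‖ := by
          rw [mildD, mildD]; congr 1; abel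
      _ ≤ 2 * (A * gaussianMoment E) * (√√s)⁻¹ * √‖x - y‖ +
          s * sing s * (2 * (C * gaussianMoment E ^ 2) * I) * √‖x - y‖ :=
          (norm_add_le _ _).trans (add_le_add h1 h2)
      _ ≤ 2 * (A * gaussianMoment E) * (√s)⁻¹ * √‖x - y‖ +
          (√s)⁻¹ * (2 * (C * gaussianMoment E ^ 2) * I) * √‖x - y‖ := by gcongr
      _ = (0 + K₁) * (√s)⁻¹ * √‖x - y‖ := by simp only [K₁]; ring
      _ ≤ (2 * D + K₁) * (√s)⁻¹ * √‖x - y‖ := by gcongr; positivity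

end FixedPoint

/-! ### Local existence of classical solutions -/

section LocalExistence

set_option maxSynthPendingDepth 3
set_option linter.unusedSectionVars false

lemma abs_rpow_sub_rpow_le {p R : ℝ} (hp : 1 ≤ p) {a b : ℝ} (ha : 0 ≤ a) (haR : a ≤ R)
    (hb : 0 ≤ b) (hbR : b ≤ R) : |a ^ p - b ^ p| ≤ p * R ^ (p - 1) * |a - b| := by
  have := (convex_Icc 0 R).norm_image_sub_le_of_norm_hasDerivWithin_le
    (f := fun x : ℝ => x ^ p) (f' := fun x => p * x ^ (p - 1)) (C := p * R ^ (p - 1)) (x := b)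
    (y := a) (fun x _ => (Real.hasDerivAt_rpow_const (Or.inr hp)).hasDerivWithinAt) ?_
    ⟨hb, hbR⟩ ⟨ha, haR⟩
  · simpa [Real.norm_eq_abs] using this
  · intro x hx
    rw [Real.norm_of_nonneg (mul_nonneg (by linarith) (Real.rpow_nonneg hx.1 _))]
    exact mul_le_mul_of_nonneg_left (Real.rpow_le_rpow hx.1 hx.2 (by linarith)) (by linarith)

section Derivatives

variable {E : Type*} [NormedAddCommGroup E] [InnerProductSpace ℝ E] [FiniteDimensional ℝ E]

lemma norm_gradient_eq (f : E → ℝ) (x : E) : ‖∇ f x‖ = ‖fderiv ℝ f x‖ :=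
  LinearIsometryEquiv.norm_map _ _

lemma laplacian_eq_sum_fderiv (f : E → ℝ) (x : E) :
    Δ f x = ∑ i, fderiv ℝ (fderiv ℝ f) x (stdOrthonormalBasis ℝ E i)
      (stdOrthonormalBasis ℝ E i) := by
  rw [InnerProductSpace.laplacian_eq_iteratedFDeriv_stdOrthonormalBasis]
  simp [iteratedFDeriv_two_apply]

lemma iteratedFDeriv_two_eq (f : E → ℝ) (x : E) :
    iteratedFDeriv ℝ 2 f x = (continuousMultilinearCurryRightEquiv' ℝ 1 E ℝ).symm
      ((continuousMultilinearCurryFin1 ℝ E (E →L[ℝ] ℝ)).symm (fderiv ℝ (fderiv ℝ f) x)) := by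
  ext m
  rw [iteratedFDeriv_two_apply]
  simp [continuousMultilinearCurryRightEquiv']
  rfl

lemma contDiff_two_of_hasFDerivAt {f : E → ℝ} {f' : E → E →L[ℝ] ℝ}
    {f'' : E → E →L[ℝ] E →L[ℝ] ℝ} (h1 : ∀ x, HasFDerivAt f (f' x) x)
    (h2 : ∀ x, HasFDerivAt f' (f'' x) x) (h3 : Continuous f'') : ContDiff ℝ 2 f := by
  have e1 : fderiv ℝ f = f' := funext fun x => (h1 x).fderiv
  have e2 : fderiv ℝ f' = f'' := funext fun x => (h2 x).fderiv
  rw [show (2 : WithTop ℕ∞) = 1 + 1 by norm_num, contDiff_succ_iff_fderiv]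
  refine ⟨fun x => (h1 x).differentiableAt, by simp, ?_⟩
  rw [contDiff_one_iff_fderiv, e1, e2]
  exact ⟨fun x => (h2 x).differentiableAt, h3⟩

end Derivatives

variable {n : ℕ}

/-- Truncation of the nonlinearity at level `R`. -/
noncomputable def truncNonlin (p q b R : ℝ) (h : EuclideanSpace ℝ (Fin n) → ℝ)
    (w : ℝ × (EuclideanSpace ℝ (Fin n) →L[ℝ] ℝ)) (x : EuclideanSpace ℝ (Fin n)) : ℝ :=
  min |w.1| R ^ p + b * min ‖w.2‖ R ^ q + h x

lemma continuous_truncNonlin {p q b R : ℝ} (hp : 1 ≤ p) (hq : 1 ≤ q)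
    {h : EuclideanSpace ℝ (Fin n) → ℝ} (hh : Continuous h) :
    Continuous fun w : (ℝ × (EuclideanSpace ℝ (Fin n) →L[ℝ] ℝ)) × EuclideanSpace ℝ (Fin n) =>
      truncNonlin p q b R h w.1 w.2 := by
  unfold truncNonlin
  refine Continuous.add (Continuous.add ?_ (continuous_const.mul ?_)) (hh.comp continuous_snd)
  · exact Continuous.rpow_const (by fun_prop) fun _ => Or.inr (by linarith)
  · exact Continuous.rpow_const (by fun_prop) fun _ => Or.inr (by linarith)

lemma norm_truncNonlin_le {p q b R H : ℝ} (hp : 1 ≤ p) (hq : 1 ≤ q) (hR : 0 ≤ R)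
    {h : EuclideanSpace ℝ (Fin n) → ℝ} (hH : ∀ x, |h x| ≤ H)
    (w : ℝ × (EuclideanSpace ℝ (Fin n) →L[ℝ] ℝ)) (x : EuclideanSpace ℝ (Fin n)) :
    ‖truncNonlin p q b R h w x‖ ≤ R ^ p + |b| * R ^ q + H := by
  have h1 : ∀ {a r : ℝ}, 0 ≤ a → 1 ≤ r → |min a R ^ r| ≤ R ^ r := fun ha hr => by
    rw [abs_of_nonneg (Real.rpow_nonneg (le_min ha hR) _)]
    exact Real.rpow_le_rpow (le_min ha hR) (min_le_right _ _) (by linarith)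
  rw [truncNonlin, Real.norm_eq_abs]
  refine (abs_add_le _ _).trans (add_le_add ((abs_add_le _ _).trans (add_le_add ?_ ?_)) (hH x))
  · exact h1 (abs_nonneg _) hp
  · rw [abs_mul]
    exact mul_le_mul_of_nonneg_left (h1 (norm_nonneg _) hq) (abs_nonneg _)

/-- Both the arguments and the points may differ: `x = y` gives the contraction constant, `x ≠ y`
the Hölder bound of the source. -/
lemma abs_truncNonlin_sub_le {p q b R : ℝ} (hp : 1 ≤ p) (hq : 1 ≤ q) (hR : 0 ≤ R)
    (h : EuclideanSpace ℝ (Fin n) → ℝ) (w w' : ℝ × (EuclideanSpace ℝ (Fin n) →L[ℝ] ℝ))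
    (x y : EuclideanSpace ℝ (Fin n)) :
    |truncNonlin p q b R h w x - truncNonlin p q b R h w' y| ≤
      p * R ^ (p - 1) * ‖w.1 - w'.1‖ + |b| * (q * R ^ (q - 1)) * ‖w.2 - w'.2‖ + |h x - h y| := by
  have hmin : ∀ a c : ℝ, |min a R - min c R| ≤ |a - c| := fun a c => by
    refine (abs_min_sub_min_le_max a R c R).trans ?_
    simp
  have h1 : ∀ {a c r d : ℝ}, 0 ≤ a → 0 ≤ c → 1 ≤ r → |a - c| ≤ d →
      |min a R ^ r - min c R ^ r| ≤ r * R ^ (r - 1) * d := fun ha hc hr hd =>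
    (abs_rpow_sub_rpow_le hr (le_min ha hR) (min_le_right _ _) (le_min hc hR)
      (min_le_right _ _)).trans (mul_le_mul_of_nonneg_left ((hmin _ _).trans hd)
        (mul_nonneg (by linarith) (Real.rpow_nonneg hR _)))
  have h2 := h1 (abs_nonneg w.1) (abs_nonneg w'.1) hp (abs_abs_sub_abs_le_abs_sub _ _)
  have h3 := h1 (norm_nonneg w.2) (norm_nonneg w'.2) hq (abs_norm_sub_norm_le _ _)
  have e : truncNonlin p q b R h w x - truncNonlin p q b R h w' y =
      (min |w.1| R ^ p - min |w'.1| R ^ p) + b * (min ‖w.2‖ R ^ q - min ‖w'.2‖ R ^ q) +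
        (h x - h y) := by
    unfold truncNonlin; ring
  rw [e]
  refine (abs_add_le _ _).trans (add_le_add ((abs_add_le _ _).trans (add_le_add h2 ?_)) le_rfl)
  rw [abs_mul, mul_assoc]
  exact mul_le_mul_of_nonneg_left h3 (abs_nonneg _)

lemma IsBC1.hasFDerivAt {φ : EuclideanSpace ℝ (Fin n) → ℝ} (hφ : IsBC1 φ)
    (x : EuclideanSpace ℝ (Fin n)) : HasFDerivAt φ (fderiv ℝ φ x) x :=
  (hφ.contDiff.differentiable one_ne_zero x).hasFDerivAt

lemma IsBC1.continuous_fderiv {φ : EuclideanSpace ℝ (Fin n) → ℝ} (hφ : IsBC1 φ) :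
    Continuous (fderiv ℝ φ) :=
  hφ.contDiff.continuous_fderiv one_ne_zero

/-- `τ < 1` is for the Hölder estimates, the next two bounds keep `u` and `Du` below the truncation
level, and the last one is the contraction. -/
lemma exists_small_time (C c L : ℝ) :
    ∃ τ : ℝ, 0 < τ ∧ τ < 1 ∧ τ * C ≤ 1 ∧ √τ * (C * c) ≤ 1 ∧ (τ + √τ * c) * L < 1 := by
  have h : ∀ f : ℝ → ℝ, Continuous f → f 0 = 0 → ∀ᶠ τ in 𝓝[>] (0 : ℝ), f τ < 1 := by
    intro f hf h0
    have h1 := (hf.tendsto 0).mono_left (nhdsWithin_le_nhds (s := Ioi (0 : ℝ)))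
    rw [h0] at h1
    exact h1.eventually_lt_const one_pos
  have h1 := h (fun τ => τ) (by fun_prop) rfl
  have h2 := h (fun τ => τ * C) (by fun_prop) (by simp)
  have h3 := h (fun τ => √τ * (C * c)) (by fun_prop) (by simp)
  have h4 := h (fun τ => (τ + √τ * c) * L) (by fun_prop) (by simp)
  have h5 : ∀ᶠ τ in 𝓝[>] (0 : ℝ), 0 < τ := self_mem_nhdsWithin
  obtain ⟨τ, h⟩ := (h1.and (h2.and (h3.and (h4.and h5)))).exists
  exact ⟨τ, h.2.2.2.2, h.1, h.2.1.le, h.2.2.1.le, h.2.2.2.1⟩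

/-- Short-time existence of classical solutions, on a time interval depending on the initial datum
only through a bound of its `C¹` norm. -/
theorem exists_isClassicalSolution {p q b : ℝ} (hp : 1 ≤ p) (hq : 1 ≤ q)
    {h : EuclideanSpace ℝ (Fin n) → ℝ} (hh : IsBC1 h) {A : ℝ} (hA0 : 0 ≤ A) :
    ∃ τ > 0, ∀ u₀ : EuclideanSpace ℝ (Fin n) → ℝ, IsBC1 u₀ → (∀ x, |u₀ x| ≤ A) →
      (∀ x, ‖∇ u₀ x‖ ≤ A) → ∃ v, IsClassicalSolution p q b h u₀ τ v := by
  obtain ⟨H, hH⟩ := hh.bounded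
  obtain ⟨H', hH'⟩ := hh.gradient_bounded
  have hH0 : 0 ≤ H := (abs_nonneg _).trans (hH 0)
  have hH'0 : 0 ≤ H' := (norm_nonneg _).trans (hH' 0)
  -- Data of size `A` grow by at most `1` on `[0, τ]`, so the truncation at `A + 1` is never felt.
  set R := A + 1 with hR
  have hR0 : 0 ≤ R := by positivity
  set C := R ^ p + |b| * R ^ q + H with hC
  have hC0 : 0 ≤ C := by positivity
  set L := p * R ^ (p - 1) + |b| * (q * R ^ (q - 1)) with hL
  have hL0 : 0 ≤ L := by positivity
  have hbound := norm_truncNonlin_le (b := b) hp hq hR0 hH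
  have hcont : Continuous fun w : (ℝ × (EuclideanSpace ℝ (Fin n) →L[ℝ] ℝ)) ×
      EuclideanSpace ℝ (Fin n) => truncNonlin p q b R h w.1 w.2 :=
    continuous_truncNonlin hp hq hh.contDiff.continuous
  have hLip : ∀ (w w' : ℝ × (EuclideanSpace ℝ (Fin n) →L[ℝ] ℝ)) x,
      ‖truncNonlin p q b R h w x - truncNonlin p q b R h w' x‖ ≤ L * dist w w' := by
    intro w w' x
    refine (abs_truncNonlin_sub_le hp hq hR0 h w w' x x).trans ?_
    rw [sub_self, abs_zero, add_zero, hL, add_mul, dist_eq_norm]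
    have h1 : ‖w.1 - w'.1‖ ≤ ‖w - w'‖ := norm_fst_le (w - w')
    have h2 : ‖w.2 - w'.2‖ ≤ ‖w - w'‖ := norm_snd_le (w - w')
    gcongr
  obtain ⟨τ, hτ0, hτ1, hτC, hτC', hτL⟩ :=
    exists_small_time C (duhConst (EuclideanSpace ℝ (Fin n))) L
  refine ⟨τ, hτ0, fun u₀ hu₀ hA hA' => ?_⟩
  have hd := hu₀.hasFDerivAt
  have hd' := hu₀.continuous_fderiv
  have hA'' : ∀ x, ‖fderiv ℝ u₀ x‖ ≤ A := fun x => by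
    rw [← norm_gradient_eq]; exact hA' x
  obtain ⟨g, hg, hgC, hgeq⟩ := exists_mild_fixedPoint hcont hL0 hbound hLip hd hd' hA hA''
    hτ0.le hτL
  obtain ⟨K, hK0, hK⟩ := exists_holder_mild hg hgC hd hd' hA hA''
  -- The source inherits Hölder continuity from `u`, `Du` and `h`; this is what gives access to
  -- second derivatives. The term `2(H + H')` interpolates between the bound and the Lipschitz
  -- constant of `h`.
  have hgK : ∀ s, 0 < s → s < τ → ∀ x y,
      ‖g s x - g s y‖ ≤ (L * K + 2 * (H + H')) * (√s)⁻¹ * √‖x - y‖ := by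
    intro s hs hsτ x y
    have hs1 : s < 1 := hsτ.trans hτ1
    obtain ⟨k1, k2⟩ := hK s hs hs1 x y
    rw [hgeq s ⟨hs.le, hsτ.le⟩, hgeq s ⟨hs.le, hsτ.le⟩]
    refine (abs_truncNonlin_sub_le hp hq hR0 h _ _ x y).trans ?_
    have hinv : 1 ≤ (√s)⁻¹ := (one_le_inv₀ (Real.sqrt_pos.2 hs)).2 (Real.sqrt_le_one.2 hs1.le)
    have k3 : |h x - h y| ≤ 2 * (H + H') * 1⁻¹ * √‖x - y‖ := by
      refine norm_sub_le_of_bound_of_lip (a := h x) (b := h y) (by positivity) one_pos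
        (norm_nonneg (x - y)) ((norm_sub_le _ _).trans ?_)
        ((norm_image_sub_le_of_hasFDerivAt hh.hasFDerivAt
          (fun z => (norm_gradient_eq h z).symm.le.trans (hH' z)) x y).trans ?_)
      · have e1 : ‖h x‖ ≤ H := hH x
        have e2 : ‖h y‖ ≤ H := hH y
        linarith
      · rw [inv_one, one_pow, mul_one]
        exact mul_le_mul_of_nonneg_right (by linarith) (norm_nonneg _)
    have k4 : 2 * (H + H') * 1⁻¹ * √‖x - y‖ ≤ 2 * (H + H') * (√s)⁻¹ * √‖x - y‖ := by
      rw [inv_one]; gcongr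
    calc p * R ^ (p - 1) * ‖mild u₀ g s x - mild u₀ g s y‖ + |b| * (q * R ^ (q - 1)) *
          ‖mildD (fderiv ℝ u₀) g s x - mildD (fderiv ℝ u₀) g s y‖ + |h x - h y|
        ≤ p * R ^ (p - 1) * (K * (√s)⁻¹ * √‖x - y‖) + |b| * (q * R ^ (q - 1)) *
          (K * (√s)⁻¹ * √‖x - y‖) + 2 * (H + H') * (√s)⁻¹ * √‖x - y‖ := by
          gcongr
          exact k3.trans k4
      _ = _ := by rw [hL]; ring
  have hK'0 : 0 ≤ L * K + 2 * (H + H') := by positivity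
  have D1 : ∀ t, 0 ≤ t → ∀ x, HasFDerivAt (mild u₀ g t) (mildD (fderiv ℝ u₀) g t x) x :=
    fun t ht x => hasFDerivAt_mild hg hgC hd hd' hA hA'' ht x
  have D2 : ∀ t ∈ Ioo 0 τ, ∀ x,
      HasFDerivAt (mildD (fderiv ℝ u₀) g t) (mildH (fderiv ℝ u₀) g t x) x :=
    fun t ht x => hasFDerivAt_mildD hg hgC hgK hK'0 hd' hA'' ht.1 ht.2 x
  have DT : ∀ t ∈ Ioo 0 τ, ∀ x, HasDerivAt (fun s => mild u₀ g s x) _ t :=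
    fun t ht x => hasDerivAt_mild_time hg hgC hgK hK'0 hd hd' hA hA'' ht x
  have E1 : ∀ t, 0 ≤ t → fderiv ℝ (mild u₀ g t) = mildD (fderiv ℝ u₀) g t :=
    fun t ht => funext fun x => (D1 t ht x).fderiv
  have E2 : ∀ t ∈ Ioo 0 τ, ∀ x,
      fderiv ℝ (fderiv ℝ (mild u₀ g t)) x = mildH (fderiv ℝ u₀) g t x := fun t ht x => by
    rw [E1 t ht.1.le]; exact (D2 t ht x).fderiv
  have CH := continuousOn_mildH hg hgC hgK hK'0 hd' hA''
  have CD := continuousOn_mildD hg hgC hd' hA''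
  have BU : ∀ t ∈ Icc 0 τ, ∀ x, |mild u₀ g t x| ≤ R := fun t ht x => by
    refine (norm_mild_le hgC hA ht.1 x).trans ?_
    have : t * C ≤ τ * C := mul_le_mul_of_nonneg_right ht.2 hC0
    linarith
  have BD : ∀ t ∈ Icc 0 τ, ∀ x, ‖mildD (fderiv ℝ u₀) g t x‖ ≤ R := fun t ht x => by
    refine (norm_mildD_le hgC hA'' ht.1 x).trans ?_
    have h1 := duhConst_nonneg (E := EuclideanSpace ℝ (Fin n))
    have : √t * (C * duhConst (EuclideanSpace ℝ (Fin n))) ≤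
        √τ * (C * duhConst (EuclideanSpace ℝ (Fin n))) :=
      mul_le_mul_of_nonneg_right (Real.sqrt_le_sqrt ht.2) (by positivity)
    linarith
  refine ⟨mild u₀ g, ?_⟩
  exact
    { differentiableAt_time := fun t ht x => (DT t ht x).differentiableAt
      contDiff_space := fun t ht => by
        refine contDiff_two_of_hasFDerivAt (D1 t ht.1.le) (D2 t ht) ?_
        exact CH.comp_continuous (f := fun x => (t, x)) (by fun_prop) fun x => ⟨ht, mem_univ _⟩
      continuousOn_deriv_time := by
        have h1 : ContinuousOn (fun z : ℝ × EuclideanSpace ℝ (Fin n) =>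
            (∑ i, mildH (fderiv ℝ u₀) g z.1 z.2 (stdOrthonormalBasis ℝ _ i)
              (stdOrthonormalBasis ℝ _ i)) + g z.1 z.2) (Ioo 0 τ ×ˢ univ) :=
          (continuousOn_finsetSum _ fun i _ =>
            (CH.clm_apply continuousOn_const).clm_apply continuousOn_const).add hg.continuousOn
        exact h1.congr fun z hz => (DT z.1 hz.1 z.2).deriv
      continuousOn_second_deriv := by
        have h1 := (continuousMultilinearCurryRightEquiv' ℝ 1 (EuclideanSpace ℝ (Fin n))
          ℝ).symm.continuous.comp_continuousOn
          ((continuousMultilinearCurryFin1 ℝ (EuclideanSpace ℝ (Fin n))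
            (EuclideanSpace ℝ (Fin n) →L[ℝ] ℝ)).symm.continuous.comp_continuousOn CH)
        refine h1.congr fun z hz => ?_
        rw [iteratedFDeriv_two_eq, E2 z.1 hz.1]
        rfl
      continuousOn := (continuous_mild hg hgC hd hA).continuousOn
      continuousOn_gradient := by
        have h1 := (InnerProductSpace.toDual ℝ
          (EuclideanSpace ℝ (Fin n))).symm.continuous.comp_continuousOn
          (CD.mono (prod_mono Ico_subset_Ici_self subset_rfl) :
            ContinuousOn _ (Ico 0 τ ×ˢ univ))
        refine h1.congr fun z hz => ?_
        rw [gradient, E1 z.1 hz.1.1]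
        rfl
      bounded := ⟨R, fun t ht x => BU t ⟨ht.1, ht.2.le⟩ x⟩
      gradient_bounded := ⟨R, fun t ht x => by
        rw [norm_gradient_eq, E1 t ht.1]
        exact BD t ⟨ht.1, ht.2.le⟩ x⟩
      equation := fun t ht x => by
        have ht' : t ∈ Icc 0 τ := ⟨ht.1.le, ht.2.le⟩
        have h1 : Δ (mild u₀ g t) x = ∑ i, mildH (fderiv ℝ u₀) g t x
            (stdOrthonormalBasis ℝ _ i) (stdOrthonormalBasis ℝ _ i) := by
          rw [laplacian_eq_sum_fderiv, E2 t ht]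
        rw [(DT t ht x).deriv, h1, add_sub_cancel_left, hgeq t ht', truncNonlin,
          norm_gradient_eq, E1 t ht.1.le, min_eq_left (BU t ht' x), min_eq_left (BD t ht' x)]
      initial := fun x => by simp [mild, duh, heat] }

end LocalExistence

/-! ### The maximum principle on the whole space -/

section MaximumPrinciple

set_option maxSynthPendingDepth 3

lemma second_deriv_nonpos_of_isMax {E : Type*} [NormedAddCommGroup E] [NormedSpace ℝ E]
    {f : E → ℝ} {f' : E → E →L[ℝ] ℝ} {f'' : E →L[ℝ] E →L[ℝ] ℝ} {x : E}
    (h1 : ∀ y, HasFDerivAt f (f' y) y) (h2 : HasFDerivAt f' f'' x) (hmax : ∀ y, f y ≤ f x)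
    (v : E) : f'' v v ≤ 0 := by
  have h0 : f' x = 0 := IsLocalMax.hasFDerivAt_eq_zero (Eventually.of_forall hmax) (h1 x)
  have ht := Convex.taylor_approx_two_segment (s := (univ : Set E)) (f := f) (f' := f')
    (f'' := f'') (x := x) convex_univ (fun y _ => h1 y) (mem_univ x)
    h2.hasFDerivWithinAt (v := 0) (w := v) (by simp) (by simp)
  have h3 := (ht.tendsto_div_nhds_zero.const_mul 2).add_const (f'' v v)
  rw [mul_zero, zero_add] at h3
  refine le_of_tendsto h3 ?_
  filter_upwards [self_mem_nhdsWithin] with k hk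
  have hk : 0 < k := hk
  have e : 2 * ((f (x + k • (0 : E) + k • v) - f (x + k • (0 : E)) - k • f' x v -
      k ^ 2 • f'' 0 v - (k ^ 2 / 2) • f'' v v) / k ^ 2) + f'' v v =
      2 * (f (x + k • v) - f x) / k ^ 2 := by
    simp only [smul_zero, add_zero, h0, map_zero, _root_.zero_apply, smul_eq_mul]
    field_simp
    ring
  rw [e]
  exact div_nonpos_of_nonpos_of_nonneg (by linarith [hmax (x + k • v)]) (by positivity)

/-- Only earlier times are compared, since the maximum may be attained at the final time of the
slab. -/
lemma deriv_nonneg_of_isMax_left {f : ℝ → ℝ} {f' t : ℝ} (hf : HasDerivAt f f' t)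
    (hmax : ∀ᶠ s in 𝓝[<] t, f s ≤ f t) : 0 ≤ f' := by
  have h1 : Tendsto (slope f t) (𝓝[<] t) (𝓝 f') :=
    hf.tendsto_slope.mono_left (nhdsWithin_mono t fun s hs => ne_of_lt hs)
  refine ge_of_tendsto h1 ?_
  filter_upwards [hmax, self_mem_nhdsWithin] with s h hs
  rw [slope_def_field]
  have hs : s < t := hs
  exact div_nonneg_of_nonpos (by linarith) (by linarith)

variable {n : ℕ}

/-- The maximum principle for `w_t - Δw ≤ K w + L |∇w|` on the whole space, for functions bounded
above; the inequality is only needed where `w` is positive. -/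
theorem nonpos_of_parabolic_inequality {σ K L : ℝ} (hL : 0 ≤ L)
    {w : ℝ → EuclideanSpace ℝ (Fin n) → ℝ}
    (hdt : ∀ t ∈ Ioo 0 σ, ∀ x, DifferentiableAt ℝ (fun s => w s x) t)
    (hdx : ∀ t ∈ Ioo 0 σ, ContDiff ℝ 2 (w t))
    (hc : ContinuousOn (fun z : ℝ × EuclideanSpace ℝ (Fin n) => w z.1 z.2) (Ico 0 σ ×ˢ univ))
    (hb : ∃ C, ∀ t ∈ Ico 0 σ, ∀ x, w t x ≤ C) (h0 : ∀ x, w 0 x ≤ 0)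
    (hw : ∀ t ∈ Ioo 0 σ, ∀ x, 0 < w t x →
      deriv (fun s => w s x) t - Δ (w t) x ≤ K * w t x + L * ‖∇ (w t) x‖)
    {t : ℝ} (ht : t ∈ Ico 0 σ) (x : EuclideanSpace ℝ (Fin n)) : w t x ≤ 0 := by
  obtain ⟨C, hC⟩ := hb
  -- With this `μ`, the function `ψ = e^{μt}(1 + |x|²)` satisfies `ψ_t - Δψ - L|∇ψ| > 0`, because
  -- `Δ|x|² = 2n` and `2|x| ≤ 1 + |x|²`.
  set μ : ℝ := 2 * n + L + 1 with hμ
  have hμ0 : 0 ≤ μ := by positivity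
  by_contra! hpos
  -- Nothing is known at `σ` itself; the closed slab up to `t₁ < σ` provides compactness.
  obtain ⟨t₁, htt₁, ht₁σ⟩ := exists_between ht.2
  have ht₁ : 0 < t₁ := ht.1.trans_lt htt₁
  -- the barrier parameter
  obtain ⟨ε, hε, hεlt⟩ : ∃ ε > 0, ε * (Real.exp (μ * t) * (1 + ‖x‖ ^ 2)) <
      Real.exp (-K * t) * w t x := by
    have h1 : 0 < Real.exp (-K * t) * w t x := by positivity
    have h2 : 0 < Real.exp (μ * t) * (1 + ‖x‖ ^ 2) := by positivity
    refine ⟨Real.exp (-K * t) * w t x / (2 * (Real.exp (μ * t) * (1 + ‖x‖ ^ 2))), by positivity, ?_⟩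
    rw [div_mul_eq_mul_div, div_lt_iff₀ (by positivity)]
    nlinarith [mul_pos h1 h2]
  -- The exponential removes the term `K w`. Subtracting `εψ` makes `z` negative far out, so a
  -- positive supremum is attained, while `ε` is small enough that `z (t, x)` stays positive.
  set z : ℝ × EuclideanSpace ℝ (Fin n) → ℝ := fun y =>
    Real.exp (-K * y.1) * w y.1 y.2 - ε * (Real.exp (μ * y.1) * (1 + ‖y.2‖ ^ 2)) with hz
  have hzpos : 0 < z (t, x) := by simp only [hz]; linarith
  set C' := Real.exp (|K| * t₁) * |C| with hC'
  have hC'0 : 0 ≤ C' := by positivity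
  obtain ⟨ρ, hρ⟩ : ∃ ρ : ℝ, ∀ s ∈ Icc 0 t₁, ∀ y : EuclideanSpace ℝ (Fin n),
      ρ < ‖y‖ → z (s, y) < 0 := by
    refine ⟨C' / ε + 1, fun s hs y hy => ?_⟩
    have h1 : Real.exp (-K * s) * w s y ≤ C' := by
      have h2 : w s y ≤ |C| := (hC s ⟨hs.1, hs.2.trans_lt ht₁σ⟩ y).trans (le_abs_self C)
      have h3 : Real.exp (-K * s) ≤ Real.exp (|K| * t₁) := by
        apply Real.exp_le_exp.2
        calc -K * s ≤ |K| * s := mul_le_mul_of_nonneg_right (neg_le_abs K) hs.1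
          _ ≤ |K| * t₁ := mul_le_mul_of_nonneg_left hs.2 (abs_nonneg K)
      calc Real.exp (-K * s) * w s y ≤ Real.exp (-K * s) * |C| := by gcongr
        _ ≤ C' := by rw [hC']; gcongr
    have h4 : 1 ≤ Real.exp (μ * s) := Real.one_le_exp (mul_nonneg hμ0 hs.1)
    have h5 : C' < ε * (1 + ‖y‖ ^ 2) := by
      have h6 : 0 ≤ C' / ε := by positivity
      have h7 : C' / ε < 1 + ‖y‖ ^ 2 := by nlinarith
      rw [div_lt_iff₀ hε] at h7
      linarith
    have h8 : ε * (1 + ‖y‖ ^ 2) ≤ ε * (Real.exp (μ * s) * (1 + ‖y‖ ^ 2)) := by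
      refine mul_le_mul_of_nonneg_left ?_ hε.le
      exact le_mul_of_one_le_left (by positivity) h4
    simp only [hz]
    linarith
  have hzc : ContinuousOn z (Icc 0 t₁ ×ˢ Metric.closedBall 0 ρ) := by
    have h1 : ContinuousOn (fun z : ℝ × EuclideanSpace ℝ (Fin n) => w z.1 z.2)
        (Icc 0 t₁ ×ˢ Metric.closedBall 0 ρ) :=
      hc.mono (prod_mono (fun s hs => ⟨hs.1, hs.2.trans_lt ht₁σ⟩) (subset_univ _))
    exact (ContinuousOn.mul (by fun_prop) h1).sub (by fun_prop)
  have hxρ : ‖x‖ ≤ ρ := by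
    by_contra! h
    exact absurd (hρ t ⟨ht.1, htt₁.le⟩ x h) (not_lt.2 hzpos.le)
  have hmem : (t, x) ∈ Icc 0 t₁ ×ˢ Metric.closedBall (0 : EuclideanSpace ℝ (Fin n)) ρ :=
    ⟨⟨ht.1, htt₁.le⟩, by simpa using hxρ⟩
  obtain ⟨⟨s, y⟩, ⟨hs, -⟩, hmax⟩ :=
    (isCompact_Icc.prod (isCompact_closedBall _ _)).exists_isMaxOn ⟨_, hmem⟩ hzc
  have hzs : 0 < z (s, y) := hzpos.trans_le (hmax hmem)
  have hglob : ∀ s' ∈ Icc 0 t₁, ∀ y', z (s', y') ≤ z (s, y) := by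
    intro s' hs' y'
    rcases le_or_gt ‖y'‖ ρ with h | h
    · exact hmax (show (s', y') ∈ _ from ⟨hs', by simpa using h⟩)
    · exact (hρ s' hs' y' h).le.trans hzs.le
  have hs0 : 0 < s := by
    rcases hs.1.eq_or_lt with h | h
    · exfalso
      have h0' : s = 0 := h.symm
      subst h0'
      have h1 : 0 < ε * (1 + ‖y‖ ^ 2) := by positivity
      simp only [hz, mul_zero, Real.exp_zero, one_mul] at hzs
      linarith [h0 y]
    · exact h
  have hsσ : s ∈ Ioo 0 σ := ⟨hs0, hs.2.trans_lt ht₁σ⟩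
  have hws : 0 < w s y := by
    have h1 : 0 < ε * (Real.exp (μ * s) * (1 + ‖y‖ ^ 2)) := by positivity
    simp only [hz] at hzs
    exact pos_of_mul_pos_right (by linarith : 0 < Real.exp (-K * s) * w s y) (Real.exp_pos _).le
  -- the time derivative
  have htime : 0 ≤ (Real.exp (-K * s) * -K * w s y +
      Real.exp (-K * s) * deriv (fun r => w r y) s) -
      ε * (Real.exp (μ * s) * μ * (1 + ‖y‖ ^ 2)) := by
    have h1 : HasDerivAt (fun r => Real.exp (-K * r)) (Real.exp (-K * s) * -K) s := by
      simpa using ((hasDerivAt_id s).const_mul (-K)).exp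
    have h2 : HasDerivAt (fun r => Real.exp (μ * r)) (Real.exp (μ * s) * μ) s := by
      simpa using ((hasDerivAt_id s).const_mul μ).exp
    have h3 := (h1.mul (hdt s hsσ y).hasDerivAt).sub ((h2.mul_const (1 + ‖y‖ ^ 2)).const_mul ε)
    refine deriv_nonneg_of_isMax_left h3 ?_
    filter_upwards [Ioo_mem_nhdsLT hs0] with r hr
    exact hglob r ⟨hr.1.le, hr.2.le.trans hs.2⟩ y
  -- the space derivatives
  set a := Real.exp (-K * s) with ha
  set c := ε * Real.exp (μ * s) with hcdef
  have ha0 : 0 < a := Real.exp_pos _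
  have hc0 : 0 < c := by positivity
  have hd1 : ∀ y', HasFDerivAt (fun y' => z (s, y'))
      (a • fderiv ℝ (w s) y' - c • (2 • innerSL ℝ y')) y' := by
    intro y'
    have h1 := (((hdx s hsσ).differentiable two_ne_zero y').hasFDerivAt.const_mul a)
    have h2 : HasFDerivAt (fun y : EuclideanSpace ℝ (Fin n) => 1 + ‖y‖ ^ 2)
        (2 • innerSL ℝ y') y' := by
      have := ((hasFDerivAt_id y').norm_sq).const_add 1
      simpa using this
    have h3 := h1.sub (h2.const_mul c)
    refine h3.congr_of_eventuallyEq (Eventually.of_forall fun y'' => ?_)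
    simp only [hz, Pi.sub_apply, ha, hcdef]
    ring
  have hd2 : HasFDerivAt (fun y' => a • fderiv ℝ (w s) y' - c • (2 • innerSL ℝ y'))
      (a • fderiv ℝ (fderiv ℝ (w s)) y - c • (2 • (innerSL ℝ :
        EuclideanSpace ℝ (Fin n) →L[ℝ] EuclideanSpace ℝ (Fin n) →L[ℝ] ℝ))) y := by
    have h1 : ContDiff ℝ 1 (fderiv ℝ (w s)) := (hdx s hsσ).fderiv_right (by norm_num)
    have h2 := (h1.differentiable one_ne_zero y).hasFDerivAt.const_smul a
    have h3 : HasFDerivAt (fun y' : EuclideanSpace ℝ (Fin n) => innerSL ℝ y')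
        (innerSL ℝ : EuclideanSpace ℝ (Fin n) →L[ℝ] EuclideanSpace ℝ (Fin n) →L[ℝ] ℝ) y :=
      (innerSL ℝ : EuclideanSpace ℝ (Fin n) →L[ℝ] EuclideanSpace ℝ (Fin n) →L[ℝ] ℝ).hasFDerivAt
    exact h2.sub ((h3.const_smul 2).const_smul c)
  have hmaxs : ∀ y', z (s, y') ≤ z (s, y) := hglob s hs
  have hgrad : a * ‖∇ (w s) y‖ = c * (2 * ‖y‖) := by
    have h1 := IsLocalMax.hasFDerivAt_eq_zero (Eventually.of_forall hmaxs) (hd1 y)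
    have h2 := congrArg norm (sub_eq_zero.1 h1)
    rw [norm_smul, norm_smul, ← norm_gradient_eq, Real.norm_of_nonneg ha0.le,
      Real.norm_of_nonneg hc0.le, ← Nat.cast_smul_eq_nsmul ℝ, norm_smul, innerSL_apply_norm] at h2
    simpa using h2
  have hlap : a * Δ (w s) y ≤ c * (2 * n) := by
    have h1 : ∀ i, a * fderiv ℝ (fderiv ℝ (w s)) y (stdOrthonormalBasis ℝ _ i)
        (stdOrthonormalBasis ℝ _ i) ≤ c * 2 := by
      intro i
      have h2 := second_deriv_nonpos_of_isMax hd1 hd2 hmaxs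
        (stdOrthonormalBasis ℝ (EuclideanSpace ℝ (Fin n)) i)
      have h3 : (innerSL ℝ : EuclideanSpace ℝ (Fin n) →L[ℝ] EuclideanSpace ℝ (Fin n) →L[ℝ] ℝ)
          (stdOrthonormalBasis ℝ (EuclideanSpace ℝ (Fin n)) i)
          (stdOrthonormalBasis ℝ (EuclideanSpace ℝ (Fin n)) i) = 1 := by
        refine (real_inner_self_eq_norm_sq
          (stdOrthonormalBasis ℝ (EuclideanSpace ℝ (Fin n)) i)).trans ?_
        rw [OrthonormalBasis.norm_eq_one, one_pow]
      simp only [_root_.sub_apply, _root_.smul_apply, smul_eq_mul, h3] at h2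
      norm_num at h2
      linarith
    rw [laplacian_eq_sum_fderiv, Finset.mul_sum]
    refine (Finset.sum_le_sum fun i _ => h1 i).trans (le_of_eq ?_)
    simp
    ring
  have hineq := hw s hsσ y hws
  have h1 : a * (deriv (fun r => w r y) s - Δ (w s) y) ≤ a * (K * w s y + L * ‖∇ (w s) y‖) :=
    mul_le_mul_of_nonneg_left hineq ha0.le
  have h2 : 2 * ‖y‖ ≤ 1 + ‖y‖ ^ 2 := by nlinarith [sq_nonneg (‖y‖ - 1)]
  have h3 : L * (a * ‖∇ (w s) y‖) ≤ L * (c * (1 + ‖y‖ ^ 2)) := by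
    rw [hgrad]; gcongr
  have h4 : ε * (Real.exp (μ * s) * μ * (1 + ‖y‖ ^ 2)) = c * (μ * (1 + ‖y‖ ^ 2)) := by
    rw [hcdef]; ring
  -- At the maximum, the inequality for `w` gives `c μ (1 + |y|²) ≤ 2nc + L c (1 + |y|²)`,
  -- impossible for the chosen `μ`.
  rw [h4] at htime
  have h5 : c * (2 * n + 1) * 1 ≤ c * (2 * n + 1) * (1 + ‖y‖ ^ 2) := by
    apply mul_le_mul_of_nonneg_left _ (by positivity)
    nlinarith [sq_nonneg ‖y‖]
  rw [hμ] at htime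
  nlinarith

end MaximumPrinciple

/-! ### Comparison, gradient bound and uniqueness -/

section Comparison

set_option maxSynthPendingDepth 3

variable {n : ℕ}

lemma laplacian_comp_add_right (f : EuclideanSpace ℝ (Fin n) → ℝ) (y x : EuclideanSpace ℝ (Fin n)) :
    Δ (fun x => f (x + y)) x = Δ f (x + y) := by
  simp only [InnerProductSpace.laplacian_eq_iteratedFDeriv_stdOrthonormalBasis,
    iteratedFDeriv_comp_add_right]

lemma gradient_comp_add_right (f : EuclideanSpace ℝ (Fin n) → ℝ) (y x : EuclideanSpace ℝ (Fin n)) :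
    ∇ (fun x => f (x + y)) x = ∇ f (x + y) := by
  simp only [gradient, fderiv_comp_add_right]

namespace IsClassicalSolution

variable {p q b σ : ℝ} {h u₀ : EuclideanSpace ℝ (Fin n) → ℝ}
  {u : ℝ → EuclideanSpace ℝ (Fin n) → ℝ}

lemma translate (hu : IsClassicalSolution p q b h u₀ σ u) (y : EuclideanSpace ℝ (Fin n)) :
    IsClassicalSolution p q b (fun x => h (x + y)) (fun x => u₀ (x + y)) σ
      (fun t x => u t (x + y)) where
  differentiableAt_time t ht x := hu.differentiableAt_time t ht (x + y)
  contDiff_space t ht := (hu.contDiff_space t ht).comp (contDiff_id.add contDiff_const)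
  continuousOn_deriv_time := hu.continuousOn_deriv_time.comp
    (f := fun z : ℝ × EuclideanSpace ℝ (Fin n) => (z.1, z.2 + y)) (by fun_prop)
    fun z hz => ⟨hz.1, mem_univ _⟩
  continuousOn_second_deriv := by
    simp only [iteratedFDeriv_comp_add_right]
    exact hu.continuousOn_second_deriv.comp
      (f := fun z : ℝ × EuclideanSpace ℝ (Fin n) => (z.1, z.2 + y)) (by fun_prop)
      fun z hz => ⟨hz.1, mem_univ _⟩
  continuousOn := hu.continuousOn.comp
    (f := fun z : ℝ × EuclideanSpace ℝ (Fin n) => (z.1, z.2 + y)) (by fun_prop)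
    fun z hz => ⟨hz.1, mem_univ _⟩
  continuousOn_gradient := by
    simp only [gradient_comp_add_right]
    exact hu.continuousOn_gradient.comp
      (f := fun z : ℝ × EuclideanSpace ℝ (Fin n) => (z.1, z.2 + y)) (by fun_prop)
      fun z hz => ⟨hz.1, mem_univ _⟩
  bounded := hu.bounded.imp fun C hC t ht x => hC t ht (x + y)
  gradient_bounded := hu.gradient_bounded.imp fun C hC t ht x => by
    rw [gradient_comp_add_right]; exact hC t ht (x + y)
  equation t ht x := by
    rw [laplacian_comp_add_right, gradient_comp_add_right]
    exact hu.equation t ht (x + y)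
  initial x := hu.initial (x + y)

lemma restrict (hu : IsClassicalSolution p q b h u₀ σ u) {σ' : ℝ} (hσ : σ' ≤ σ) :
    IsClassicalSolution p q b h u₀ σ' u where
  differentiableAt_time t ht := hu.differentiableAt_time t ⟨ht.1, ht.2.trans_le hσ⟩
  contDiff_space t ht := hu.contDiff_space t ⟨ht.1, ht.2.trans_le hσ⟩
  continuousOn_deriv_time :=
    hu.continuousOn_deriv_time.mono (prod_mono (Ioo_subset_Ioo_right hσ) subset_rfl)
  continuousOn_second_deriv :=
    hu.continuousOn_second_deriv.mono (prod_mono (Ioo_subset_Ioo_right hσ) subset_rfl)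
  continuousOn := hu.continuousOn.mono (prod_mono (Ico_subset_Ico_right hσ) subset_rfl)
  continuousOn_gradient :=
    hu.continuousOn_gradient.mono (prod_mono (Ico_subset_Ico_right hσ) subset_rfl)
  bounded := hu.bounded.imp fun _ hC t ht => hC t ⟨ht.1, ht.2.trans_le hσ⟩
  gradient_bounded := hu.gradient_bounded.imp fun _ hC t ht => hC t ⟨ht.1, ht.2.trans_le hσ⟩
  equation t ht := hu.equation t ⟨ht.1, ht.2.trans_le hσ⟩
  initial := hu.initial

lemma shift (hu : IsClassicalSolution p q b h u₀ σ u) {t₀ : ℝ} (ht₀ : 0 ≤ t₀) :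
    IsClassicalSolution p q b h (u t₀) (σ - t₀) (fun t x => u (t₀ + t) x) := by
  have hIoo : ∀ t ∈ Ioo 0 (σ - t₀), t₀ + t ∈ Ioo 0 σ := fun t ht =>
    ⟨by linarith [ht.1], by linarith [ht.2]⟩
  have hIco : ∀ t ∈ Ico 0 (σ - t₀), t₀ + t ∈ Ico 0 σ := fun t ht =>
    ⟨by linarith [ht.1], by linarith [ht.2]⟩
  have hderiv : ∀ t x, deriv (fun s => u (t₀ + s) x) t = deriv (fun s => u s x) (t₀ + t) :=
    fun t x => deriv_comp_const_add (fun s => u s x) t₀ t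
  exact
    { differentiableAt_time := fun t ht x =>
        (hu.differentiableAt_time _ (hIoo t ht) x).comp t (by fun_prop)
      contDiff_space := fun t ht => hu.contDiff_space _ (hIoo t ht)
      continuousOn_deriv_time := by
        simp only [hderiv]
        exact hu.continuousOn_deriv_time.comp
          (f := fun z : ℝ × EuclideanSpace ℝ (Fin n) => (t₀ + z.1, z.2)) (by fun_prop)
          fun z hz => ⟨hIoo _ hz.1, mem_univ _⟩
      continuousOn_second_deriv := hu.continuousOn_second_deriv.comp
        (f := fun z : ℝ × EuclideanSpace ℝ (Fin n) => (t₀ + z.1, z.2)) (by fun_prop)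
        fun z hz => ⟨hIoo _ hz.1, mem_univ _⟩
      continuousOn := hu.continuousOn.comp
        (f := fun z : ℝ × EuclideanSpace ℝ (Fin n) => (t₀ + z.1, z.2)) (by fun_prop)
        fun z hz => ⟨hIco _ hz.1, mem_univ _⟩
      continuousOn_gradient := hu.continuousOn_gradient.comp
        (f := fun z : ℝ × EuclideanSpace ℝ (Fin n) => (t₀ + z.1, z.2)) (by fun_prop)
        fun z hz => ⟨hIco _ hz.1, mem_univ _⟩
      bounded := hu.bounded.imp fun _ hC t ht => hC _ (hIco t ht)
      gradient_bounded := hu.gradient_bounded.imp fun _ hC t ht => hC _ (hIco t ht)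
      equation := fun t ht x => by
        rw [hderiv]
        exact hu.equation _ (hIoo t ht) x
      initial := fun x => by rw [add_zero] }

/-- The maximum principle applies to `-A - u`: `|u|^p` and `h` have a favourable sign, and `|∇u|^q ≤
G^(q-1)|∇u|` makes the gradient term a drift. The bound `G` enters only `L`, which leaves no trace
in the result. -/
lemma neg_le (hu : IsClassicalSolution p q b h u₀ σ u) (hq : 1 ≤ q) (hh : ∀ x, 0 ≤ h x) {A : ℝ}
    (hA : ∀ x, |u₀ x| ≤ A) {t : ℝ} (ht : t ∈ Ico 0 σ) (x : EuclideanSpace ℝ (Fin n)) :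
    -A ≤ u t x := by
  obtain ⟨C, hC⟩ := hu.bounded
  obtain ⟨G, hG⟩ := hu.gradient_bounded
  have hG0 : 0 ≤ G := (norm_nonneg _).trans (hG t ht 0)
  have key := nonpos_of_parabolic_inequality (σ := σ) (K := 0) (L := |b| * G ^ (q - 1))
    (w := fun t x => -A - u t x) (by positivity)
    (fun t ht x => (hu.differentiableAt_time t ht x).const_sub _)
    (fun t ht => contDiff_const.sub (hu.contDiff_space t ht))
    (continuousOn_const.sub hu.continuousOn)
    ⟨-A + C, fun t ht x => by linarith [neg_le_of_abs_le (hC t ht x)]⟩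
    (fun x => by rw [hu.initial]; linarith [neg_le_of_abs_le (hA x)])
    (fun t ht x _ => ?_) ht x
  · linarith
  · have h1 : deriv (fun s => -A - u s x) t = - deriv (fun s => u s x) t := by
      rw [deriv_const_sub]
    have h2 : Δ (fun x => -A - u t x) x = - Δ (u t) x := by
      have := ContDiffAt.laplacian_sub (x := x) (f₁ := fun _ => -A) (f₂ := u t)
        contDiffAt_const (hu.contDiff_space t ht).contDiffAt
      rw [InnerProductSpace.laplacian_const, Pi.zero_apply, zero_sub] at this
      exact this
    have h3 : ‖∇ (fun x => -A - u t x) x‖ = ‖∇ (u t) x‖ := by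
      rw [norm_gradient_eq, norm_gradient_eq, fderiv_const_sub, norm_neg]
    have h4 := hu.equation t ht x
    have h5 : ‖∇ (u t) x‖ ^ q ≤ G ^ (q - 1) * ‖∇ (u t) x‖ := by
      have h6 := hG t (Ioo_subset_Ico_self ht) x
      have h7 : ‖∇ (u t) x‖ ^ q = ‖∇ (u t) x‖ ^ (q - 1) * ‖∇ (u t) x‖ := by
        rcases (norm_nonneg (∇ (u t) x)).eq_or_lt with h0 | h0
        · rw [← h0, mul_zero, Real.zero_rpow (by linarith)]
        · rw [Real.rpow_sub_one h0.ne', div_mul_cancel₀ _ h0.ne']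
      rw [h7]
      exact mul_le_mul_of_nonneg_right
        (Real.rpow_le_rpow (norm_nonneg _) h6 (by linarith)) (norm_nonneg _)
    have h8 : 0 ≤ |u t x| ^ p := Real.rpow_nonneg (abs_nonneg _) _
    have h9 : -(b * ‖∇ (u t) x‖ ^ q) ≤ |b| * (G ^ (q - 1) * ‖∇ (u t) x‖) := by
      have h10 : 0 ≤ ‖∇ (u t) x‖ ^ q := Real.rpow_nonneg (norm_nonneg _) _
      calc -(b * ‖∇ (u t) x‖ ^ q) = -b * ‖∇ (u t) x‖ ^ q := by ring
        _ ≤ |b| * ‖∇ (u t) x‖ ^ q := mul_le_mul_of_nonneg_right (neg_le_abs b) h10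
        _ ≤ _ := mul_le_mul_of_nonneg_left h5 (abs_nonneg b)
    rw [h1, h2, h3]
    linarith [hh x]

/-- Comparison of two bounded solutions whose data and sources are close. -/
lemma sub_le (hu : IsClassicalSolution p q b h u₀ σ u) (hp : 1 ≤ p) (hq : 1 ≤ q)
    {h' v₀ : EuclideanSpace ℝ (Fin n) → ℝ} {v : ℝ → EuclideanSpace ℝ (Fin n) → ℝ}
    (hv : IsClassicalSolution p q b h' v₀ σ v) {R α β : ℝ}
    (huR : ∀ t ∈ Ioo 0 σ, ∀ x, |u t x| ≤ R) (hvR : ∀ t ∈ Ioo 0 σ, ∀ x, |v t x| ≤ R) (hα : 0 ≤ α)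
    (hβ : 0 ≤ β) (h0 : ∀ x, v₀ x - u₀ x ≤ α) (hh : ∀ x, h' x - h x ≤ β) {t : ℝ}
    (ht : t ∈ Ico 0 σ) (x : EuclideanSpace ℝ (Fin n)) :
    v t x - u t x ≤ Real.exp (p * R ^ (p - 1) * t) * (α + β * t) := by
  set K := p * R ^ (p - 1) with hK
  obtain ⟨C, hC⟩ := hu.bounded
  obtain ⟨C', hC'⟩ := hv.bounded
  obtain ⟨G₁, hG₁⟩ := hu.gradient_bounded
  obtain ⟨G₂, hG₂⟩ := hv.gradient_bounded
  set G := max G₁ G₂ with hG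
  have hG0 : 0 ≤ G := ((norm_nonneg _).trans (hG₁ t ht 0)).trans (le_max_left _ _)
  have hσ : 0 < σ := ht.1.trans_lt ht.2
  have hR0 : 0 ≤ R := (abs_nonneg _).trans (huR (σ / 2) ⟨by linarith, by linarith⟩ 0)
  have hK0 : 0 ≤ K := by positivity
  -- The function `e = e^{Kt}(α + βt)` satisfies `e' ≥ K e + β` and `e(0) = α`, so it dominates both
  -- the initial gap and the gap of the sources.
  have he : ∀ t, HasDerivAt (fun t => Real.exp (K * t) * (α + β * t))
      (K * (Real.exp (K * t) * (α + β * t)) + Real.exp (K * t) * β) t := by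
    intro t
    have h1 : HasDerivAt (fun r => Real.exp (K * r)) (Real.exp (K * t) * K) t := by
      simpa using ((hasDerivAt_id t).const_mul K).exp
    have h2 : HasDerivAt (fun r => α + β * r) β t := by
      simpa using ((hasDerivAt_id t).const_mul β).const_add α
    refine (h1.mul h2).congr_deriv ?_
    ring
  have key := nonpos_of_parabolic_inequality (σ := σ) (K := K) (L := |b| * (q * G ^ (q - 1)))
    (w := fun t x => v t x - u t x - Real.exp (K * t) * (α + β * t)) (by positivity)
    (fun t ht x => ((hv.differentiableAt_time t ht x).sub (hu.differentiableAt_time t ht x)).sub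
      (he t).differentiableAt)
    (fun t ht => ((hv.contDiff_space t ht).sub (hu.contDiff_space t ht)).sub contDiff_const)
    ((hv.continuousOn.sub hu.continuousOn).sub (by fun_prop))
    ⟨C' + C, fun t ht x => by
      have h1 : 0 ≤ Real.exp (K * t) * (α + β * t) :=
        mul_nonneg (Real.exp_pos _).le (add_nonneg hα (mul_nonneg hβ ht.1))
      linarith [le_of_abs_le (hC' t ht x), neg_le_of_abs_le (hC t ht x)]⟩
    (fun x => by
      rw [hu.initial, hv.initial, mul_zero, mul_zero, Real.exp_zero]
      linarith [h0 x])
    (fun t ht x hw => ?_) ht x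
  · linarith
  · have ht' := Ioo_subset_Ico_self ht
    set e := Real.exp (K * t) * (α + β * t) with hedef
    have he0 : 0 ≤ e := mul_nonneg (Real.exp_pos _).le (add_nonneg hα (mul_nonneg hβ ht.1.le))
    have hd : 0 ≤ v t x - u t x := by linarith
    have h1 : deriv (fun s => v s x - u s x - Real.exp (K * s) * (α + β * s)) t =
        deriv (fun s => v s x) t - deriv (fun s => u s x) t - (K * e + Real.exp (K * t) * β) :=
      (((hv.differentiableAt_time t ht x).hasDerivAt.sub
        (hu.differentiableAt_time t ht x).hasDerivAt).sub (he t)).deriv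
    have h2 : Δ (fun x => v t x - u t x - e) x = Δ (v t) x - Δ (u t) x := by
      have c1 := (hv.contDiff_space t ht).contDiffAt (x := x)
      have c2 := (hu.contDiff_space t ht).contDiffAt (x := x)
      have e1 := ContDiffAt.laplacian_sub (x := x) (f₁ := v t - u t) (f₂ := fun _ => e)
        (c1.sub c2) contDiffAt_const
      rw [InnerProductSpace.laplacian_const, Pi.zero_apply, sub_zero,
        ContDiffAt.laplacian_sub c1 c2] at e1
      exact e1
    have h3 : ‖∇ (fun x => v t x - u t x - e) x‖ = ‖∇ (v t) x - ∇ (u t) x‖ := by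
      have c1 := (hv.contDiff_space t ht).differentiable two_ne_zero x
      have c2 := (hu.contDiff_space t ht).differentiable two_ne_zero x
      rw [norm_gradient_eq, fderiv_sub_const, fderiv_fun_sub c1 c2]
      simp only [gradient]
      rw [← map_sub, LinearIsometryEquiv.norm_map]
    have e1 := hu.equation t ht x
    have e2 := hv.equation t ht x
    -- Linear control by `v - u` without absolute value is possible because `v ≥ u` wherever the
    -- inequality is needed.
    have h4 : |v t x| ^ p - |u t x| ^ p ≤ K * (v t x - u t x) := by
      refine (le_abs_self _).trans ((abs_rpow_sub_rpow_le hp (abs_nonneg _) (hvR t ht x)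
        (abs_nonneg _) (huR t ht x)).trans ?_)
      refine mul_le_mul_of_nonneg_left ?_ hK0
      exact (abs_abs_sub_abs_le_abs_sub _ _).trans (abs_of_nonneg hd).le
    have h5 : b * (‖∇ (v t) x‖ ^ q - ‖∇ (u t) x‖ ^ q) ≤
        |b| * (q * G ^ (q - 1)) * ‖∇ (v t) x - ∇ (u t) x‖ := by
      refine (le_abs_self _).trans ?_
      rw [abs_mul, mul_assoc]
      refine mul_le_mul_of_nonneg_left ?_ (abs_nonneg b)
      refine (abs_rpow_sub_rpow_le hq (norm_nonneg _) ((hG₂ t ht' x).trans (le_max_right _ _))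
        (norm_nonneg _) ((hG₁ t ht' x).trans (le_max_left _ _))).trans ?_
      exact mul_le_mul_of_nonneg_left (abs_norm_sub_norm_le _ _) (by positivity)
    have h6 : β ≤ Real.exp (K * t) * β :=
      le_mul_of_one_le_left hβ (Real.one_le_exp (mul_nonneg hK0 ht.1.le))
    rw [h1, h2, h3]
    have h7 := hh x
    nlinarith

/-- The gradient bound: `|∇u(t)|` is controlled by the Lipschitz constants of the data and by the
growth factor of the nonlinearity. -/
lemma norm_gradient_le (hu : IsClassicalSolution p q b h u₀ σ u) (hp : 1 ≤ p) (hq : 1 ≤ q)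
    {R α β : ℝ} (huR : ∀ t ∈ Ioo 0 σ, ∀ x, |u t x| ≤ R)
    (h0 : ∀ x y, |u₀ x - u₀ y| ≤ α * ‖x - y‖) (hh : ∀ x y, |h x - h y| ≤ β * ‖x - y‖)
    (hα : 0 ≤ α) (hβ : 0 ≤ β) {t : ℝ} (ht : t ∈ Ico 0 σ) (x : EuclideanSpace ℝ (Fin n)) :
    ‖∇ (u t) x‖ ≤ Real.exp (p * R ^ (p - 1) * t) * (α + β * t) := by
  have hN : 0 ≤ Real.exp (p * R ^ (p - 1) * t) * (α + β * t) :=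
    mul_nonneg (Real.exp_pos _).le (add_nonneg hα (mul_nonneg hβ ht.1))
  have key : ∀ x y, u t (x + y) - u t x ≤
      Real.exp (p * R ^ (p - 1) * t) * (α + β * t) * ‖y‖ := by
    intro x y
    -- The translate solves the same problem with translated data, which differ by at most the
    -- Lipschitz constants times `‖y‖`.
    have h1 := hu.sub_le hp hq (hu.translate y) huR (fun t ht x => huR t ht (x + y))
      (α := α * ‖y‖) (β := β * ‖y‖) (by positivity) (by positivity)
      (fun x => (le_abs_self _).trans ((h0 _ _).trans (by simp)))
      (fun x => (le_abs_self _).trans ((hh _ _).trans (by simp))) ht x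
    exact h1.trans (le_of_eq (by ring))
  rw [norm_gradient_eq]
  refine norm_fderiv_le_of_lip' ℝ hN (Eventually.of_forall fun y => ?_)
  rw [Real.norm_eq_abs, abs_le]
  have h1 := key x (y - x)
  have h2 := key y (x - y)
  rw [add_sub_cancel] at h1 h2
  rw [norm_sub_rev] at h2
  constructor <;> linarith

lemma unique (hu : IsClassicalSolution p q b h u₀ σ u) (hp : 1 ≤ p) (hq : 1 ≤ q)
    {v : ℝ → EuclideanSpace ℝ (Fin n) → ℝ} (hv : IsClassicalSolution p q b h u₀ σ v) {t : ℝ}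
    (ht : t ∈ Ico 0 σ) (x : EuclideanSpace ℝ (Fin n)) : v t x = u t x := by
  obtain ⟨C, hC⟩ := hu.bounded
  obtain ⟨C', hC'⟩ := hv.bounded
  have b1 : ∀ t ∈ Ioo 0 σ, ∀ x, |u t x| ≤ max C C' := fun t ht x =>
    (hC t (Ioo_subset_Ico_self ht) x).trans (le_max_left _ _)
  have b2 : ∀ t ∈ Ioo 0 σ, ∀ x, |v t x| ≤ max C C' := fun t ht x =>
    (hC' t (Ioo_subset_Ico_self ht) x).trans (le_max_right _ _)
  have h1 := hu.sub_le hp hq hv b1 b2 le_rfl le_rfl (by simp) (by simp) ht x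
  have h2 := hv.sub_le hp hq hu b2 b1 le_rfl le_rfl (by simp) (by simp) ht x
  simp only [zero_mul, add_zero, mul_zero] at h1 h2
  linarith

end IsClassicalSolution

end Comparison

/-! ### Continuation and blow-up -/

section BlowUp

set_option maxSynthPendingDepth 3

variable {n : ℕ}

namespace IsBC1

variable {φ : EuclideanSpace ℝ (Fin n) → ℝ}

lemma norm_gradient_le_gradSupNorm (hφ : IsBC1 φ) (x : EuclideanSpace ℝ (Fin n)) :
    ‖∇ φ x‖ ≤ gradSupNorm φ := by
  obtain ⟨C, hC⟩ := hφ.gradient_bounded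
  exact le_ciSup (f := fun x => ‖∇ φ x‖) ⟨C, by rintro _ ⟨y, rfl⟩; exact hC y⟩ x

lemma gradSupNorm_nonneg (hφ : IsBC1 φ) : 0 ≤ gradSupNorm φ :=
  (norm_nonneg _).trans (hφ.norm_gradient_le_gradSupNorm 0)

lemma abs_le_c1Norm (hφ : IsBC1 φ) (x : EuclideanSpace ℝ (Fin n)) : |φ x| ≤ c1Norm φ := by
  obtain ⟨C, hC⟩ := hφ.bounded
  have h1 := le_ciSup (f := fun x => |φ x|) ⟨C, by rintro _ ⟨y, rfl⟩; exact hC y⟩ x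
  have h2 := hφ.gradSupNorm_nonneg
  rw [c1Norm]
  linarith

lemma gradSupNorm_le_c1Norm (φ : EuclideanSpace ℝ (Fin n) → ℝ) : gradSupNorm φ ≤ c1Norm φ :=
  le_add_of_nonneg_left (Real.iSup_nonneg fun _ => abs_nonneg _)

lemma abs_sub_le (hφ : IsBC1 φ) (x y : EuclideanSpace ℝ (Fin n)) :
    |φ x - φ y| ≤ gradSupNorm φ * ‖x - y‖ :=
  norm_image_sub_le_of_hasFDerivAt hφ.hasFDerivAt
    (fun z => (norm_gradient_eq φ z).symm.le.trans (hφ.norm_gradient_le_gradSupNorm z)) x y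

end IsBC1

/-- Continuity of a function given by `Ψ` before the time `T` and by the translate of `Θ` after
the time `t₀ < T`. -/
lemma continuousOn_glue {E X : Type*} [TopologicalSpace E] [TopologicalSpace X] {T t₀ τ : ℝ}
    (ht₀T : t₀ < T) {I : ℝ → Set ℝ} (hI : ∀ s t, t ∈ I (t₀ + τ) → t < s → t ∈ I s)
    (hI0 : ∀ s t, t ∈ I s → 0 ≤ t) (hIτ : ∀ t, t₀ < t → t ∈ I (t₀ + τ) → t - t₀ ∈ I τ)
    {Φ Ψ Θ : ℝ × E → X} (h1 : ∀ z, z.1 < T → Φ z = Ψ z)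
    (h2 : ∀ z, t₀ < z.1 → Φ z = Θ (z.1 - t₀, z.2))
    (h3 : ∀ s, 0 < s → s < T → ContinuousOn Ψ (I s ×ˢ univ)) (h4 : ContinuousOn Θ (I τ ×ˢ univ)) :
    ContinuousOn Φ (I (t₀ + τ) ×ˢ univ) := by
  refine continuousOn_of_locally_continuousOn fun z hz => ?_
  rcases lt_or_ge z.1 T with hzT | hzT
  · obtain ⟨s, hzs, hsT⟩ := exists_between hzT
    refine ⟨Iio s ×ˢ univ, isOpen_Iio.prod isOpen_univ, ⟨hzs, mem_univ _⟩, ?_⟩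
    refine ((h3 s ((hI0 _ _ hz.1).trans_lt hzs) hsT).mono ?_).congr fun y hy => ?_
    · exact fun y hy => ⟨hI s y.1 hy.1.1 hy.2.1, mem_univ _⟩
    · have h5 : y.1 < s := hy.2.1
      exact h1 y (h5.trans hsT)
  · refine ⟨Ioi t₀ ×ˢ univ, isOpen_Ioi.prod isOpen_univ, ⟨ht₀T.trans_le hzT, mem_univ _⟩, ?_⟩
    have h5 : ContinuousOn (fun z : ℝ × E => Θ (z.1 - t₀, z.2))
        ((I (t₀ + τ) ×ˢ univ) ∩ (Ioi t₀ ×ˢ univ)) :=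
      h4.comp (f := fun z : ℝ × E => (z.1 - t₀, z.2)) (by fun_prop)
        fun y hy => ⟨hIτ y.1 hy.2.1 hy.1.1, mem_univ _⟩
    exact h5.congr fun y hy => h2 y hy.2.1

namespace IsClassicalSolution

variable {p q b : ℝ} {h u₀ : EuclideanSpace ℝ (Fin n) → ℝ}
  {u : ℝ → EuclideanSpace ℝ (Fin n) → ℝ}

lemma isBC1 {σ : ℝ} (hu : IsClassicalSolution p q b h u₀ σ u) {t : ℝ} (ht : t ∈ Ioo 0 σ) :
    IsBC1 (u t) where
  contDiff := (hu.contDiff_space t ht).of_le (by norm_num)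
  bounded := hu.bounded.imp fun _ hC => hC t (Ioo_subset_Ico_self ht)
  gradient_bounded := hu.gradient_bounded.imp fun _ hC => hC t (Ioo_subset_Ico_self ht)

lemma abs_le_max {σ : ℝ} (hu : IsClassicalSolution p q b h u₀ σ u) (hq : 1 ≤ q)
    (hu₀ : IsBC1 u₀) (hh : ∀ x, 0 ≤ h x) {M : ℝ} (hM : ∀ t ∈ Ioo 0 σ, ∀ x, u t x ≤ M) {t : ℝ}
    (ht : t ∈ Ioo 0 σ) (x : EuclideanSpace ℝ (Fin n)) : |u t x| ≤ max M (c1Norm u₀) := by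
  rw [abs_le]
  refine ⟨?_, (hM t ht x).trans (le_max_left _ _)⟩
  have h1 := hu.neg_le hq hh hu₀.abs_le_c1Norm (Ioo_subset_Ico_self ht) x
  exact (neg_le_neg (le_max_right _ _)).trans h1

/-- Gluing: a solution on every `[0, s)` with `s < T` is continued by a solution starting from its
value at `t₀ < T`, provided the two coincide on `[t₀, T)`. -/
lemma glue {T t₀ τ : ℝ} (hu : ∀ s, 0 < s → s < T → IsClassicalSolution p q b h u₀ s u)
    (hbdd : ∃ C, ∀ t ∈ Ico 0 T, ∀ x, |u t x| ≤ C)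
    (hgbdd : ∃ C, ∀ t ∈ Ico 0 T, ∀ x, ‖∇ (u t) x‖ ≤ C)
    {v : ℝ → EuclideanSpace ℝ (Fin n) → ℝ} (ht₀ : 0 < t₀) (ht₀T : t₀ < T)
    (hv : IsClassicalSolution p q b h (u t₀) τ v)
    (hvu : ∀ t ∈ Ico t₀ T, ∀ x, v (t - t₀) x = u t x) :
    IsClassicalSolution p q b h u₀ (t₀ + τ) (fun t => if t < T then u t else v (t - t₀)) := by
  set W : ℝ → EuclideanSpace ℝ (Fin n) → ℝ := fun t => if t < T then u t else v (t - t₀) with hW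
  have hWu : ∀ t, t < T → W t = u t := fun t ht => if_pos ht
  -- By agreement on `[t₀, T)`, the glued function is the translate of `v` on a whole neighbourhood
  -- of every `t ≥ T`, so nothing has to be matched at the seam.
  have hWv : ∀ t, t₀ ≤ t → W t = v (t - t₀) := fun t ht => by
    by_cases h : t < T
    · rw [hWu t h]
      ext x
      exact (hvu t ⟨ht, h⟩ x).symm
    · exact if_neg h
  have eu : ∀ t, t < T → ∀ x, (fun s => W s x) =ᶠ[𝓝 t] fun s => u s x := fun t ht x => by
    filter_upwards [Iio_mem_nhds ht] with s hs
    rw [hWu s hs]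
  have ev : ∀ t, t₀ < t → ∀ x, (fun s => W s x) =ᶠ[𝓝 t] fun s => v (s - t₀) x := fun t ht x => by
    filter_upwards [Ioi_mem_nhds ht] with s hs
    rw [hWv s (le_of_lt hs)]
  have dv : ∀ t, t₀ < t → ∀ x,
      deriv (fun s => W s x) t = deriv (fun s => v s x) (t - t₀) := fun t ht x => by
    rw [(ev t ht x).deriv_eq]
    exact deriv_comp_sub_const (fun s => v s x) t₀ t
  have hs : ∀ t, 0 ≤ t → t < T → ∃ s, t < s ∧ s < T ∧ IsClassicalSolution p q b h u₀ s u :=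
    fun t ht htT => by
      obtain ⟨s, hts, hsT⟩ := exists_between htT
      exact ⟨s, hts, hsT, hu s (ht.trans_lt hts) hsT⟩
  have hIoo : ∀ t, T ≤ t → t ∈ Ioo 0 (t₀ + τ) → t - t₀ ∈ Ioo 0 τ := fun t h ht =>
    ⟨by linarith, by linarith [ht.2]⟩
  have hIco : ∀ t, T ≤ t → t ∈ Ico 0 (t₀ + τ) → t - t₀ ∈ Ico 0 τ := fun t h ht =>
    ⟨by linarith, by linarith [ht.2]⟩
  have hI1 : ∀ s t, t ∈ Ioo 0 (t₀ + τ) → t < s → t ∈ Ioo 0 s := fun s t ht hts => ⟨ht.1, hts⟩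
  have hI2 : ∀ s t : ℝ, t ∈ Ioo 0 s → 0 ≤ t := fun s t ht => ht.1.le
  have hI3 : ∀ t, t₀ < t → t ∈ Ioo 0 (t₀ + τ) → t - t₀ ∈ Ioo 0 τ := fun t ht h =>
    ⟨sub_pos.2 ht, by linarith [h.2]⟩
  have hJ1 : ∀ s t, t ∈ Ico 0 (t₀ + τ) → t < s → t ∈ Ico 0 s := fun s t ht hts => ⟨ht.1, hts⟩
  have hJ2 : ∀ s t : ℝ, t ∈ Ico 0 s → 0 ≤ t := fun s t ht => ht.1
  have hJ3 : ∀ t, t₀ < t → t ∈ Ico 0 (t₀ + τ) → t - t₀ ∈ Ico 0 τ := fun t ht h =>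
    ⟨(sub_pos.2 ht).le, by linarith [h.2]⟩
  obtain ⟨C₁, hC₁⟩ := hbdd
  obtain ⟨C₂, hC₂⟩ := hgbdd
  obtain ⟨C₃, hC₃⟩ := hv.bounded
  obtain ⟨C₄, hC₄⟩ := hv.gradient_bounded
  exact
    { differentiableAt_time := fun t ht x => by
        rcases lt_or_ge t T with h | h
        · obtain ⟨s, hts, hsT, hus⟩ := hs t ht.1.le h
          exact (hus.differentiableAt_time t ⟨ht.1, hts⟩ x).congr_of_eventuallyEq (eu t h x)
        · refine DifferentiableAt.congr_of_eventuallyEq ?_ (ev t (ht₀T.trans_le h) x)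
          exact DifferentiableAt.comp (f := fun s => s - t₀) t
            (hv.differentiableAt_time (t - t₀) (hIoo t h ht) x) (by fun_prop)
      contDiff_space := fun t ht => by
        rcases lt_or_ge t T with h | h
        · obtain ⟨s, hts, hsT, hus⟩ := hs t ht.1.le h
          rw [hWu t h]
          exact hus.contDiff_space t ⟨ht.1, hts⟩
        · rw [hWv t (ht₀T.le.trans h)]
          exact hv.contDiff_space _ (hIoo t h ht)
      continuousOn_deriv_time := continuousOn_glue (I := fun s => Ioo 0 s) ht₀T hI1 hI2 hI3
        (fun z hz => (eu z.1 hz z.2).deriv_eq)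
        (fun z hz => dv z.1 hz z.2) (fun s h0 h1 => (hu s h0 h1).continuousOn_deriv_time)
        hv.continuousOn_deriv_time
      continuousOn_second_deriv := continuousOn_glue (I := fun s => Ioo 0 s) ht₀T hI1 hI2 hI3
        (fun z hz => by rw [hWu z.1 hz])
        (fun z hz => by rw [hWv z.1 hz.le]) (fun s h0 h1 => (hu s h0 h1).continuousOn_second_deriv)
        hv.continuousOn_second_deriv
      continuousOn := continuousOn_glue (I := fun s => Ico 0 s) ht₀T hJ1 hJ2 hJ3
        (fun z hz => by rw [hWu z.1 hz])
        (fun z hz => by rw [hWv z.1 hz.le]) (fun s h0 h1 => (hu s h0 h1).continuousOn)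
        hv.continuousOn
      continuousOn_gradient := continuousOn_glue (I := fun s => Ico 0 s) ht₀T hJ1 hJ2 hJ3
        (fun z hz => by rw [hWu z.1 hz])
        (fun z hz => by rw [hWv z.1 hz.le]) (fun s h0 h1 => (hu s h0 h1).continuousOn_gradient)
        hv.continuousOn_gradient
      bounded := ⟨max C₁ C₃, fun t ht x => by
        rcases lt_or_ge t T with h | h
        · rw [hWu t h]
          exact (hC₁ t ⟨ht.1, h⟩ x).trans (le_max_left _ _)
        · rw [hWv t (ht₀T.le.trans h)]
          exact (hC₃ _ (hIco t h ht) x).trans (le_max_right _ _)⟩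
      gradient_bounded := ⟨max C₂ C₄, fun t ht x => by
        rcases lt_or_ge t T with h | h
        · rw [hWu t h]
          exact (hC₂ t ⟨ht.1, h⟩ x).trans (le_max_left _ _)
        · rw [hWv t (ht₀T.le.trans h)]
          exact (hC₄ _ (hIco t h ht) x).trans (le_max_right _ _)⟩
      equation := fun t ht x => by
        rcases lt_or_ge t T with h | h
        · obtain ⟨s, hts, hsT, hus⟩ := hs t ht.1.le h
          rw [(eu t h x).deriv_eq, hWu t h]
          exact hus.equation t ⟨ht.1, hts⟩ x
        · rw [dv t (ht₀T.trans_le h) x, hWv t (ht₀T.le.trans h)]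
          exact hv.equation _ (hIoo t h ht) x
      initial := fun x => by
        have hT : 0 < T := ht₀.trans ht₀T
        rw [hWu 0 hT]
        obtain ⟨s, -, -, hus⟩ := hs 0 le_rfl hT
        exact hus.initial x }

end IsClassicalSolution

/-- The explicit gradient bound. -/
noncomputable def gradientBound (p M τ A B : ℝ) : ℝ :=
  Real.exp (p * max M A ^ (p - 1) * τ) * (|A| + |B| * |τ|) + 1

/-- The absolute values and the `+ 1` in `gradientBound` serve only to make it positive for
arbitrary real arguments. -/
lemma gradientBound_pos (p M τ A B : ℝ) : 0 < gradientBound p M τ A B := by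
  unfold gradientBound; positivity

lemma IsMaximalClassicalSolution.norm_gradient_le {p q b : ℝ}
    {h u₀ : EuclideanSpace ℝ (Fin n) → ℝ} {T : EReal} {u : ℝ → EuclideanSpace ℝ (Fin n) → ℝ}
    (hp : 1 < p) (hq : 1 ≤ q) (hu₀ : IsBC1 u₀) (hh : IsBC1 h) (hh0 : ∀ x, 0 ≤ h x)
    (hu : IsMaximalClassicalSolution p q b h u₀ T u) {M τ : ℝ} (hM : 0 < M)
    (huM : ∀ t : ℝ, 0 < t → (t : EReal) < min T (τ : EReal) → ∀ x, u t x ≤ M) {t : ℝ} (ht : 0 < t)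
    (htT : (t : EReal) < min T (τ : EReal)) (x : EuclideanSpace ℝ (Fin n)) :
    ‖∇ (u t) x‖ ≤ gradientBound p M τ (c1Norm u₀) (gradSupNorm h) := by
  -- `u` is known to be a classical solution only on intervals strictly inside `[0, T)`; the
  -- estimate does not depend on the choice of `σ`.
  obtain ⟨σ, htσ, hσ⟩ := EReal.lt_iff_exists_real_btwn.1 htT
  have htσ' : t < σ := EReal.coe_lt_coe_iff.1 htσ
  have hσT : (σ : EReal) < T := hσ.trans_le (min_le_left _ _)
  have hστ : σ < τ := EReal.coe_lt_coe_iff.1 (hσ.trans_le (min_le_right _ _))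
  have hsol := hu.solution σ (ht.trans htσ') hσT
  have hM' : ∀ t ∈ Ioo 0 σ, ∀ x, u t x ≤ M := fun t ht x =>
    huM t ht.1 ((EReal.coe_lt_coe_iff.2 ht.2).trans hσ) x
  have hA0 : 0 ≤ c1Norm u₀ := hu₀.gradSupNorm_nonneg.trans (IsBC1.gradSupNorm_le_c1Norm u₀)
  have hB0 := hh.gradSupNorm_nonneg
  have h1 := hsol.norm_gradient_le hp.le hq (R := max M (c1Norm u₀)) (α := c1Norm u₀)
    (β := gradSupNorm h) (fun t ht x => hsol.abs_le_max hq hu₀ hh0 hM' ht x)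
    (fun x y => (hu₀.abs_sub_le x y).trans (mul_le_mul_of_nonneg_right
      (IsBC1.gradSupNorm_le_c1Norm u₀) (norm_nonneg _)))
    hh.abs_sub_le hA0 hB0 ⟨ht.le, htσ'⟩ x
  refine h1.trans ?_
  have hK : 0 ≤ p * max M (c1Norm u₀) ^ (p - 1) :=
    mul_nonneg (by linarith) (Real.rpow_nonneg (hM.le.trans (le_max_left _ _)) _)
  have htτ : t ≤ τ := (htσ'.trans hστ).le
  rw [gradientBound, abs_of_nonneg hA0, abs_of_nonneg hB0, abs_of_nonneg (ht.le.trans htτ)]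
  have h2 : Real.exp (p * max M (c1Norm u₀) ^ (p - 1) * t) * (c1Norm u₀ + gradSupNorm h * t) ≤
      Real.exp (p * max M (c1Norm u₀) ^ (p - 1) * τ) * (c1Norm u₀ + gradSupNorm h * τ) := by
    gcongr
  linarith

/-- Otherwise `u` would be bounded in `C¹` up to the existence time and could be continued past it.
-/
lemma IsMaximalClassicalSolution.limsup_eq_top {p q b : ℝ}
    {h u₀ : EuclideanSpace ℝ (Fin n) → ℝ} {T : EReal} {u : ℝ → EuclideanSpace ℝ (Fin n) → ℝ}
    (hp : 1 < p) (hq : 1 ≤ q) (hu₀ : IsBC1 u₀) (hh : IsBC1 h) (hh0 : ∀ x, 0 ≤ h x)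
    (hu : IsMaximalClassicalSolution p q b h u₀ T u) (hT : T < ⊤) :
    limsup (fun t : ℝ => ⨆ x, (u t x : EReal)) (𝓝[<] T.toReal) = ⊤ := by
  have hTbot : T ≠ ⊥ := ne_bot_of_gt hu.time_pos
  obtain ⟨S, rfl⟩ : ∃ S : ℝ, T = (S : EReal) := ⟨T.toReal, (EReal.coe_toReal hT.ne hTbot).symm⟩
  rw [EReal.toReal_coe]
  have hS : 0 < S := by exact_mod_cast hu.time_pos
  have hsol : ∀ s, 0 < s → s < S → IsClassicalSolution p q b h u₀ s u := fun s h0 h1 =>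
    hu.solution s h0 (EReal.coe_lt_coe_iff.2 h1)
  by_contra hne
  obtain ⟨M', hM', -⟩ := EReal.lt_iff_exists_real_btwn.1 (lt_top_iff_ne_top.2 hne)
  have hev := eventually_lt_of_limsup_lt hM'
  obtain ⟨a, haS, ha⟩ := mem_nhdsLT_iff_exists_Ioo_subset.1 hev
  have haS : a < S := haS
  -- a uniform upper bound of the solution
  obtain ⟨M, hM0, hM⟩ : ∃ M : ℝ, 0 < M ∧ ∀ t, 0 < t → t < S → ∀ x, u t x ≤ M := by
    -- The finite limsup controls only times close to `S`; before `s` the bound is the one contained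
    -- in the notion of classical solution.
    obtain ⟨s, hs1, hs2⟩ := exists_between (max_lt haS hS)
    have hs0 : 0 < s := (le_max_right _ _).trans_lt hs1
    obtain ⟨C, hC⟩ := (hsol s hs0 hs2).bounded
    refine ⟨max (max M' C) 1, by positivity, fun t ht0 htS x => ?_⟩
    rcases lt_or_ge t s with hts | hts
    · exact (le_of_abs_le (hC t ⟨ht0.le, hts⟩ x)).trans ((le_max_right _ _).trans (le_max_left _ _))
    · have hta : a < t := ((le_max_left _ _).trans_lt hs1).trans_le hts
      have h1 : (⨆ x, (u t x : EReal)) < (M' : EReal) := ha ⟨hta, htS⟩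
      have h2 : (u t x : EReal) < (M' : EReal) := (le_iSup (fun x => (u t x : EReal)) x).trans_lt h1
      exact (EReal.coe_lt_coe_iff.1 h2).le.trans ((le_max_left _ _).trans (le_max_left _ _))
  set R := max M (c1Norm u₀)
  set N := gradientBound p M S (c1Norm u₀) (gradSupNorm h)
  have hbR : ∀ t, 0 < t → t < S → ∀ x, |u t x| ≤ R := fun t ht htS x => by
    obtain ⟨s, hts, hsS⟩ := exists_between htS
    exact (hsol s (ht.trans hts) hsS).abs_le_max hq hu₀ hh0
      (fun r hr => hM r hr.1 (hr.2.trans hsS)) ⟨ht, hts⟩ x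
  have hbN : ∀ t, 0 < t → t < S → ∀ x, ‖∇ (u t) x‖ ≤ N := fun t ht htS x => by
    refine hu.norm_gradient_le hp hq hu₀ hh hh0 hM0 (fun r hr hrS => ?_) ht ?_ x
    · rw [min_self] at hrS
      exact hM r hr (EReal.coe_lt_coe_iff.1 hrS)
    · rw [min_self]
      exact EReal.coe_lt_coe_iff.2 htS
  have hbdd : ∃ C, ∀ t ∈ Ico 0 S, ∀ x, |u t x| ≤ C := by
    obtain ⟨C, hC⟩ := (hsol (S / 2) (by linarith) (by linarith)).bounded
    refine ⟨max C R, fun t ht x => ?_⟩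
    rcases ht.1.eq_or_lt with h0 | h0
    · exact (hC t ⟨ht.1, by linarith⟩ x).trans (le_max_left _ _)
    · exact (hbR t h0 ht.2 x).trans (le_max_right _ _)
  have hgbdd : ∃ C, ∀ t ∈ Ico 0 S, ∀ x, ‖∇ (u t) x‖ ≤ C := by
    obtain ⟨C, hC⟩ := (hsol (S / 2) (by linarith) (by linarith)).gradient_bounded
    refine ⟨max C N, fun t ht x => ?_⟩
    rcases ht.1.eq_or_lt with h0 | h0
    · exact (hC t ⟨ht.1, by linarith⟩ x).trans (le_max_left _ _)
    · exact (hbN t h0 ht.2 x).trans (le_max_right _ _)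
  -- continuation beyond the existence time
  have hN0 : 0 ≤ N := (gradientBound_pos _ _ _ _ _).le
  obtain ⟨τ, hτ, hloc⟩ := exists_isClassicalSolution (p := p) (q := q) (b := b) hp.le hq hh
    (A := max R N) (hN0.trans (le_max_right _ _))
  -- `τ` was fixed from the uniform `C¹` bound before `t₀` is chosen, so `t₀` can be taken with `t₀
  -- + τ > S`.
  obtain ⟨t₀, ht₀, ht₀S⟩ := exists_between (max_lt (show S - τ < S by linarith) hS)
  have ht₀0 : 0 < t₀ := (le_max_right _ _).trans_lt ht₀
  have ht₀τ : S < t₀ + τ := by linarith [(le_max_left (S - τ) 0).trans_lt ht₀]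
  obtain ⟨s₀, hs₀, hs₀S⟩ := exists_between ht₀S
  have hBC := (hsol s₀ (ht₀0.trans hs₀) hs₀S).isBC1 ⟨ht₀0, hs₀⟩
  obtain ⟨v, hv⟩ := hloc (u t₀) hBC (fun x => (hbR t₀ ht₀0 ht₀S x).trans (le_max_left _ _))
    (fun x => (hbN t₀ ht₀0 ht₀S x).trans (le_max_right _ _))
  have hvu : ∀ t ∈ Ico t₀ S, ∀ x, v (t - t₀) x = u t x := by
    intro t ht x
    obtain ⟨s, hts, hsS⟩ := exists_between ht.2
    have h1 := (hsol s (by linarith [ht.1]) hsS).shift ht₀0.le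
    have h2 := h1.unique hp.le hq (hv.restrict (σ' := s - t₀) (by linarith)) (t := t - t₀)
      ⟨by linarith [ht.1], by linarith⟩ x
    rwa [add_sub_cancel] at h2
  have hglue := IsClassicalSolution.glue hsol hbdd hgbdd ht₀0 ht₀S hv hvu
  have hle := hu.maximal (t₀ + τ) _ (by linarith) hglue fun t _ _ htS x => by
    have : t < S := EReal.coe_lt_coe_iff.1 htS
    simp only [if_pos this]
  exact absurd (EReal.coe_le_coe_iff.1 hle) (not_le.2 ht₀τ)

end BlowUp

theorem proposition1 :
    -- (i) the gradient bound, with `N = N(p, M, τ, ‖u₀‖_{C¹}, ‖∇h‖_∞)`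
    (∃ N : ℝ → ℝ → ℝ → ℝ → ℝ → ℝ, (∀ p M τ A B : ℝ, 0 < N p M τ A B) ∧
      ∀ (n : ℕ) (p q b : ℝ) (h u₀ : EuclideanSpace ℝ (Fin n) → ℝ) (T : EReal)
        (u : ℝ → EuclideanSpace ℝ (Fin n) → ℝ),
        1 ≤ n → 1 < p → 1 ≤ q → IsBC1 u₀ → IsBC1 h → (∀ x, 0 ≤ h x) →
        IsMaximalClassicalSolution p q b h u₀ T u →
        ∀ M τ : ℝ, 0 < M → 0 < τ →
          (∀ t : ℝ, 0 < t → (t : EReal) < min T (τ : EReal) → ∀ x, u t x ≤ M) →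
          ∀ t : ℝ, 0 < t → (t : EReal) < min T (τ : EReal) → ∀ x,
            ‖∇ (u t) x‖ ≤ N p M τ (c1Norm u₀) (gradSupNorm h)) ∧
    -- (ii) blow-up of `sup u` if the existence time is finite
    (∀ (n : ℕ) (p q b : ℝ) (h u₀ : EuclideanSpace ℝ (Fin n) → ℝ) (T : EReal)
        (u : ℝ → EuclideanSpace ℝ (Fin n) → ℝ),
        1 ≤ n → 1 < p → 1 ≤ q → IsBC1 u₀ → IsBC1 h → (∀ x, 0 ≤ h x) →
        IsMaximalClassicalSolution p q b h u₀ T u →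
        T < ⊤ →
          limsup (fun t : ℝ => ⨆ x, (u t x : EReal)) (𝓝[<] T.toReal) = ⊤) := by
  -- The witness is fixed before `n`, `q` and `b` are, so the bound is uniform in them.
  refine ⟨⟨gradientBound, gradientBound_pos, ?_⟩, ?_⟩
  · intro n p q b h u₀ T u _ hp hq hu₀ hh hh0 hu M τ hM _ huM t ht htT x
    exact hu.norm_gradient_le hp hq hu₀ hh hh0 hM huM ht htT x
  · intro n p q b h u₀ T u _ hp hq hu₀ hh hh0 hu hT
    exact hu.limsup_eq_top hp hq hu₀ hh hh0 hT
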